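/- Let $\phi$ be a smooth real-valued function defined on an open neighborhood of the origin in $\mathbb R^2$ with $\phi(0)=0$ and $\nabla\phi(0)=0$. For a smooth real-valued function $f$ near the origin let $c_{jk}(f)=\frac1{j!k!}\partial_1^j\partial_2^kf(0)$ be its Taylor coefficients at the origin and $\mathcal T(f)=\{(j,k)\in\mathbb N^2: c_{jk}(f)\neq 0\}$ its Taylor support, where $\mathbb N=\{0,1,2,\dots\}$. Assume that $\phi$ is of finite type at the origin, i.e. $\mathcal T(\phi)\neq\emptyset$. For $f$ with $\mathcal T(f)\ne\emptyset$, the Newton polyhedron $\mathcal N(f)$ is the convex hull of $\bigcup_{(j,k)\in\mathcal T(f)}\big((j,k)+[0,\infty)^2\big)$. The Newton distance $d(f)$ is the coordinate $d$ of the point $(d,d)$ at which the line $t_1=t_2$ meets the boundary of $\mathcal N(f)$. The principal face $\pi(f)$ is the face (vertex or edge) of $\mathcal N(f)$ of minimal dimension which contains $(d,d)$. If $\pi(f)$ is compact, the principal part of $f$ is the polynomial $f_{\rm pr}(x_1,x_2)=\sum_{(j,k)\in\pi(f)}c_{jk}(f)x_1^jx_2^k$, and $m(f_{\rm pr})$ denotes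 the maximal order of vanishing of $f_{\rm pr}$ at the points of the unit circle $x_1^2+x_2^2=1$. A local coordinate system $y$ at the origin is a smooth diffeomorphism $x\mapsto y(x)$ between open neighborhoods of the origin with $y(0)=0$; we write $\phi^y$ for $\phi$ expressed in the coordinates $y$, i.e. $\phi(x)=\phi^y(y(x))$ for $x$ near the origin. The height is $h(\phi)=\sup_y d(\phi^y)$, where the supremum is over all local coordinate systems $y$ at the origin, and $y$ is called adapted to $\phi$ if $d(\phi^y)=h(\phi)$. Then the following conditions on $\phi$ are equivalent: (a) There exists a local coordinate system $y$ at the origin, adapted to $\phi$, such that $\pi(\phi^y)$ is a vertex. (b) For every local coordinate system $y$ at the origin which is adapted to $\phi$, either $\pi(\phi^y)$ is a vertex, or $\pi(\phi^y)$ is a compact edge and $m(\phi^y_{\rm pr})=d(\phi^y)$. -/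

import Mathlib

open scoped ContDiff

noncomputable section

namespace Newton

/-- The Taylor coefficient `c_{jk} = (1 / (j! k!)) ∂₁ʲ ∂₂ᵏ f (x)` of `f` at the point `x`. -/
def taylorCoeff (f : ℝ × ℝ → ℝ) (x : ℝ × ℝ) (j k : ℕ) : ℝ :=
  iteratedDeriv j (fun s : ℝ => iteratedDeriv k (fun t : ℝ => f (s, t)) x.2) x.1 /
    ((j.factorial : ℝ) * (k.factorial : ℝ))

/-- The Taylor support of `f` at the point `x`. -/
def taylorSupport (f : ℝ × ℝ → ℝ) (x : ℝ × ℝ) : Set (ℕ × ℕ) :=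
  {p | taylorCoeff f x p.1 p.2 ≠ 0}

/-- The order of vanishing of `f` at `x`: the least order of a partial derivative of `f` that
does not vanish at `x` (and `⊤` if there is none). -/
def vanishingOrder (f : ℝ × ℝ → ℝ) (x : ℝ × ℝ) : ℕ∞ :=
  ⨅ p ∈ taylorSupport f x, ((p.1 + p.2 : ℕ) : ℕ∞)

/-- The maximal order of vanishing of `f` along the unit circle centered at the origin. -/
def circleOrder (f : ℝ × ℝ → ℝ) : ℕ∞ :=
  ⨆ x ∈ {x : ℝ × ℝ | x.1 ^ 2 + x.2 ^ 2 = 1}, vanishingOrder f x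

/-- The Newton polyhedron of `f` at the origin: the convex hull of the union of the quadrants
`(j, k) + [0, ∞)²`, where `(j, k)` runs through the Taylor support of `f` at the origin. -/
def polyhedron (f : ℝ × ℝ → ℝ) : Set (ℝ × ℝ) :=
  convexHull ℝ (⋃ p ∈ taylorSupport f 0, {t : ℝ × ℝ | (p.1 : ℝ) ≤ t.1 ∧ (p.2 : ℝ) ≤ t.2})

/-- The Newton distance `d`: the bisectrix `t₁ = t₂` enters the Newton polyhedron, which is closed
and stable under addition of `[0, ∞)²`, at its unique boundary point `(d, d)` on the
bisectrix. -/
def distance (f : ℝ × ℝ → ℝ) : ℝ :=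
  sInf {t : ℝ | (t, t) ∈ polyhedron f}

/-- The faces of dimension at most one (vertices and edges) of a convex polyhedron `N` in the
plane: the nonempty intersections of `N` with its supporting lines. -/
def IsFace (N F : Set (ℝ × ℝ)) : Prop :=
  F.Nonempty ∧ ∃ a b c : ℝ, (a ≠ 0 ∨ b ≠ 0) ∧ (∀ t ∈ N, c ≤ a * t.1 + b * t.2) ∧
    F = {t | t ∈ N ∧ a * t.1 + b * t.2 = c}

/-- The (affine) dimension of a face. -/
def faceDim (F : Set (ℝ × ℝ)) : ℕ :=
  Module.finrank ℝ (vectorSpan ℝ F)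

/-- `F` is the principal face of the Newton polyhedron of `f`: the face of minimal dimension
which contains the point `(d, d)`. -/
def IsPrincipalFace (f : ℝ × ℝ → ℝ) (F : Set (ℝ × ℝ)) : Prop :=
  IsFace (polyhedron f) F ∧ (distance f, distance f) ∈ F ∧
    ∀ G : Set (ℝ × ℝ), IsFace (polyhedron f) G → (distance f, distance f) ∈ G →
      faceDim F ≤ faceDim G

/-- A face is a vertex if it consists of a single point. -/
def IsVertex (F : Set (ℝ × ℝ)) : Prop :=
  ∃ v : ℝ × ℝ, F = {v}

/-- A face is a compact edge if it is one-dimensional and compact. -/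
def IsCompactEdge (F : Set (ℝ × ℝ)) : Prop :=
  faceDim F = 1 ∧ IsCompact F

/-- The polynomial function `∑ c_{jk} x₁ʲ x₂ᵏ`, where the sum runs over the `(j, k)` in `F`, for a
compact set `F` (which contains only finitely many `(j, k)`). For the principal face `F` of `f`
this is the principal part of `f`. -/
def facePart (f : ℝ × ℝ → ℝ) (F : Set (ℝ × ℝ)) (x : ℝ × ℝ) : ℝ :=
  ∑ᶠ p ∈ {p : ℕ × ℕ | ((p.1 : ℝ), (p.2 : ℝ)) ∈ F},
    taylorCoeff f 0 p.1 p.2 * x.1 ^ p.1 * x.2 ^ p.2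

/-- A local coordinate system `y = e x` at the origin: a smooth diffeomorphism between open
neighborhoods of the origin which preserves the origin. -/
def IsLocalCoordinates (e : OpenPartialHomeomorph (ℝ × ℝ) (ℝ × ℝ)) : Prop :=
  (0 : ℝ × ℝ) ∈ e.source ∧ e 0 = 0 ∧
    ContDiffOn ℝ ∞ e e.source ∧ ContDiffOn ℝ ∞ e.symm e.target

/-- The function `f` expressed in the coordinates `y = e x`, that is `f x = inCoordinates f e y`
for `x` near the origin. Only its germ at the origin is meaningful. -/
def inCoordinates (f : ℝ × ℝ → ℝ) (e : OpenPartialHomeomorph (ℝ × ℝ) (ℝ × ℝ)) : ℝ × ℝ → ℝ :=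
  fun y => f (e.symm y)

/-- The height of `f`: the supremum of the Newton distances of `f` in all local coordinate systems
at the origin. For smooth `f` of finite type the distances are bounded by the order of vanishing
of `f` at the origin, which does not depend on the coordinates. -/
def height (f : ℝ × ℝ → ℝ) : ℝ :=
  sSup {d : ℝ | ∃ e : OpenPartialHomeomorph (ℝ × ℝ) (ℝ × ℝ),
    IsLocalCoordinates e ∧ d = distance (inCoordinates f e)}

/-- The local coordinate system `y = e x` is adapted to `f`. -/
def IsAdapted (f : ℝ × ℝ → ℝ) (e : OpenPartialHomeomorph (ℝ × ℝ) (ℝ × ℝ)) : Prop :=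
  IsLocalCoordinates e ∧ height f = distance (inCoordinates f e)

end Newton

end

section

open scoped ContDiff Pointwise
open Filter Topology Asymptotics Finset

namespace Newton

/-! ### Taylor expansion with remainder in one and two variables -/

section

/-! Everything is read off from weighted initial forms. For integer weights `p, q ≥ 1` the part of
weighted degree `N` of the Taylor series is the limit of `s⁻ᴺ f(s^p u, s^q v)` as `s → 0⁺`, provided
the weighted order is at least `N` (`tendsto_initForm`, `ordGE_of_tendsto`); so it is transported by
any coordinate change whose leading behaviour for these weights is known. Integer weights also
suffice to bound the Newton distance `d` (`distance_le_of_weights`). By the implicit function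
theorem every coordinate change becomes, after a possible swap and one shear `(u, v) ↦ (u, v +
ψ(u))`, linear and triangular to leading order for all weights `p ≤ q` at once (`exists_shear_wlim`,
`exists_normal_form`). Thus only shears matter.

A shear can raise `d` only if some line of weights `(1, k)` is principal and its initial form has a
root `v = c uᵏ`, `c ≠ 0`, of multiplicity greater than `d`. Coordinates without such a bad root, in
either order of the variables, are called good. In good coordinates `d` is maximal
(`Good.distance_le`), while a bad root can be sheared away with a strict gain (`Bad.lt_distance`).
If the removal of bad roots never ended, the exponents would increase strictly, and the Borel sum of
the shears could have a bad root only with an exponent above all of them; so good coordinates exist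
(`exists_good`). Hence adapted means good, and the height is attained.

(b) ⇒ (a): in good coordinates with a compact principal edge, a root of multiplicity `d` on the
circle lies off the axes, because the edge has support points strictly on both sides of the
bisectrix. Counting monomials forces one weight to be 1 (`EdgeLine.eq_one`). The shear that moves
the root onto an axis cannot raise `d`, so `(d, d)` must be in the support, where it is an extreme
point of the edge line and therefore a vertex (`IsAdapted.exists_diagVertex_of_le`).

(a) ⇒ (b): goodness bounds the multiplicities by `d` in every adapted system. Conversely, if `(d,
d)` is a vertex for `f`, the part of `f` on any line of positive weights through `(d, d)` is
divisible by `u^d` or `v^d`. The normal form carries a factor of multiplicity `d` to the principal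
part of the other system, where it vanishes along a curve from the origin across the unit circle
(`Good.le_circleOrder_of_le`). An unbounded principal face is incompatible with the vertex
(`DiagVertex.of_le_snd`). -/

theorem isBigO_pow_of_hasDerivAt {F F' : ℝ → ℝ} {M : ℕ} (h0 : F 0 = 0)
    (hF : ∀ᶠ x in 𝓝 (0 : ℝ), HasDerivAt F (F' x) x)
    (hO : F' =O[𝓝 0] (fun x => x ^ M)) : F =O[𝓝 0] (fun x => x ^ (M + 1)) := by
  obtain ⟨C, hC⟩ := hO.bound
  obtain ⟨r, hr, hball⟩ := Metric.eventually_nhds_iff.1 (hF.and hC)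
  refine IsBigO.of_bound C ?_
  refine Metric.eventually_nhds_iff.2 ⟨r, hr, fun x hx => ?_⟩
  have hsub : ∀ y ∈ Set.uIcc (0 : ℝ) x, |y| ≤ |x| := by
    intro y hy
    have := Set.abs_sub_left_of_mem_uIcc hy
    simpa using this
  have key := (convex_uIcc (0 : ℝ) x).norm_image_sub_le_of_norm_hasDerivWithin_le
    (f := F) (f' := F') (C := C * |x| ^ M)
    (fun y hy => (hball (by
      have := hsub y hy
      simp only [dist_zero_right, Real.norm_eq_abs] at hx ⊢; linarith)).1.hasDerivWithinAt)
    (fun y hy => by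
      have h1 := hsub y hy
      have h2 := (hball (y := y) (by
        simp only [dist_zero_right, Real.norm_eq_abs] at hx ⊢; linarith)).2
      -- The constant `C` has no sign a priori. Where the power does not vanish, the bound itself
      -- forces `0 ≤ C`; a negative `C` is refuted below at a nonzero point of the ball.
      have hC0 : 0 ≤ C ∨ |y| ^ M = 0 := by
        by_contra hcon
        push Not at hcon
        have h3 : 0 < |y| ^ M := lt_of_le_of_ne (by positivity) (Ne.symm hcon.2)
        rw [norm_pow, Real.norm_eq_abs y] at h2
        have := norm_nonneg (F' y)
        nlinarith
      rw [norm_pow, Real.norm_eq_abs y] at h2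
      rcases hC0 with hC0 | hC0
      · exact h2.trans (by gcongr)
      · by_cases hC1 : 0 ≤ C
        · exact h2.trans (by gcongr)
        · exfalso
          have h4 := (hball (y := x) hx).2
          have hM : M ≠ 0 := by
            rintro rfl; simp at hC0
          by_cases hx0 : x = 0
          · subst hx0
            have h5 : ∀ᶠ z in 𝓝[≠] (0:ℝ), dist z 0 < r :=
              nhdsWithin_le_nhds (Metric.ball_mem_nhds _ hr)
            obtain ⟨z, hz, hz0⟩ := (h5.and self_mem_nhdsWithin).exists
            have := (hball hz).2
            have h7 : 0 < ‖z ^ M‖ := norm_pos_iff.2 (pow_ne_zero _ hz0)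
            have := norm_nonneg (F' z)
            nlinarith
          · have h7 : 0 < ‖x ^ M‖ := norm_pos_iff.2 (pow_ne_zero _ hx0)
            have := norm_nonneg (F' x)
            nlinarith)
    Set.left_mem_uIcc Set.right_mem_uIcc
  rw [h0, sub_zero, sub_zero] at key
  calc ‖F x‖ ≤ C * |x| ^ M * ‖x‖ := key
    _ = C * ‖x ^ (M + 1)‖ := by rw [norm_pow, Real.norm_eq_abs, pow_succ, mul_assoc]

theorem contDiffAt_deriv {g : ℝ → ℝ} {x : ℝ} (hg : ContDiffAt ℝ ∞ g x) :
    ContDiffAt ℝ ∞ (deriv g) x := by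
  have h := (hg.fderiv_right (m := ∞) (by simp)).clm_apply
    (contDiffAt_const (c := (1 : ℝ)))
  exact h

theorem eventually_differentiableAt {E : Type*} [NormedAddCommGroup E] [NormedSpace ℝ E]
    {g : E → ℝ} {x : E} (hg : ContDiffAt ℝ ∞ g x) :
    ∀ᶠ y in 𝓝 x, DifferentiableAt ℝ g y := by
  have h1 : ContDiffAt ℝ 1 g x := hg.of_le (by exact_mod_cast le_top)
  filter_upwards [h1.eventually (by simp)] with y hy
  exact hy.differentiableAt (by simp)

/-- One-dimensional Taylor expansion at the origin. -/
theorem taylor_isBigO_one {g : ℝ → ℝ} (hg : ContDiffAt ℝ ∞ g 0) (M : ℕ) :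
    (fun x => g x - ∑ n ∈ range M, iteratedDeriv n g 0 / (n.factorial : ℝ) * x ^ n)
      =O[𝓝 0] (fun x => x ^ M) := by
  induction M generalizing g with
  | zero =>
    simpa using hg.continuousAt.isBigO_one ℝ
  | succ M ih =>
    -- The derivative of the remainder is the remainder of `deriv g`, one order lower.
    refine isBigO_pow_of_hasDerivAt (F' := fun x => deriv g x -
      ∑ n ∈ range M, iteratedDeriv n (deriv g) 0 / (n.factorial : ℝ) * x ^ n) ?_ ?_
      (ih (contDiffAt_deriv hg))
    · simp [Finset.sum_range_succ']
    · filter_upwards [eventually_differentiableAt hg] with x hx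
      refine hx.hasDerivAt.sub ?_
      simp_rw [Finset.sum_range_succ']
      have : ∀ n ∈ range M, HasDerivAt
          (fun y : ℝ => iteratedDeriv (n + 1) g 0 / ((n + 1).factorial : ℝ) * y ^ (n + 1))
          (iteratedDeriv n (deriv g) 0 / (n.factorial : ℝ) * x ^ n) x := by
        intro n _
        have h := (hasDerivAt_pow (n + 1) x).const_mul
          (iteratedDeriv (n + 1) g 0 / ((n + 1).factorial : ℝ))
        refine h.congr_deriv ?_
        rw [iteratedDeriv_succ', Nat.factorial_succ]
        push_cast
        field_simp
      simpa using (HasDerivAt.fun_sum this).add_const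
        (iteratedDeriv 0 g 0 / (Nat.factorial 0 : ℝ) * x ^ 0)

/-- The partial derivative in the second variable. -/
noncomputable def partialSnd (f : ℝ × ℝ → ℝ) (x : ℝ × ℝ) : ℝ := deriv (fun t => f (x.1, t)) x.2

theorem hasDerivAt_snd {f : ℝ × ℝ → ℝ} {x : ℝ × ℝ} (hf : DifferentiableAt ℝ f x) :
    HasDerivAt (fun t => f (x.1, t)) (fderiv ℝ f x (0, 1)) x.2 := by
  have h1 : HasDerivAt (fun t : ℝ => (x.1, t)) ((0 : ℝ), (1 : ℝ)) x.2 :=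
    (hasDerivAt_const _ _).prodMk (hasDerivAt_id _)
  exact HasFDerivAt.comp_hasDerivAt (x := x.2) (f := fun t : ℝ => (x.1, t)) (l := f)
    (l' := fderiv ℝ f x) hf.hasFDerivAt h1

theorem contDiffAt_partialSnd {f : ℝ × ℝ → ℝ} {x : ℝ × ℝ} (hf : ContDiffAt ℝ ∞ f x) :
    ContDiffAt ℝ ∞ (partialSnd f) x := by
  have h := (hf.fderiv_right (m := ∞) (by simp)).clm_apply
    (contDiffAt_const (c := ((0 : ℝ), (1 : ℝ))))
  refine h.congr_of_eventuallyEq ?_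
  filter_upwards [eventually_differentiableAt hf] with y hy
  exact (hasDerivAt_snd hy).deriv

/-- The inner derivative of `taylorCoeff` is the one in the second variable, so `∂₂` merely shifts
the inner index. The induction built on this never interchanges mixed partial derivatives. -/
theorem taylorCoeff_partialSnd (f : ℝ × ℝ → ℝ) (x : ℝ × ℝ) (j k : ℕ) :
    taylorCoeff (partialSnd f) x j k = (k + 1) * taylorCoeff f x j (k + 1) := by
  simp only [taylorCoeff, iteratedDeriv_succ' (n := k), Nat.factorial_succ]
  have : (fun s : ℝ => iteratedDeriv k (fun t => partialSnd f (s, t)) x.2) =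
    fun s : ℝ => iteratedDeriv k (deriv fun t => f (s, t)) x.2 := rfl
  rw [this]
  push_cast
  field_simp

/-- The Taylor polynomial with coefficients `a` and total degree less than `M`. -/
noncomputable def jet (a : ℕ → ℕ → ℝ) (M : ℕ) (h : ℝ × ℝ) : ℝ :=
  ∑ j ∈ range M, ∑ k ∈ range (M - j), a j k * h.1 ^ j * h.2 ^ k

theorem hasDerivAt_jet (a : ℕ → ℕ → ℝ) (M : ℕ) (h : ℝ × ℝ) :
    HasDerivAt (fun t => jet a (M + 1) (h.1, t))
      (jet (fun j k => (k + 1) * a j (k + 1)) M h) h.2 := by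
  have h1 : ∀ t, jet a (M + 1) (h.1, t) = ∑ j ∈ range (M + 1),
      (a j 0 * h.1 ^ j + ∑ k ∈ range (M - j), a j (k + 1) * h.1 ^ j * t ^ (k + 1)) := by
    intro t
    refine Finset.sum_congr rfl fun j hj => ?_
    have : M + 1 - j = (M - j) + 1 := by simp at hj; omega
    rw [this, Finset.sum_range_succ']
    simp [add_comm]
  have h2 : jet (fun j k => (k + 1) * a j (k + 1)) M h = ∑ j ∈ range (M + 1),
      (0 + ∑ k ∈ range (M - j), (k + 1) * a j (k + 1) * h.1 ^ j * h.2 ^ k) := by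
    simp [jet, Finset.sum_range_succ _ M]
  rw [h2, funext h1]
  refine HasDerivAt.fun_sum fun j _ => (hasDerivAt_const _ _).add (HasDerivAt.fun_sum fun k _ => ?_)
  have := (hasDerivAt_pow (k + 1) h.2).const_mul (a j (k + 1) * h.1 ^ j)
  refine this.congr_deriv ?_
  push_cast
  ring

theorem jet_axis (a : ℕ → ℕ → ℝ) (M : ℕ) (s : ℝ) :
    jet a M (s, 0) = ∑ j ∈ range M, a j 0 * s ^ j := by
  refine Finset.sum_congr rfl fun j hj => ?_
  have : M - j = (M - j - 1) + 1 := by simp at hj; omega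
  rw [this, Finset.sum_range_succ']
  simp

theorem isBigO_fst_pow (M : ℕ) :
    (fun h : ℝ × ℝ => h.1 ^ M) =O[𝓝 0] (fun h => ‖h‖ ^ M) :=
  IsBigO.pow (IsBigO.of_bound 1 (Eventually.of_forall fun h => by
    simpa using norm_fst_le h)) M

/-- Mean value inequality on the vertical segment from `(h.1, 0)` to `h`, whose points have sup norm
at most `‖h‖`. -/
theorem isBigO_norm_pow_of_hasDerivAt {G G' : ℝ × ℝ → ℝ} {M : ℕ}
    (hG : ∀ᶠ h in 𝓝 (0 : ℝ × ℝ), HasDerivAt (fun t => G (h.1, t)) (G' h) h.2)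
    (hO : G' =O[𝓝 0] (fun h => ‖h‖ ^ M))
    (h0 : (fun h : ℝ × ℝ => G (h.1, 0)) =O[𝓝 0] (fun h => ‖h‖ ^ (M + 1))) :
    G =O[𝓝 0] (fun h => ‖h‖ ^ (M + 1)) := by
  obtain ⟨C, hC0, hC⟩ := hO.exists_nonneg
  obtain ⟨r, hr, hball⟩ := Metric.eventually_nhds_iff.1 (hG.and hC.bound)
  suffices h : (fun h : ℝ × ℝ => G h - G (h.1, 0)) =O[𝓝 0] (fun h => ‖h‖ ^ (M + 1)) by
    simpa using h.add h0
  refine IsBigO.of_bound C (Metric.eventually_nhds_iff.2 ⟨r, hr, fun h hh => ?_⟩)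
  have hsub : ∀ y ∈ Set.uIcc (0 : ℝ) h.2, ‖(h.1, y)‖ ≤ ‖h‖ := by
    intro y hy
    have := Set.abs_sub_left_of_mem_uIcc hy
    simp only [sub_zero] at this
    rw [Prod.norm_def, Prod.norm_def]
    exact max_le_max le_rfl this
  have key := (convex_uIcc (0 : ℝ) h.2).norm_image_sub_le_of_norm_hasDerivWithin_le
    (f := fun t => G (h.1, t)) (f' := fun t => G' (h.1, t)) (C := C * ‖h‖ ^ M)
    (fun y hy => (hball (y := (h.1, y)) (by
      have := hsub y hy
      simp only [dist_zero_right] at hh ⊢; linarith)).1.hasDerivWithinAt)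
    (fun y hy => by
      have h1 := hsub y hy
      have h2 := (hball (y := (h.1, y)) (by
        simp only [dist_zero_right] at hh ⊢; linarith)).2
      rw [norm_pow, norm_norm] at h2
      exact h2.trans (by gcongr))
    Set.left_mem_uIcc Set.right_mem_uIcc
  calc ‖G h - G (h.1, 0)‖ ≤ C * ‖h‖ ^ M * ‖h.2 - 0‖ := key
    _ ≤ C * ‖h‖ ^ M * ‖h‖ := by
        rw [sub_zero]; gcongr; exact norm_snd_le h
    _ = C * ‖‖h‖ ^ (M + 1)‖ := by rw [norm_pow, norm_norm, pow_succ, mul_assoc]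

theorem contDiffAt_axis {f : ℝ × ℝ → ℝ} (hf : ContDiffAt ℝ ∞ f 0) :
    ContDiffAt ℝ ∞ (fun s : ℝ => f (s, 0)) 0 := by
  have h1 : ContDiffAt ℝ ∞ (fun s : ℝ => (s, (0 : ℝ))) 0 := by fun_prop
  exact ContDiffAt.comp (g := f) (0 : ℝ) hf h1

/-- Taylor expansion in two variables. -/
theorem taylor_isBigO {f : ℝ × ℝ → ℝ} (hf : ContDiffAt ℝ ∞ f 0) (M : ℕ) :
    (fun h => f h - jet (taylorCoeff f 0) M h) =O[𝓝 0] (fun h => ‖h‖ ^ M) := by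
  induction M generalizing f with
  | zero => simpa [jet] using hf.continuousAt.isBigO_one ℝ
  | succ M ih =>
    refine isBigO_norm_pow_of_hasDerivAt
      (G' := fun h => partialSnd f h - jet (taylorCoeff (partialSnd f) 0) M h) ?_
      (ih (contDiffAt_partialSnd hf)) ?_
    · filter_upwards [eventually_differentiableAt hf] with h hh
      have h1 : taylorCoeff (partialSnd f) 0 = fun j k => (k + 1) * taylorCoeff f 0 j (k + 1) := by
        funext j k; rw [taylorCoeff_partialSnd]
      rw [h1]
      exact ((hasDerivAt_snd hh).differentiableAt.hasDerivAt).sub (hasDerivAt_jet _ M h)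
    · have h1 := taylor_isBigO_one (contDiffAt_axis hf) (M + 1)
      have h2 : Tendsto (fun h : ℝ × ℝ => h.1) (𝓝 0) (𝓝 0) := continuous_fst.tendsto' _ _ rfl
      refine ((h1.comp_tendsto h2).trans (isBigO_fst_pow (M + 1))).congr_left fun h => ?_
      simp only [jet_axis, Function.comp]
      congr 1
      refine Finset.sum_congr rfl fun j _ => ?_
      simp [taylorCoeff]

end

/-! ### Uniqueness of Taylor coefficients; weighted initial forms -/

section

theorem eq_zero_of_mul_pow_isBigO {A : ℝ} {n : ℕ}
    (h : (fun s : ℝ => A * s ^ n) =O[𝓝[>] 0] (fun s => s ^ (n + 1))) : A = 0 := by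
  have h1 : (fun s : ℝ => A * s ^ n * (s ^ n)⁻¹) =O[𝓝[>] 0] (fun s => s ^ (n + 1) * (s ^ n)⁻¹) :=
    h.mul (isBigO_refl _ _)
  have h2 : (fun _ : ℝ => A) =O[𝓝[>] 0] (fun s : ℝ => s) := by
    refine h1.congr' ?_ ?_ <;>
    · filter_upwards [self_mem_nhdsWithin] with s hs
      have : s ≠ 0 := ne_of_gt hs
      field_simp
      try ring
  have h3 : Tendsto (fun s : ℝ => s) (𝓝[>] 0) (𝓝 0) := nhdsWithin_le_nhds
  exact tendsto_nhds_unique tendsto_const_nhds (h2.trans_tendsto h3)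

/-- The coefficients of a Taylor expansion are unique. -/
theorem jet_coeff_eq_zero {b : ℕ → ℕ → ℝ}
    (h : ∀ M, jet b M =O[𝓝 0] (fun h : ℝ × ℝ => ‖h‖ ^ M)) (j k : ℕ) : b j k = 0 := by
  suffices H : ∀ n j k, j + k < n → b j k = 0 from H (j + k + 1) j k (Nat.lt_succ_self _)
  intro n
  induction n with
  | zero => intro j k hjk; omega
  | succ n ih =>
    -- On the line of slope `v` the terms below degree `n` vanish by induction, and those of degree
    -- `n` give `sⁿ` times a polynomial in `v`, which must be zero to be `O(sⁿ⁺¹)`.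
    have hjet : ∀ s v : ℝ, jet b (n + 1) (s, s * v) =
        (∑ j ∈ range (n + 1), b j (n - j) * v ^ (n - j)) * s ^ n := by
      intro s v
      rw [jet, Finset.sum_mul]
      refine Finset.sum_congr rfl fun j hj => ?_
      have hj' : j ≤ n := by simpa [Nat.lt_succ_iff] using hj
      rw [Finset.sum_eq_single (n - j)]
      · have : s ^ n = s ^ j * s ^ (n - j) := by rw [← pow_add]; congr 1; omega
        simp only [mul_pow, this]; ring
      · intro k hk hk'
        have : j + k < n := by simp at hk; omega
        simp [ih j k this]
      · intro hn; exfalso; apply hn; simp; omega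
    have hzero : ∀ v : ℝ, ∑ j ∈ range (n + 1), b j (n - j) * v ^ (n - j) = 0 := by
      intro v
      have ht : Tendsto (fun s : ℝ => (s, s * v)) (𝓝[>] 0) (𝓝 (0 : ℝ × ℝ)) := by
        have : Continuous (fun s : ℝ => (s, s * v)) := by fun_prop
        exact (this.tendsto' 0 0 (by simp)).mono_left nhdsWithin_le_nhds
      have h1 := (h (n + 1)).comp_tendsto ht
      refine eq_zero_of_mul_pow_isBigO (n := n) ?_
      refine (h1.congr_left fun s => hjet s v).trans ?_
      have h2 : (fun s : ℝ => ‖(s, s * v)‖) =O[𝓝[>] 0] (fun s => s) := by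
        refine IsBigO.of_bound (max 1 |v|) (Eventually.of_forall fun s => ?_)
        rw [norm_norm, Prod.norm_def]
        refine max_le ?_ ?_
        · exact le_mul_of_one_le_left (norm_nonneg _) (le_max_left _ _)
        · simp only [norm_mul, Real.norm_eq_abs]
          rw [mul_comm]; gcongr; exact le_max_right _ _
      exact h2.pow (n + 1)
    have hpoly : (∑ j ∈ range (n + 1), Polynomial.monomial (n - j) (b j (n - j)) :
        Polynomial ℝ) = 0 := by
      refine Polynomial.funext fun v => ?_
      simpa [Polynomial.eval_finsetSum] using hzero v
    intro j k hjk
    rcases Nat.lt_or_ge (j + k) n with hlt | hge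
    · exact ih j k hlt
    · have hk : k = n - j := by omega
      have hc := congrArg (fun P => Polynomial.coeff P k) hpoly
      simp only [Polynomial.finsetSum_coeff, Polynomial.coeff_monomial,
        Polynomial.coeff_zero] at hc
      rw [Finset.sum_eq_single j] at hc
      · rw [if_pos hk.symm] at hc; rw [hk]; exact hc
      · intro i hi hij
        rw [if_neg]; simp at hi; omega
      · intro hn; exfalso; apply hn; simp; omega

theorem jet_sub (a b : ℕ → ℕ → ℝ) (M : ℕ) (h : ℝ × ℝ) :
    jet (fun j k => a j k - b j k) M h = jet a M h - jet b M h := by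
  simp only [jet, ← Finset.sum_sub_distrib, sub_mul]

theorem taylorCoeff_eq_of_isBigO {f : ℝ × ℝ → ℝ} (hf : ContDiffAt ℝ ∞ f 0) {a : ℕ → ℕ → ℝ}
    (ha : ∀ M, (fun h => f h - jet a M h) =O[𝓝 0] (fun h : ℝ × ℝ => ‖h‖ ^ M)) :
    taylorCoeff f 0 = a := by
  funext j k
  rw [← sub_eq_zero]
  refine jet_coeff_eq_zero (b := fun j k => taylorCoeff f 0 j k - a j k) (fun M => ?_) j k
  refine ((ha M).sub (taylor_isBigO hf M)).congr_left fun h => ?_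
  rw [jet_sub]; ring

theorem tendsto_swap_zero : Tendsto (Prod.swap : ℝ × ℝ → ℝ × ℝ) (𝓝 0) (𝓝 0) :=
  continuous_swap.tendsto' _ _ rfl

theorem contDiffAt_comp_swap {f : ℝ × ℝ → ℝ} {x : ℝ × ℝ} (hf : ContDiffAt ℝ ∞ f x.swap) :
    ContDiffAt ℝ ∞ (f ∘ Prod.swap) x := by
  have h1 : ContDiffAt ℝ ∞ (Prod.swap : ℝ × ℝ → ℝ × ℝ) x := by
    have : ContDiffAt ℝ ∞ (fun x : ℝ × ℝ => (x.2, x.1)) x := by fun_prop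
    exact this
  exact ContDiffAt.comp x hf h1

theorem jet_swap (a : ℕ → ℕ → ℝ) (M : ℕ) (h : ℝ × ℝ) :
    jet a M h.swap = jet (fun j k => a k j) M h := by
  simp only [jet, Prod.fst_swap, Prod.snd_swap]
  rw [Finset.sum_comm' (t' := range M) (s' := fun k => range (M - k))]
  · refine Finset.sum_congr rfl fun j _ => Finset.sum_congr rfl fun k _ => by ring
  · intro x y; simp; omega

theorem norm_prod_swap (h : ℝ × ℝ) : ‖h.swap‖ = ‖h‖ := by
  simp [Prod.norm_def, max_comm]

/-- Uniqueness of the expansion stands in for the symmetry of mixed partial derivatives. -/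
theorem taylorCoeff_swap {f : ℝ × ℝ → ℝ} (hf : ContDiffAt ℝ ∞ f 0) (j k : ℕ) :
    taylorCoeff (f ∘ Prod.swap) 0 j k = taylorCoeff f 0 k j := by
  have := taylorCoeff_eq_of_isBigO (f := f ∘ Prod.swap) (contDiffAt_comp_swap (x := 0) hf)
    (a := fun j k => taylorCoeff f 0 k j) fun M => by
      have h1 := (taylor_isBigO hf M).comp_tendsto tendsto_swap_zero
      refine (h1.congr_left fun h => ?_).congr_right fun h => ?_
      · simp [Function.comp, jet_swap]
      · simp only [Function.comp, norm_prod_swap]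
  rw [this]

theorem taylorCoeff_translate (f : ℝ × ℝ → ℝ) (x : ℝ × ℝ) (j k : ℕ) :
    taylorCoeff f x j k = taylorCoeff (fun h => f (x + h)) 0 j k := by
  simp only [taylorCoeff]
  congr 1
  have h1 : ∀ s : ℝ, iteratedDeriv k (fun t => f (x + (s, t))) 0 =
      iteratedDeriv k (fun t => f (x.1 + s, t)) x.2 := by
    intro s
    have := congrFun (iteratedDeriv_comp_const_add k (fun t => f (x.1 + s, t)) x.2) 0
    rw [add_zero] at this
    rw [← this]
    congr 1
  have h2 := congrFun (iteratedDeriv_comp_const_add j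
    (fun s => iteratedDeriv k (fun t => f (s, t)) x.2) x.1) 0
  simp only [Prod.fst_zero, Prod.snd_zero]
  rw [funext h1, h2, add_zero]

/-- The exponents on the line `p j + q k = N`. -/
def line (p q N : ℕ) : Finset (ℕ × ℕ) :=
  (range (N + 1) ×ˢ range (N + 1)).filter fun x => p * x.1 + q * x.2 = N

theorem mem_line {p q N : ℕ} (hp : 1 ≤ p) (hq : 1 ≤ q) {x : ℕ × ℕ} :
    x ∈ line p q N ↔ p * x.1 + q * x.2 = N := by
  simp only [line, mem_filter, mem_product, mem_range, and_iff_right_iff_imp]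
  intro h
  constructor <;> nlinarith

/-- The weighted homogeneous part of degree `N` of the Taylor series of `f`. -/
noncomputable def initForm (f : ℝ × ℝ → ℝ) (p q N : ℕ) (u v : ℝ) : ℝ :=
  ∑ x ∈ line p q N, taylorCoeff f 0 x.1 x.2 * u ^ x.1 * v ^ x.2

/-- The weighted order of the Taylor series of `f` is at least `N`. -/
def OrdGE (f : ℝ × ℝ → ℝ) (p q N : ℕ) : Prop :=
  ∀ x ∈ taylorSupport f 0, N ≤ p * x.1 + q * x.2

theorem taylorCoeff_eq_zero_of_ordGE {f : ℝ × ℝ → ℝ} {p q N j k : ℕ} (h : OrdGE f p q N)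
    (hjk : p * j + q * k < N) : taylorCoeff f 0 j k = 0 := by
  by_contra hc
  have := h (j, k) hc
  simp at this; omega

/-- The weighted homogeneous part of degree `N`, for a fixed value
of the first variable, as a polynomial in the second one. -/
noncomputable def edgePoly (f : ℝ × ℝ → ℝ) (p q N : ℕ) (u : ℝ) : Polynomial ℝ :=
  ∑ x ∈ line p q N, Polynomial.monomial x.2 (taylorCoeff f 0 x.1 x.2 * u ^ x.1)

theorem edgePoly_eval (f : ℝ × ℝ → ℝ) (p q N : ℕ) (u v : ℝ) :
    (edgePoly f p q N u).eval v = initForm f p q N u v := by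
  simp [edgePoly, initForm, Polynomial.eval_finsetSum]

/-- On the line the second exponent determines the first, so no two monomials merge when `u` is
fixed. -/
theorem edgePoly_coeff {f : ℝ × ℝ → ℝ} {p q N : ℕ} (hp : 1 ≤ p) (hq : 1 ≤ q) {u : ℝ} {j k : ℕ}
    (h : p * j + q * k = N) : (edgePoly f p q N u).coeff k = taylorCoeff f 0 j k * u ^ j := by
  simp only [edgePoly, Polynomial.finsetSum_coeff, Polynomial.coeff_monomial]
  rw [Finset.sum_eq_single (j, k)]
  · simp
  · rintro ⟨j', k'⟩ hx hne
    rw [mem_line hp hq] at hx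
    rw [if_neg]
    rintro rfl
    apply hne
    have : p * j' = p * j := by dsimp only at hx h; omega
    have := Nat.eq_of_mul_eq_mul_left (by omega) this
    simp [this]
  · intro hn; exact absurd ((mem_line hp hq).2 h) hn

theorem exists_of_edgePoly_coeff_ne_zero {f : ℝ × ℝ → ℝ} {p q N : ℕ} (hp : 1 ≤ p) (hq : 1 ≤ q)
    {u : ℝ} {k : ℕ} (h : (edgePoly f p q N u).coeff k ≠ 0) :
    ∃ j, p * j + q * k = N ∧ (j, k) ∈ taylorSupport f 0 := by
  by_contra hcon
  push Not at hcon
  apply h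
  simp only [edgePoly, Polynomial.finsetSum_coeff, Polynomial.coeff_monomial]
  refine Finset.sum_eq_zero fun x hx => ?_
  rw [mem_line hp hq] at hx
  split_ifs with hk
  · subst hk
    have := hcon x.1 hx
    simp only [taylorSupport, Set.mem_ofPred_eq, not_not] at this
    simp [this]
  · rfl

theorem initForm_coeff_eq {f g : ℝ × ℝ → ℝ} {p q N : ℕ} (hp : 1 ≤ p) (hq : 1 ≤ q)
    (h : ∀ v, initForm f p q N 1 v = initForm g p q N 1 v) {j k : ℕ} (hjk : p * j + q * k = N) :
    taylorCoeff f 0 j k = taylorCoeff g 0 j k := by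
  have : edgePoly f p q N 1 = edgePoly g p q N 1 :=
    Polynomial.funext fun v => by simp only [edgePoly_eval, h]
  have h2 := congrArg (fun P => Polynomial.coeff P k) this
  simpa [edgePoly_coeff hp hq hjk] using h2

theorem taylorCoeff_eq_zero_of_initForm {f : ℝ × ℝ → ℝ} {p q N : ℕ} (hp : 1 ≤ p) (hq : 1 ≤ q)
    (h : ∀ v, initForm f p q N 1 v = 0) {j k : ℕ} (hjk : p * j + q * k = N) :
    taylorCoeff f 0 j k = 0 := by
  have : edgePoly f p q N 1 = 0 :=
    Polynomial.funext fun v => by simp only [edgePoly_eval, h, Polynomial.eval_zero]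
  have h2 := congrArg (fun P => Polynomial.coeff P k) this
  simpa [edgePoly_coeff hp hq hjk] using h2

/-- Weighted scaling limit: the initial form is the limit of the rescaled function. -/
theorem tendsto_initForm {f : ℝ × ℝ → ℝ} (hf : ContDiffAt ℝ ∞ f 0) {p q N : ℕ} (hp : 1 ≤ p)
    (hq : 1 ≤ q) (hord : OrdGE f p q N) {U V : ℝ → ℝ} {u v : ℝ}
    (hU : Tendsto U (𝓝[>] 0) (𝓝 u)) (hV : Tendsto V (𝓝[>] 0) (𝓝 v)) :
    Tendsto (fun s => (s ^ N)⁻¹ * f (s ^ p * U s, s ^ q * V s)) (𝓝[>] 0)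
      (𝓝 (initForm f p q N u v)) := by
  have hs0 : Tendsto (fun s : ℝ => s) (𝓝[>] 0) (𝓝 0) := nhdsWithin_le_nhds
  have hsO : ∀ {r : ℕ} {W : ℝ → ℝ} {w : ℝ}, 1 ≤ r → Tendsto W (𝓝[>] 0) (𝓝 w) →
      (fun s => s ^ r * W s) =O[𝓝[>] 0] (fun s => s) := by
    intro r W w hr hW
    have h1 : (fun s : ℝ => s ^ r) =O[𝓝[>] 0] (fun s => s) := by
      obtain ⟨r', rfl⟩ := Nat.exists_eq_add_of_le hr
      have : (fun s : ℝ => s ^ r') =O[𝓝[>] 0] (fun _ => (1 : ℝ)) :=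
        (hs0.pow r').isBigO_one ℝ
      simpa [pow_add] using (isBigO_refl (fun s : ℝ => s) _).mul this
    simpa using h1.mul (hW.isBigO_one ℝ)
  have hUO := hsO hp hU
  have hVO := hsO hq hV
  have hnorm : (fun s : ℝ => ‖(s ^ p * U s, s ^ q * V s)‖) =O[𝓝[>] 0] (fun s => s) :=
    (hUO.prod_left hVO).norm_left
  have hto : Tendsto (fun s : ℝ => (s ^ p * U s, s ^ q * V s)) (𝓝[>] 0) (𝓝 0) :=
    tendsto_zero_iff_norm_tendsto_zero.2 (hnorm.trans_tendsto hs0)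
  -- Both weights are at least one, so the scaled point is `O(s)` and a remainder of order `N + 1`
  -- is negligible against `s ^ N`.
  have hR := ((taylor_isBigO hf (N + 1)).comp_tendsto hto).trans (hnorm.pow (N + 1))
  have hR0 : Tendsto (fun s => (s ^ N)⁻¹ * (f (s ^ p * U s, s ^ q * V s) -
      jet (taylorCoeff f 0) (N + 1) (s ^ p * U s, s ^ q * V s))) (𝓝[>] 0) (𝓝 0) := by
    have h1 := (isBigO_refl (fun s : ℝ => (s ^ N)⁻¹) (𝓝[>] 0)).mul hR
    refine h1.trans_tendsto (hs0.congr' ?_)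
    filter_upwards [self_mem_nhdsWithin] with s hs
    have : s ≠ 0 := ne_of_gt hs
    field_simp
    ring
  have hJ : Tendsto (fun s => (s ^ N)⁻¹ *
      jet (taylorCoeff f 0) (N + 1) (s ^ p * U s, s ^ q * V s)) (𝓝[>] 0)
      (𝓝 (∑ j ∈ range (N + 1), ∑ k ∈ range (N + 1 - j),
        if p * j + q * k = N then taylorCoeff f 0 j k * u ^ j * v ^ k else 0)) := by
    simp only [jet, Finset.mul_sum]
    refine tendsto_finsetSum _ fun j _ => tendsto_finsetSum _ fun k _ => ?_
    have hlim : Tendsto (fun s => taylorCoeff f 0 j k * U s ^ j * V s ^ k) (𝓝[>] 0)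
        (𝓝 (taylorCoeff f 0 j k * u ^ j * v ^ k)) :=
      (tendsto_const_nhds.mul (hU.pow j)).mul (hV.pow k)
    rcases lt_trichotomy (p * j + q * k) N with hlt | heq | hgt
    · rw [if_neg hlt.ne, taylorCoeff_eq_zero_of_ordGE hord hlt]
      simp
    · rw [if_pos heq]
      refine hlim.congr' ?_
      filter_upwards [self_mem_nhdsWithin] with s hs
      have : s ≠ 0 := ne_of_gt hs
      rw [← heq, mul_pow, mul_pow, ← pow_mul, ← pow_mul, pow_add]
      field_simp
    · rw [if_neg hgt.ne']
      obtain ⟨m, hm⟩ := Nat.exists_eq_add_of_lt hgt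
      have h2 : Tendsto (fun s : ℝ => s ^ (m + 1) * (taylorCoeff f 0 j k * U s ^ j * V s ^ k))
          (𝓝[>] 0) (𝓝 0) := by
        simpa using (hs0.pow (m + 1)).mul hlim
      refine h2.congr' ?_
      filter_upwards [self_mem_nhdsWithin] with s hs
      have : s ≠ 0 := ne_of_gt hs
      have h3 : s ^ (p * j) * s ^ (q * k) = s ^ N * s ^ (m + 1) := by
        rw [← pow_add, ← pow_add, hm, add_assoc]
      rw [mul_pow, mul_pow, ← pow_mul, ← pow_mul]
      field_simp
      linear_combination (-(taylorCoeff f 0 j k * U s ^ j * V s ^ k)) * h3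
  have hsum : (∑ j ∈ range (N + 1), ∑ k ∈ range (N + 1 - j),
        if p * j + q * k = N then taylorCoeff f 0 j k * u ^ j * v ^ k else 0) =
      initForm f p q N u v := by
    rw [initForm, line, Finset.sum_filter, Finset.sum_product]
    refine Finset.sum_congr rfl fun j hj => ?_
    -- Weights at least one force `j + k ≤ N` on the line, so the truncated jet contains all its
    -- points.
    refine Finset.sum_subset (fun k hk => ?_) fun k hk hk' => ?_
    · simp at hk ⊢; omega
    · rw [if_neg]
      simp at hk hk'
      have : j ≤ p * j := Nat.le_mul_of_pos_left _ hp
      have : k ≤ q * k := Nat.le_mul_of_pos_left _ hq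
      omega
  rw [← hsum]
  have := hR0.add hJ
  rw [zero_add] at this
  refine this.congr fun s => ?_
  ring

/-- Converse of `tendsto_initForm`. -/
theorem ordGE_of_tendsto {f : ℝ × ℝ → ℝ} (hf : ContDiffAt ℝ ∞ f 0) {p q N : ℕ} (hp : 1 ≤ p)
    (hq : 1 ≤ q) {G : ℝ → ℝ → ℝ}
    (h : ∀ u v, Tendsto (fun s => (s ^ N)⁻¹ * f (s ^ p * u, s ^ q * v)) (𝓝[>] 0) (𝓝 (G u v))) :
    OrdGE f p q N ∧ ∀ u v, initForm f p q N u v = G u v := by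
  have hs0 : Tendsto (fun s : ℝ => s) (𝓝[>] 0) (𝓝 0) := nhdsWithin_le_nhds
  have hord : ∀ n, n ≤ N → OrdGE f p q n := by
    intro n
    induction n with
    | zero => intro _ x _; exact Nat.zero_le _
    | succ n ih =>
      intro hn
      have ihn := ih (by omega)
      -- For `n < N`, rescaling by `s⁻ⁿ` gives a positive power of `s` times a convergent quantity;
      -- the form of degree `n` vanishes and the order climbs by one.
      have hz : ∀ v, initForm f p q n 1 v = 0 := by
        intro v
        refine tendsto_nhds_unique
          (tendsto_initForm hf hp hq ihn (tendsto_const_nhds (x := (1 : ℝ)))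
            (tendsto_const_nhds (x := v))) ?_
        obtain ⟨m, hm⟩ := Nat.exists_eq_add_of_lt hn
        have h2 := (hs0.pow (m + 1)).mul (h 1 v)
        rw [zero_pow (by omega), zero_mul] at h2
        refine h2.congr' ?_
        filter_upwards [self_mem_nhdsWithin] with s hs
        have : s ≠ 0 := ne_of_gt hs
        rw [hm, add_assoc, pow_add s n]
        field_simp
      intro x hx
      have h3 := ihn x hx
      rcases h3.eq_or_lt with heq | hlt
      · exact absurd (taylorCoeff_eq_zero_of_initForm hp hq hz heq.symm) hx
      · exact hlt
  refine ⟨hord N le_rfl, fun u v => ?_⟩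
  exact tendsto_nhds_unique (tendsto_initForm hf hp hq (hord N le_rfl)
    (tendsto_const_nhds (x := u)) (tendsto_const_nhds (x := v))) (h u v)

theorem taylorCoeff_eq_zero_of_isBigO {f : ℝ × ℝ → ℝ} (hf : ContDiffAt ℝ ∞ f 0) {N : ℕ}
    (h : f =O[𝓝 0] (fun h => ‖h‖ ^ N)) {j k : ℕ} (hjk : j + k < N) : taylorCoeff f 0 j k = 0 := by
  have hs0 : Tendsto (fun s : ℝ => s) (𝓝[>] 0) (𝓝 0) := nhdsWithin_le_nhds
  have := (ordGE_of_tendsto hf (p := 1) (q := 1) (N := j + k) le_rfl le_rfl (G := fun _ _ => 0)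
    (fun u v => ?_)).2
  · exact taylorCoeff_eq_zero_of_initForm le_rfl le_rfl (fun v => this 1 v) (by ring)
  · have hto : Tendsto (fun s : ℝ => (s ^ 1 * u, s ^ 1 * v)) (𝓝[>] 0) (𝓝 0) := by
      have : Continuous (fun s : ℝ => (s ^ 1 * u, s ^ 1 * v)) := by fun_prop
      exact (this.tendsto' 0 0 (by simp)).mono_left nhdsWithin_le_nhds
    have hn : (fun s : ℝ => ‖(s ^ 1 * u, s ^ 1 * v)‖) =O[𝓝[>] 0] (fun s => s) := by
      refine (IsBigO.prod_left ?_ ?_).norm_left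
      · simpa [mul_comm] using (isBigO_refl (fun s : ℝ => s) (𝓝[>] 0)).const_mul_left u
      · simpa [mul_comm] using (isBigO_refl (fun s : ℝ => s) (𝓝[>] 0)).const_mul_left v
    have h1 := (h.comp_tendsto hto).trans (hn.pow N)
    have h2 := (isBigO_refl (fun s : ℝ => (s ^ (j + k))⁻¹) (𝓝[>] 0)).mul h1
    obtain ⟨m, hm⟩ := Nat.exists_eq_add_of_lt hjk
    refine h2.trans_tendsto ?_
    have h3 := hs0.pow (m + 1)
    rw [zero_pow (by omega)] at h3
    refine h3.congr' ?_
    filter_upwards [self_mem_nhdsWithin] with s hs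
    have : s ≠ 0 := ne_of_gt hs
    rw [hm, add_assoc, pow_add s (j + k)]
    field_simp

theorem isBigO_of_taylorCoeff_eq_zero {f : ℝ × ℝ → ℝ} (hf : ContDiffAt ℝ ∞ f 0) {N : ℕ}
    (h : ∀ j k, j + k < N → taylorCoeff f 0 j k = 0) : f =O[𝓝 0] (fun h => ‖h‖ ^ N) := by
  refine (taylor_isBigO hf N).congr_left fun x => ?_
  have : jet (taylorCoeff f 0) N x = 0 :=
    Finset.sum_eq_zero fun j hj => Finset.sum_eq_zero fun k hk => by
      rw [h j k (by simp at hj hk; omega)]; simp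
  rw [this, sub_zero]

end

/-! ### The Newton polyhedron: monotonicity and closedness -/

section

variable {f : ℝ × ℝ → ℝ}

theorem mem_polyhedron_of_le {x : ℕ × ℕ} (hx : x ∈ taylorSupport f 0) {t : ℝ × ℝ}
    (h1 : (x.1 : ℝ) ≤ t.1) (h2 : (x.2 : ℝ) ≤ t.2) : t ∈ polyhedron f :=
  subset_convexHull ℝ _ (Set.mem_iUnion₂.2 ⟨x, hx, h1, h2⟩)

theorem convex_polyhedron (f : ℝ × ℝ → ℝ) : Convex ℝ (polyhedron f) := convex_convexHull ℝ _

theorem polyhedron_add {t w : ℝ × ℝ} (ht : t ∈ polyhedron f) (hw1 : 0 ≤ w.1) (hw2 : 0 ≤ w.2) :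
    t + w ∈ polyhedron f := by
  have hconv : Convex ℝ {t : ℝ × ℝ | t + w ∈ polyhedron f} :=
    (convex_polyhedron f).translate_preimage_left w
  refine convexHull_min (fun s hs => ?_) hconv ht
  obtain ⟨x, hx, h1, h2⟩ := Set.mem_iUnion₂.1 hs
  exact mem_polyhedron_of_le hx (by simp; linarith) (by simp; linarith)

theorem convex_halfplane_le (a b c : ℝ) : Convex ℝ {t : ℝ × ℝ | c ≤ a * t.1 + b * t.2} := by
  intro x hx y hy s r hs hr hsr
  simp only [Set.mem_ofPred_eq, Prod.fst_add, Prod.snd_add, Prod.smul_fst, Prod.smul_snd,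
    smul_eq_mul] at *
  have h1 := mul_le_mul_of_nonneg_left hx hs
  have h2 := mul_le_mul_of_nonneg_left hy hr
  have : c = s * c + r * c := by rw [← add_mul, hsr, one_mul]
  linarith

theorem le_of_mem_polyhedron {a b c : ℝ} (ha : 0 ≤ a) (hb : 0 ≤ b)
    (h : ∀ x ∈ taylorSupport f 0, c ≤ a * (x.1 : ℝ) + b * (x.2 : ℝ)) {t : ℝ × ℝ}
    (ht : t ∈ polyhedron f) : c ≤ a * t.1 + b * t.2 := by
  refine convexHull_min (fun s hs => ?_) (convex_halfplane_le a b c) ht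
  obtain ⟨x, hx, h1, h2⟩ := Set.mem_iUnion₂.1 hs
  have := h x hx
  have := mul_le_mul_of_nonneg_left h1 ha
  have := mul_le_mul_of_nonneg_left h2 hb
  simp only [Set.mem_ofPred_eq]
  linarith

theorem fst_nonneg_of_mem {t : ℝ × ℝ} (ht : t ∈ polyhedron f) : 0 ≤ t.1 := by
  have := le_of_mem_polyhedron (a := 1) (b := 0) (c := 0) (by simp) le_rfl
    (fun x _ => by simp) ht
  simpa using this

/-- Dickson's lemma: the support has finitely many minimal points, so the polyhedron is the sum of a
compact hull and the closed quadrant. Closedness makes the infimum in `distance` attained. -/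
theorem isClosed_polyhedron (f : ℝ × ℝ → ℝ) : IsClosed (polyhedron f) := by
  set T := taylorSupport f 0
  set T0 : Set (ℕ × ℕ) := {x | Minimal (· ∈ T) x}
  have hfin : T0.Finite :=
    (setOfPred_minimal_antichain _).finite_of_partiallyWellOrderedOn
      (Set.isPWO_of_wellQuasiOrderedLE _)
  set Q : Set (ℝ × ℝ) := {t | 0 ≤ t.1 ∧ 0 ≤ t.2}
  set P0 : Set (ℝ × ℝ) := (fun x : ℕ × ℕ => ((x.1 : ℝ), (x.2 : ℝ))) '' T0
  have hQc : Convex ℝ Q := by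
    have h1 := convex_halfplane_le 1 0 0
    have h2 := convex_halfplane_le 0 1 0
    have : Q = {t : ℝ × ℝ | 0 ≤ 1 * t.1 + 0 * t.2} ∩ {t : ℝ × ℝ | 0 ≤ 0 * t.1 + 1 * t.2} := by
      ext t; simp [Q]
    rw [this]; exact h1.inter h2
  have hQcl : IsClosed Q :=
    (isClosed_le continuous_const continuous_fst).inter
      (isClosed_le continuous_const continuous_snd)
  have hU : (⋃ p ∈ T, {t : ℝ × ℝ | (p.1 : ℝ) ≤ t.1 ∧ (p.2 : ℝ) ≤ t.2}) = P0 + Q := by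
    ext t
    simp only [Set.mem_iUnion₂, Set.mem_add]
    constructor
    · rintro ⟨x, hx, h1, h2⟩
      obtain ⟨y, hy, hmin⟩ := exists_minimal_le_of_wellFoundedLT (· ∈ T) x hx
      have hy1 : (y.1 : ℝ) ≤ x.1 := by exact_mod_cast hy.1
      have hy2 : (y.2 : ℝ) ≤ x.2 := by exact_mod_cast hy.2
      refine ⟨_, ⟨y, hmin, rfl⟩, (t.1 - y.1, t.2 - y.2), ⟨?_, ?_⟩, ?_⟩
      · simp; linarith
      · simp; linarith
      · ext <;> simp
    · rintro ⟨_, ⟨y, hy, rfl⟩, w, ⟨hw1, hw2⟩, rfl⟩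
      exact ⟨y, hy.prop, by simpa using hw1, by simpa using hw2⟩
  have : polyhedron f = convexHull ℝ P0 + Q := by
    rw [polyhedron, hU, convexHull_add, hQc.convexHull_eq]
  rw [this]
  exact hQcl.add_left_of_isCompact ((hfin.image _).isCompact_convexHull ℝ)

end

/-! ### Newton distance, supporting lines and faces -/

section

variable {f : ℝ × ℝ → ℝ}

theorem bddBelow_diag (f : ℝ × ℝ → ℝ) : BddBelow {t : ℝ | (t, t) ∈ polyhedron f} :=
  ⟨0, fun _ ht => fst_nonneg_of_mem ht⟩

theorem distance_mem (hT : (taylorSupport f 0).Nonempty) :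
    (distance f, distance f) ∈ polyhedron f := by
  have hne : {t : ℝ | (t, t) ∈ polyhedron f}.Nonempty := by
    obtain ⟨x, hx⟩ := hT
    refine ⟨max x.1 x.2, mem_polyhedron_of_le hx ?_ ?_⟩
    · exact le_max_left _ _
    · exact le_max_right _ _
  have hcl : IsClosed {t : ℝ | (t, t) ∈ polyhedron f} :=
    (isClosed_polyhedron f).preimage (by fun_prop : Continuous fun t : ℝ => (t, t))
  exact hcl.csInf_mem hne (bddBelow_diag f)

theorem distance_le_of_mem {t : ℝ} (h : (t, t) ∈ polyhedron f) : distance f ≤ t :=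
  csInf_le (bddBelow_diag f) h

theorem distance_nonneg (hT : (taylorSupport f 0).Nonempty) : 0 ≤ distance f :=
  fst_nonneg_of_mem (distance_mem hT)

theorem distance_le_of_mem_support {x : ℕ × ℕ} (hx : x ∈ taylorSupport f 0) {r : ℝ}
    (h1 : (x.1 : ℝ) ≤ r) (h2 : (x.2 : ℝ) ≤ r) : distance f ≤ r :=
  distance_le_of_mem (mem_polyhedron_of_le hx h1 h2)

theorem convex_halfplane_lt (a b c : ℝ) : Convex ℝ {t : ℝ × ℝ | c < a * t.1 + b * t.2} := by
  refine convex_iff_forall_pos.2 fun x hx y hy s r hs hr hsr => ?_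
  simp only [Set.mem_ofPred_eq, Prod.fst_add, Prod.snd_add, Prod.smul_fst, Prod.smul_snd,
    smul_eq_mul] at *
  have h1 := mul_lt_mul_of_pos_left hx hs
  have h2 := mul_lt_mul_of_pos_left hy hr
  have : c = s * c + r * c := by rw [← add_mul, hsr, one_mul]
  linarith

theorem lt_of_mem_polyhedron {a b c : ℝ} (ha : 0 ≤ a) (hb : 0 ≤ b)
    (h : ∀ x ∈ taylorSupport f 0, c < a * (x.1 : ℝ) + b * (x.2 : ℝ)) {t : ℝ × ℝ}
    (ht : t ∈ polyhedron f) : c < a * t.1 + b * t.2 := by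
  refine convexHull_min (fun s hs => ?_) (convex_halfplane_lt a b c) ht
  obtain ⟨x, hx, h1, h2⟩ := Set.mem_iUnion₂.1 hs
  have := h x hx
  have := mul_le_mul_of_nonneg_left h1 ha
  have := mul_le_mul_of_nonneg_left h2 hb
  simp only [Set.mem_ofPred_eq]
  linarith

theorem le_distance_of_weight (hT : (taylorSupport f 0).Nonempty) {a b c : ℝ} (ha : 0 ≤ a)
    (hb : 0 ≤ b) (h : ∀ x ∈ taylorSupport f 0, c ≤ a * (x.1 : ℝ) + b * (x.2 : ℝ)) :
    c ≤ (a + b) * distance f := by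
  have := le_of_mem_polyhedron ha hb h (distance_mem hT)
  simp only at this; linarith

/-- Otherwise the polyhedron would lie in an open half-plane that misses `(d, d)`. -/
theorem exists_weight_le (hT : (taylorSupport f 0).Nonempty) {a b : ℝ} (ha : 0 ≤ a)
    (hb : 0 ≤ b) :
    ∃ x ∈ taylorSupport f 0, a * (x.1 : ℝ) + b * (x.2 : ℝ) ≤ (a + b) * distance f := by
  by_contra hcon
  push Not at hcon
  have := lt_of_mem_polyhedron ha hb hcon (distance_mem hT)
  simp only at this; linarith

/-- Smaller diagonal points are missing, so `(d, d)` is not interior and a functional separates it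
from the interior. Stability under adding the quadrant fixes the signs of the coefficients. -/
theorem exists_supporting_line (hT : (taylorSupport f 0).Nonempty) :
    ∃ a b : ℝ, 0 ≤ a ∧ 0 ≤ b ∧ 0 < a + b ∧
      ∀ t ∈ polyhedron f, (a + b) * distance f ≤ a * t.1 + b * t.2 := by
  set d := distance f
  have hd : (d, d) ∈ polyhedron f := distance_mem hT
  have hint : (d, d) ∉ interior (polyhedron f) := by
    intro h
    have hc : Tendsto (fun e : ℝ => (d - e, d - e)) (𝓝[>] 0) (𝓝 (d, d)) := by
      have : Continuous (fun e : ℝ => (d - e, d - e)) := by fun_prop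
      exact (this.tendsto' 0 _ (by simp)).mono_left nhdsWithin_le_nhds
    have h1 := hc.eventually (mem_interior_iff_mem_nhds.1 h)
    obtain ⟨e, he, he0⟩ := (h1.and self_mem_nhdsWithin).exists
    have := distance_le_of_mem he
    have he0 : 0 < e := he0
    linarith
  obtain ⟨g, hg⟩ := geometric_hahn_banach_open_point (convex_polyhedron f).interior
    isOpen_interior hint
  have hgt : ∀ t : ℝ × ℝ, g t = t.1 * g (1, 0) + t.2 * g (0, 1) := by
    intro t
    have : t = t.1 • ((1 : ℝ), (0 : ℝ)) + t.2 • ((0 : ℝ), (1 : ℝ)) := by ext <;> simp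
    conv_lhs => rw [this]
    rw [map_add, map_smul, map_smul, smul_eq_mul, smul_eq_mul]
  -- Diagonal shifts of any point are interior; the strict inequality there also yields `0 < a + b`.
  have hshift : ∀ t ∈ polyhedron f, ∀ e > 0, t + (e, e) ∈ interior (polyhedron f) := by
    intro t ht e he
    rw [mem_interior_iff_mem_nhds]
    have h1 : ∀ᶠ s : ℝ × ℝ in 𝓝 (t + (e, e)), t.1 < s.1 ∧ t.2 < s.2 := by
      refine ((continuous_fst.tendsto _).eventually (lt_mem_nhds ?_)).and
        ((continuous_snd.tendsto _).eventually (lt_mem_nhds ?_)) <;> simpa using he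
    filter_upwards [h1] with s hs
    have := polyhedron_add (w := s - t) ht (by simp; linarith [hs.1]) (by simp; linarith [hs.2])
    simpa using this
  have hlt : ∀ t ∈ polyhedron f, ∀ e > 0,
      (t.1 + e) * g (1, 0) + (t.2 + e) * g (0, 1) < d * g (1, 0) + d * g (0, 1) := by
    intro t ht e he
    have := hg _ (hshift t ht e he)
    rw [hgt, hgt (d, d)] at this
    simpa using this
  have hle : ∀ t ∈ polyhedron f,
      t.1 * g (1, 0) + t.2 * g (0, 1) ≤ d * g (1, 0) + d * g (0, 1) := by
    intro t ht
    have hc : Tendsto (fun e : ℝ => (t.1 + e) * g (1, 0) + (t.2 + e) * g (0, 1)) (𝓝[>] 0)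
        (𝓝 (t.1 * g (1, 0) + t.2 * g (0, 1))) := by
      have : Continuous (fun e : ℝ => (t.1 + e) * g (1, 0) + (t.2 + e) * g (0, 1)) := by fun_prop
      exact (this.tendsto' 0 _ (by simp)).mono_left nhdsWithin_le_nhds
    refine le_of_tendsto hc ?_
    filter_upwards [self_mem_nhdsWithin] with e he
    exact (hlt t ht e he).le
  refine ⟨-g (1, 0), -g (0, 1), ?_, ?_, ?_, ?_⟩
  · have := hle _ (polyhedron_add (w := (1, 0)) hd (by simp) (by simp))
    simp at this; linarith
  · have := hle _ (polyhedron_add (w := (0, 1)) hd (by simp) (by simp))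
    simp at this; linarith
  · have := hlt _ hd 1 one_pos
    simp only at this; linarith
  · intro t ht
    have := hle t ht
    change (-g (1, 0) + -g (0, 1)) * d ≤ _
    linarith

/-- The real supporting line at `(d, d)` is approximated by the integer weights `⌊n a⌋ + 1`, `⌊n b⌋
+ 1`. The rounding costs at most `2 r`, so `n (a + b) (d - r) ≤ 2 r` for all `n`. -/
theorem distance_le_of_weights (hT : (taylorSupport f 0).Nonempty) {r : ℝ}
    (h : ∀ p q : ℕ, 1 ≤ p → 1 ≤ q → ∃ x ∈ taylorSupport f 0,
      (p : ℝ) * (x.1 : ℝ) + (q : ℝ) * (x.2 : ℝ) ≤ ((p : ℝ) + q) * r) : distance f ≤ r := by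
  obtain ⟨a, b, ha, hb, hab, hs⟩ := exists_supporting_line hT
  have hr : 0 ≤ r := by
    obtain ⟨x, hx, hx2⟩ := h 1 1 le_rfl le_rfl
    have h1 : (0 : ℝ) ≤ x.1 := Nat.cast_nonneg _
    have h2 : (0 : ℝ) ≤ x.2 := Nat.cast_nonneg _
    push_cast at hx2
    linarith
  have key : ∀ n : ℕ, (n : ℝ) * ((a + b) * (distance f - r)) ≤ 2 * r := by
    intro n
    obtain ⟨x, hx, hx2⟩ := h (⌊n * a⌋₊ + 1) (⌊n * b⌋₊ + 1) (by simp) (by simp)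
    have h1 : (0 : ℝ) ≤ x.1 := Nat.cast_nonneg _
    have h2 : (0 : ℝ) ≤ x.2 := Nat.cast_nonneg _
    have h3 := hs (x.1, x.2) (mem_polyhedron_of_le hx le_rfl le_rfl)
    simp only at h3
    have h4 := mul_le_mul_of_nonneg_right (Nat.lt_floor_add_one ((n : ℝ) * a)).le h1
    have h5 := mul_le_mul_of_nonneg_right (Nat.lt_floor_add_one ((n : ℝ) * b)).le h2
    have h6 := mul_le_mul_of_nonneg_right
      (Nat.floor_le (mul_nonneg (Nat.cast_nonneg n) ha : 0 ≤ (n : ℝ) * a)) hr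
    have h7 := mul_le_mul_of_nonneg_right
      (Nat.floor_le (mul_nonneg (Nat.cast_nonneg n) hb : 0 ≤ (n : ℝ) * b)) hr
    push_cast at hx2
    have h8 := mul_le_mul_of_nonneg_left h3 (Nat.cast_nonneg (α := ℝ) n)
    nlinarith
  by_contra hcon
  push Not at hcon
  have hpos : 0 < (a + b) * (distance f - r) := mul_pos hab (by linarith)
  obtain ⟨n, hn⟩ := exists_nat_gt (2 * r / ((a + b) * (distance f - r)))
  rw [div_lt_iff₀ hpos] at hn
  linarith [key n]

/-- The points of the Taylor support on a line. -/
def supportOn (f : ℝ × ℝ → ℝ) (a b c : ℝ) : Set (ℝ × ℝ) :=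
  {t | ∃ x ∈ taylorSupport f 0, a * (x.1 : ℝ) + b * (x.2 : ℝ) = c ∧ t = ((x.1 : ℝ), (x.2 : ℝ))}

/-- A proper convex combination of points of the half-plane reaches the line only if both ends do.
Hence the half-plane, with its boundary cut down to the hull, is convex; it contains the quadrants,
since `a, b > 0` lets only their corners touch the line. -/
theorem face_eq_convexHull {a b c : ℝ} (ha : 0 < a) (hb : 0 < b)
    (h : ∀ t ∈ polyhedron f, c ≤ a * t.1 + b * t.2) :
    {t | t ∈ polyhedron f ∧ a * t.1 + b * t.2 = c} = convexHull ℝ (supportOn f a b c) := by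
  apply Set.Subset.antisymm
  · rintro t ⟨ht, htc⟩
    have hline : ∀ s ∈ convexHull ℝ (supportOn f a b c), a * s.1 + b * s.2 = c := by
      intro s hs
      have hconv : Convex ℝ {t : ℝ × ℝ | a * t.1 + b * t.2 = c} := by
        intro x hx y hy s r hs hr hsr
        simp only [Set.mem_ofPred_eq, Prod.fst_add, Prod.snd_add, Prod.smul_fst, Prod.smul_snd,
          smul_eq_mul] at *
        calc _ = s * (a * x.1 + b * x.2) + r * (a * y.1 + b * y.2) := by ring
          _ = c := by rw [hx, hy, ← add_mul, hsr, one_mul]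
      refine convexHull_min ?_ hconv hs
      rintro _ ⟨x, _, hx, rfl⟩
      exact hx
    have hconv : Convex ℝ {t : ℝ × ℝ | c ≤ a * t.1 + b * t.2 ∧
        (a * t.1 + b * t.2 = c → t ∈ convexHull ℝ (supportOn f a b c))} := by
      refine convex_iff_forall_pos.2 fun x hx y hy s r hs hr hsr => ⟨?_, fun heq => ?_⟩
      · exact convex_halfplane_le a b c hx.1 hy.1 hs.le hr.le hsr
      · simp only [Prod.fst_add, Prod.snd_add, Prod.smul_fst, Prod.smul_snd,
          smul_eq_mul] at heq
        have h1 : s * (a * x.1 + b * x.2 - c) + r * (a * y.1 + b * y.2 - c) = 0 := by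
          linear_combination heq - c * hsr
        have h2 := mul_nonneg hs.le (sub_nonneg.2 hx.1)
        have h3 := mul_nonneg hr.le (sub_nonneg.2 hy.1)
        have h4 : s * (a * x.1 + b * x.2 - c) = 0 := by linarith
        have h5 : r * (a * y.1 + b * y.2 - c) = 0 := by linarith
        have h6 := (mul_eq_zero.1 h4).resolve_left hs.ne'
        have h7 := (mul_eq_zero.1 h5).resolve_left hr.ne'
        exact convex_convexHull ℝ _ (hx.2 (by linarith)) (hy.2 (by linarith)) hs.le hr.le hsr
    refine (convexHull_min (fun s hs => ?_) hconv ht).2 htc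
    obtain ⟨x, hx, h1, h2⟩ := Set.mem_iUnion₂.1 hs
    have h3 := h _ (mem_polyhedron_of_le hx le_rfl le_rfl : ((x.1 : ℝ), (x.2 : ℝ)) ∈ _)
    simp only at h3
    have h4 := mul_le_mul_of_nonneg_left h1 ha.le
    have h5 := mul_le_mul_of_nonneg_left h2 hb.le
    refine ⟨by linarith, fun heq => subset_convexHull ℝ _ ⟨x, hx, by linarith, ?_⟩⟩
    have h6 : a * (s.1 - x.1) = 0 := by linarith
    have h7 : b * (s.2 - x.2) = 0 := by linarith
    have h8 := (mul_eq_zero.1 h6).resolve_left ha.ne'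
    have h9 := (mul_eq_zero.1 h7).resolve_left hb.ne'
    ext <;> simp <;> linarith
  · refine convexHull_min ?_ ?_
    · rintro _ ⟨x, hx, hxc, rfl⟩
      exact ⟨mem_polyhedron_of_le hx le_rfl le_rfl, hxc⟩
    · intro x hx y hy s r hs hr hsr
      refine ⟨convex_polyhedron f hx.1 hy.1 hs hr hsr, ?_⟩
      simp only [Prod.fst_add, Prod.snd_add, Prod.smul_fst, Prod.smul_snd, smul_eq_mul]
      calc _ = s * (a * x.1 + b * x.2) + r * (a * y.1 + b * y.2) := by ring
        _ = c := by rw [hx.2, hy.2, ← add_mul, hsr, one_mul]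

theorem exists_isPrincipalFace (hT : (taylorSupport f 0).Nonempty) :
    ∃ F, IsPrincipalFace f F := by
  obtain ⟨a, b, ha, hb, hab, hs⟩ := exists_supporting_line hT
  have hd := distance_mem hT
  set S : Set (Set (ℝ × ℝ)) :=
    {F | IsFace (polyhedron f) F ∧ (distance f, distance f) ∈ F}
  have hS : S.Nonempty := by
    have hmem : (distance f, distance f) ∈ {t | t ∈ polyhedron f ∧ a * t.1 + b * t.2 =
        (a + b) * distance f} := ⟨hd, by ring⟩
    refine ⟨_, ⟨⟨_, hmem⟩, a, b, (a + b) * distance f, ?_, hs, rfl⟩, hmem⟩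
    by_contra hcon
    push Not at hcon
    rw [hcon.1, hcon.2] at hab
    simp at hab
  refine ⟨Function.argminOn faceDim S hS, ?_, ?_, fun G hG hGd => ?_⟩
  · exact (Function.argminOn_mem faceDim S hS).1
  · exact (Function.argminOn_mem faceDim S hS).2
  · exact Function.argminOn_le faceDim S ⟨hG, hGd⟩

end

/-! ### Arithmetic description of the principal face -/

section

variable {f : ℝ × ℝ → ℝ}

/-- The bisectrix meets the boundary of the Newton polyhedron in a vertex. -/
def DiagVertex (f : ℝ × ℝ → ℝ) : Prop :=
  ∃ d : ℕ, (d, d) ∈ taylorSupport f 0 ∧ ∃ a b : ℝ, 0 < a ∧ 0 < b ∧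
    ∀ x ∈ taylorSupport f 0, x ≠ (d, d) → (a + b) * d < a * (x.1 : ℝ) + b * (x.2 : ℝ)

theorem faceDim_singleton (v : ℝ × ℝ) : faceDim {v} = 0 := by
  simp [faceDim]

theorem DiagVertex.spec (h : DiagVertex f) : ∃ d : ℕ, (d : ℝ) = distance f ∧
    (d, d) ∈ taylorSupport f 0 ∧ ∃ a b : ℝ, 0 < a ∧ 0 < b ∧
    ∀ x ∈ taylorSupport f 0, x ≠ (d, d) → (a + b) * d < a * (x.1 : ℝ) + b * (x.2 : ℝ) := by
  obtain ⟨d, hd, a, b, ha, hb, hab⟩ := h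
  refine ⟨d, le_antisymm ?_ (distance_le_of_mem_support hd le_rfl le_rfl), hd, a, b, ha, hb, hab⟩
  have := le_distance_of_weight ⟨_, hd⟩ ha.le hb.le (c := (a + b) * d) fun x hx => by
    by_cases hxd : x = (d, d)
    · subst hxd; simp only; linarith
    · exact (hab x hx hxd).le
  exact le_of_mul_le_mul_left this (by linarith)

theorem DiagVertex.isPrincipalFace (h : DiagVertex f) :
    IsPrincipalFace f {(distance f, distance f)} := by
  obtain ⟨d, hdd, hd, a, b, ha, hb, hab⟩ := h.spec
  have hle : ∀ x ∈ taylorSupport f 0, (a + b) * d ≤ a * (x.1 : ℝ) + b * (x.2 : ℝ) := by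
    intro x hx
    by_cases hxd : x = (d, d)
    · subst hxd; simp only; linarith
    · exact (hab x hx hxd).le
  rw [← hdd]
  refine ⟨⟨⟨_, rfl⟩, a, b, (a + b) * d, Or.inl ha.ne', fun t ht =>
    le_of_mem_polyhedron ha.le hb.le hle ht, ?_⟩, by rw [hdd]; rfl, fun G _ _ => ?_⟩
  · rw [face_eq_convexHull ha hb fun t ht => le_of_mem_polyhedron ha.le hb.le hle ht]
    have : supportOn f a b ((a + b) * d) = {((d : ℝ), (d : ℝ))} := by
      ext t
      constructor
      · rintro ⟨x, hx, hxc, rfl⟩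
        by_cases hxd : x = (d, d)
        · subst hxd; rfl
        · exact absurd hxc (hab x hx hxd).ne'
      · rintro rfl
        exact ⟨(d, d), hd, by simp only; ring, rfl⟩
    rw [this, convexHull_singleton]
  · rw [faceDim_singleton]; exact Nat.zero_le _

/-- A zero coefficient of the supporting line would put a ray into the face. So both are positive,
the face is the hull of the support points on it, and its single point is an integral point of the
bisectrix. -/
theorem diagVertex_of_singleton {F : Set (ℝ × ℝ)} (hF : IsPrincipalFace f F) (hv : IsVertex F) :
    DiagVertex f := by
  obtain ⟨⟨hne, a, b, c, hab, hs, hFeq⟩, hd, -⟩ := hF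
  obtain ⟨v, rfl⟩ := hv
  have hdv : (distance f, distance f) = v := hd
  have hvN : v ∈ polyhedron f ∧ a * v.1 + b * v.2 = c := by
    have : v ∈ ({v} : Set (ℝ × ℝ)) := rfl
    rw [hFeq] at this; exact this
  have h1 : 0 < a := by
    have h1 := polyhedron_add (w := (1, 0)) hvN.1 (by simp) (by simp)
    have h2 := hs _ h1
    simp at h2
    rcases eq_or_ne a 0 with h0 | h0
    · have : v + (1, 0) ∈ ({v} : Set (ℝ × ℝ)) := by
        rw [hFeq]; exact ⟨h1, by simp [h0, ← hvN.2]⟩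
      simp at this
    · exact lt_of_le_of_ne (by linarith [hvN.2]) h0.symm
  have h2 : 0 < b := by
    have h1 := polyhedron_add (w := (0, 1)) hvN.1 (by simp) (by simp)
    have h2 := hs _ h1
    simp at h2
    rcases eq_or_ne b 0 with h0 | h0
    · have : v + (0, 1) ∈ ({v} : Set (ℝ × ℝ)) := by
        rw [hFeq]; exact ⟨h1, by simp [h0, ← hvN.2]⟩
      simp at this
    · exact lt_of_le_of_ne (by linarith [hvN.2]) h0.symm
  rw [face_eq_convexHull h1 h2 hs] at hFeq
  have hne' : (supportOn f a b c).Nonempty := by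
    rw [← convexHull_nonempty_iff (𝕜 := ℝ), ← hFeq]; exact ⟨v, rfl⟩
  have hall : ∀ x ∈ taylorSupport f 0, a * (x.1 : ℝ) + b * (x.2 : ℝ) = c →
      ((x.1 : ℝ), (x.2 : ℝ)) = v := by
    intro x hx hxc
    have : ((x.1 : ℝ), (x.2 : ℝ)) ∈ ({v} : Set (ℝ × ℝ)) := by
      rw [hFeq]; exact subset_convexHull ℝ _ ⟨x, hx, hxc, rfl⟩
    exact this
  obtain ⟨_, x, hx, hxc, rfl⟩ := hne'
  have hxv := hall x hx hxc
  rw [← hdv] at hxv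
  have h3 := congrArg Prod.fst hxv
  have h4 := congrArg Prod.snd hxv
  simp only at h3 h4
  have h5 : x.1 = x.2 := by exact_mod_cast h3.trans h4.symm
  have hx' : x = (x.1, x.1) := by ext <;> simp [h5]
  refine ⟨x.1, hx' ▸ hx, a, b, h1, h2, fun y hy hyx => ?_⟩
  have h6 := hs _ (mem_polyhedron_of_le hy le_rfl le_rfl : ((y.1 : ℝ), (y.2 : ℝ)) ∈ _)
  simp only at h6
  have h7 : (a + b) * (x.1 : ℝ) = c := by rw [← hxc, ← h5]; ring
  rw [h7]
  refine lt_of_le_of_ne h6 fun heq => hyx ?_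
  have h8 := hall y hy heq.symm
  rw [← hall x hx hxc] at h8
  have h9 := congrArg Prod.fst h8
  have h10 := congrArg Prod.snd h8
  simp only [Nat.cast_inj] at h9 h10
  ext
  · exact h9
  · simp [h10, h5]

theorem exists_principal_vertex_iff :
    (∃ F, IsPrincipalFace f F ∧ IsVertex F) ↔ DiagVertex f :=
  ⟨fun ⟨_, hF, hv⟩ => diagVertex_of_singleton hF hv,
    fun h => ⟨_, h.isPrincipalFace, _, rfl⟩⟩

/-- If `(d, d)` is the lowest point of the support on a supporting line, it is a vertex. -/
theorem diagVertex_of_snd {p q N d : ℕ} (hp : 1 ≤ p) (hord : OrdGE f p q N)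
    (hd : (d, d) ∈ taylorSupport f 0) (hN : N = (p + q) * d)
    (h : ∀ x ∈ taylorSupport f 0, p * x.1 + q * x.2 = N → x ≠ (d, d) → d < x.2) :
    DiagVertex f := by
  -- Tilting the line: points off it gain at least `d + 1` from the scaling, more than the extra `d`
  -- of `(d, d)`; on the line the larger second exponent decides.
  refine ⟨d, hd, (d + 1) * p, (d + 1) * q + 1, by positivity, by positivity, fun x hx hxd => ?_⟩
  have : ((d + 1) * p + ((d + 1) * q + 1)) * d < (d + 1) * p * x.1 + ((d + 1) * q + 1) * x.2 := by
    rcases (hord x hx).eq_or_lt with heq | hlt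
    · have h1 := h x hx heq.symm hxd
      have h2 : (d + 1) * (p * x.1 + q * x.2) = (d + 1) * ((p + q) * d) := by rw [← heq, hN]
      nlinarith
    · have h2 : (d + 1) * ((p + q) * d + 1) ≤ (d + 1) * (p * x.1 + q * x.2) :=
        Nat.mul_le_mul_left _ (by omega)
      nlinarith [Nat.zero_le x.2]
  exact_mod_cast this

theorem diagVertex_of_fst {p q N d : ℕ} (hq : 1 ≤ q) (hord : OrdGE f p q N)
    (hd : (d, d) ∈ taylorSupport f 0) (hN : N = (p + q) * d)
    (h : ∀ x ∈ taylorSupport f 0, p * x.1 + q * x.2 = N → x ≠ (d, d) → d < x.1) :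
    DiagVertex f := by
  refine ⟨d, hd, (d + 1) * p + 1, (d + 1) * q, by positivity, by positivity, fun x hx hxd => ?_⟩
  have : ((d + 1) * p + 1 + (d + 1) * q) * d < ((d + 1) * p + 1) * x.1 + (d + 1) * q * x.2 := by
    rcases (hord x hx).eq_or_lt with heq | hlt
    · have h1 := h x hx heq.symm hxd
      have h2 : (d + 1) * (p * x.1 + q * x.2) = (d + 1) * ((p + q) * d) := by rw [← heq, hN]
      nlinarith
    · have h2 : (d + 1) * ((p + q) * d + 1) ≤ (d + 1) * (p * x.1 + q * x.2) :=
        Nat.mul_le_mul_left _ (by omega)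
      nlinarith [Nat.zero_le x.1]
  exact_mod_cast this

/-- Arithmetic data of a compact principal edge `F`. -/
structure EdgeData (f : ℝ × ℝ → ℝ) (F : Set (ℝ × ℝ)) (p q N : ℕ) : Prop where
  hp : 1 ≤ p
  hq : 1 ≤ q
  coprime : Nat.Coprime p q
  ord : OrdGE f p q N
  weight : (N : ℝ) = ((p : ℝ) + q) * distance f
  face : F = {t | t ∈ polyhedron f ∧ (p : ℝ) * t.1 + q * t.2 = N}
  below : ∃ x ∈ taylorSupport f 0, p * x.1 + q * x.2 = N ∧ (x.2 : ℝ) < distance f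
  left : ∃ x ∈ taylorSupport f 0, p * x.1 + q * x.2 = N ∧ (x.1 : ℝ) < distance f
  isCompactEdge : IsCompactEdge F

theorem finite_supportOn {a b c : ℝ} (ha : 0 < a) (hb : 0 < b) : (supportOn f a b c).Finite := by
  have hfin : (Set.Iic (⌈c / a⌉₊, ⌈c / b⌉₊)).Finite := Set.finite_Iic _
  refine (hfin.image fun x : ℕ × ℕ => ((x.1 : ℝ), (x.2 : ℝ))).subset ?_
  rintro _ ⟨x, _, hx, rfl⟩
  refine ⟨x, ⟨?_, ?_⟩, rfl⟩
  · have : (x.1 : ℝ) ≤ c / a := by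
      rw [le_div_iff₀ ha]
      have : 0 ≤ b * (x.2 : ℝ) := by positivity
      linarith
    exact_mod_cast this.trans (Nat.le_ceil _)
  · have : (x.2 : ℝ) ≤ c / b := by
      rw [le_div_iff₀ hb]
      have : 0 ≤ a * (x.1 : ℝ) := by positivity
      linarith
    exact_mod_cast this.trans (Nat.le_ceil _)

theorem convex_snd_lt (c : ℝ) : Convex ℝ {t : ℝ × ℝ | c < t.2} := by
  simpa using convex_halfplane_lt 0 1 c

theorem convex_fst_lt (c : ℝ) : Convex ℝ {t : ℝ × ℝ | c < t.1} := by
  simpa using convex_halfplane_lt 1 0 c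

theorem faceDim_eq_one {F : Set (ℝ × ℝ)} {a b c : ℝ} (hab : a ≠ 0)
    (hF : ∀ t ∈ F, a * t.1 + b * t.2 = c) {x y : ℝ × ℝ} (hx : x ∈ F) (hy : y ∈ F) (hxy : x ≠ y) :
    faceDim F = 1 := by
  have h1 : vectorSpan ℝ F ≤ Submodule.span ℝ {((-b, a) : ℝ × ℝ)} := by
    rw [vectorSpan_def]
    refine Submodule.span_le.2 ?_
    rintro _ ⟨s, hs, t, ht, rfl⟩
    refine Submodule.mem_span_singleton.2 ⟨(s.2 - t.2) / a, ?_⟩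
    have h1 := hF s hs
    have h2 := hF t ht
    ext
    · simp only [Prod.smul_fst, smul_eq_mul, vsub_eq_sub, Prod.fst_sub]
      field_simp
      linarith
    · simp only [Prod.smul_snd, smul_eq_mul, vsub_eq_sub, Prod.snd_sub]
      field_simp
  have h2 : faceDim F ≤ 1 := by
    refine (Submodule.finrank_mono h1).trans ?_
    simpa using finrank_span_le_card (R := ℝ) ({((-b, a) : ℝ × ℝ)} : Set (ℝ × ℝ))
  have h3 : faceDim F ≠ 0 := by
    intro h0
    have h4 : vectorSpan ℝ F = ⊥ := Submodule.finrank_eq_zero.1 h0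
    have h5 := vsub_mem_vectorSpan ℝ hx hy
    rw [h4, Submodule.mem_bot, vsub_eq_sub, sub_eq_zero] at h5
    exact hxy h5
  omega

/-- Without a vertex on the bisectrix the line carries two support points. Their difference is
integral, so the slope is rational, and dividing by the gcd gives coprime weights. The inequalities
in `below` and `left` are strict, since an extreme point of the edge with coordinate `d` would be
`(d, d)`, a vertex. -/
theorem exists_edgeData {F : Set (ℝ × ℝ)} {a b c : ℝ} (ha : 0 < a) (hb : 0 < b)
    (hs : ∀ t ∈ polyhedron f, c ≤ a * t.1 + b * t.2)
    (hF : F = {t | t ∈ polyhedron f ∧ a * t.1 + b * t.2 = c})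
    (hd : (distance f, distance f) ∈ F) (hV : ¬ DiagVertex f) :
    ∃ p q N, EdgeData f F p q N := by
  have hhull := face_eq_convexHull ha hb hs
  rw [← hF] at hhull
  have hc : (a + b) * distance f = c := by
    rw [hF] at hd; have := hd.2; simp only at this; linarith
  -- a lowest and a leftmost point
  have hdsnd : ∃ x ∈ taylorSupport f 0, a * (x.1 : ℝ) + b * (x.2 : ℝ) = c ∧
      (x.2 : ℝ) ≤ distance f := by
    by_contra hcon
    push Not at hcon
    have := convexHull_min (s := supportOn f a b c) (by
      rintro _ ⟨x, hx, hxc, rfl⟩; exact hcon x hx hxc) (convex_snd_lt (distance f)) (hhull ▸ hd)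
    exact lt_irrefl (distance f) this
  have hdfst : ∃ x ∈ taylorSupport f 0, a * (x.1 : ℝ) + b * (x.2 : ℝ) = c ∧
      (x.1 : ℝ) ≤ distance f := by
    by_contra hcon
    push Not at hcon
    have := convexHull_min (s := supportOn f a b c) (by
      rintro _ ⟨x, hx, hxc, rfl⟩; exact hcon x hx hxc) (convex_fst_lt (distance f)) (hhull ▸ hd)
    exact lt_irrefl (distance f) this
  -- two distinct points
  have hmemF : ∀ x ∈ taylorSupport f 0, a * (x.1 : ℝ) + b * (x.2 : ℝ) = c →
      ((x.1 : ℝ), (x.2 : ℝ)) ∈ F := by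
    intro x hx hxc
    rw [hhull]; exact subset_convexHull ℝ _ ⟨x, hx, hxc, rfl⟩
  have htwo : ∃ x ∈ taylorSupport f 0, ∃ y ∈ taylorSupport f 0,
      a * (x.1 : ℝ) + b * (x.2 : ℝ) = c ∧ a * (y.1 : ℝ) + b * (y.2 : ℝ) = c ∧ x.1 < y.1 := by
    by_contra hcon
    push Not at hcon
    obtain ⟨x, hx, hxc, hxd⟩ := hdsnd
    obtain ⟨y, hy, hyc, hyd⟩ := hdfst
    have heq : ∀ z ∈ taylorSupport f 0, a * (z.1 : ℝ) + b * (z.2 : ℝ) = c → z = x := by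
      intro z hz hzc
      have h1 := hcon x hx z hz hxc hzc
      have h2 := hcon z hz x hx hzc hxc
      have h3 : z.1 = x.1 := le_antisymm h1 h2
      have h4 : b * ((z.2 : ℝ) - x.2) = 0 := by rw [h3] at hzc; linarith
      have h5 := (mul_eq_zero.1 h4).resolve_left hb.ne'
      have h6 : (z.2 : ℝ) = x.2 := by linarith
      ext
      · exact h3
      · exact_mod_cast h6
    have hyx := heq y hy hyc
    subst hyx
    have h1 : a * (distance f - y.1) + b * (distance f - y.2) = 0 := by linarith
    have h2 := mul_nonneg ha.le (sub_nonneg.2 hyd)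
    have h3 := mul_nonneg hb.le (sub_nonneg.2 hxd)
    have h4 : a * (distance f - y.1) = 0 := by linarith
    have h5 : b * (distance f - y.2) = 0 := by linarith
    have h6 := (mul_eq_zero.1 h4).resolve_left ha.ne'
    have h7 := (mul_eq_zero.1 h5).resolve_left hb.ne'
    have h8 : y.1 = y.2 := by
      have : (y.1 : ℝ) = y.2 := by linarith
      exact_mod_cast this
    have hyy : y = (y.1, y.1) := by ext <;> simp [h8]
    refine hV ⟨y.1, hyy ▸ hy, a, b, ha, hb, fun z hz hzy => ?_⟩
    have h9 := hs _ (mem_polyhedron_of_le hz le_rfl le_rfl : ((z.1 : ℝ), (z.2 : ℝ)) ∈ _)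
    simp only at h9
    have h10 : (a + b) * (y.1 : ℝ) = c := by
      have : distance f = y.1 := by linarith
      rw [← this]; exact hc
    rw [h10]
    refine lt_of_le_of_ne h9 fun h => hzy ?_
    rw [heq z hz h.symm]; exact hyy
  obtain ⟨x, hx, y, hy, hxc, hyc, hxy⟩ := htwo
  have hxy2 : y.2 < x.2 := by
    have h1 : (x.1 : ℝ) < y.1 := by exact_mod_cast hxy
    have h2 := mul_lt_mul_of_pos_left h1 ha
    have h3 : b * (y.2 : ℝ) < b * x.2 := by linarith
    exact_mod_cast lt_of_mul_lt_mul_left h3 hb.le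
  obtain ⟨g, p, q, hg, hcop, hpg, hqg⟩ := Nat.exists_coprime' (m := x.2 - y.2) (n := y.1 - x.1)
    (Nat.gcd_pos_of_pos_left _ (by omega))
  have hp : 1 ≤ p := by
    rcases Nat.eq_zero_or_pos p with h | h
    · rw [h, zero_mul] at hpg; omega
    · exact h
  have hq : 1 ≤ q := by
    rcases Nat.eq_zero_or_pos q with h | h
    · rw [h, zero_mul] at hqg; omega
    · exact h
  have hp0 : (0 : ℝ) < p := by exact_mod_cast hp
  have hq0 : (0 : ℝ) < q := by exact_mod_cast hq
  have hgR : (0 : ℝ) < g := by exact_mod_cast hg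
  have hpR : (x.2 : ℝ) - y.2 = p * g := by
    have : (x.2 : ℝ) = y.2 + p * g := by exact_mod_cast (by omega : x.2 = y.2 + p * g)
    linarith
  have hqR : (y.1 : ℝ) - x.1 = q * g := by
    have : (y.1 : ℝ) = x.1 + q * g := by exact_mod_cast (by omega : y.1 = x.1 + q * g)
    linarith
  have hslope : a * q = b * p := by
    have : (a * q - b * p) * g = 0 := by linear_combination hyc - hxc - a * hqR + b * hpR
    linarith [(mul_eq_zero.1 this).resolve_right hgR.ne']
  obtain ⟨l, hl, rfl, rfl⟩ : ∃ l : ℝ, 0 < l ∧ a = l * p ∧ b = l * q := by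
    refine ⟨a / p, div_pos ha hp0, by field_simp, ?_⟩
    field_simp; linarith
  set N := p * x.1 + q * x.2 with hN
  have hNR : (N : ℝ) = p * x.1 + q * x.2 := by simp [hN]
  have hcN : c = l * N := by rw [hNR, ← hxc]; ring
  have hiff : ∀ s t : ℝ, l * p * s + l * q * t = c ↔ (p : ℝ) * s + q * t = N := by
    intro s t
    rw [hcN]
    constructor
    · intro h
      have : l * ((p : ℝ) * s + q * t - N) = 0 := by linear_combination h
      linarith [(mul_eq_zero.1 this).resolve_left hl.ne']
    · intro h; rw [← h]; ring
  have hiffN : ∀ z : ℕ × ℕ, l * p * z.1 + l * q * z.2 = c ↔ p * z.1 + q * z.2 = N := by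
    intro z; rw [hiff]; exact_mod_cast Iff.rfl
  have hord : OrdGE f p q N := by
    intro z hz
    have h9 := hs _ (mem_polyhedron_of_le hz le_rfl le_rfl : ((z.1 : ℝ), (z.2 : ℝ)) ∈ _)
    simp only at h9
    rw [hcN] at h9
    have : l * (N : ℝ) ≤ l * ((p : ℝ) * z.1 + q * z.2) := by linarith
    exact_mod_cast le_of_mul_le_mul_left this hl
  have hNd : (N : ℝ) = ((p : ℝ) + q) * distance f := by
    have : l * (N : ℝ) = l * (((p : ℝ) + q) * distance f) := by rw [← hcN, ← hc]; ring
    exact mul_left_cancel₀ hl.ne' this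
  have hdiag : ∀ z : ℕ × ℕ, p * z.1 + q * z.2 = N →
      (p : ℝ) * ((z.1 : ℝ) - distance f) + q * ((z.2 : ℝ) - distance f) = 0 := by
    intro z hz
    have : (p : ℝ) * z.1 + q * z.2 = N := by exact_mod_cast hz
    linarith
  have hpt : ∀ z : ℕ × ℕ, (z.1 : ℝ) = distance f → (z.2 : ℝ) = distance f →
      z = (z.1, z.1) ∧ N = (p + q) * z.1 := by
    intro z h1 h2
    have h3 : z.1 = z.2 := by exact_mod_cast h1.trans h2.symm
    refine ⟨by ext <;> simp [h3], ?_⟩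
    rw [← h1] at hNd
    exact_mod_cast hNd
  refine ⟨p, q, N, hp, hq, hcop, hord, hNd, ?_, ?_, ?_, ?_, ?_⟩
  · rw [hF]; ext t; simp only [Set.mem_ofPred_eq, hiff]
  · by_contra hcon
    push Not at hcon
    obtain ⟨z, hz, hzc, hzd⟩ := hdsnd
    rw [hiffN] at hzc
    have h1 : (z.2 : ℝ) = distance f := le_antisymm hzd (hcon z hz hzc)
    have h2 : (z.1 : ℝ) = distance f := by
      have := hdiag z hzc
      rw [h1, sub_self, mul_zero, add_zero] at this
      linarith [(mul_eq_zero.1 this).resolve_left hp0.ne']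
    obtain ⟨hzz, hNz⟩ := hpt z h2 h1
    refine hV (diagVertex_of_snd hp hord (hzz ▸ hz) hNz fun w hw hwN hwz => ?_)
    have h3 := hcon w hw hwN
    rw [← h2] at h3
    refine lt_of_le_of_ne (by exact_mod_cast h3) fun h4 => hwz ?_
    have : p * w.1 = p * z.1 := by rw [← h4] at hwN; nlinarith
    ext
    · exact Nat.eq_of_mul_eq_mul_left hp this
    · exact h4.symm
  · by_contra hcon
    push Not at hcon
    obtain ⟨z, hz, hzc, hzd⟩ := hdfst
    rw [hiffN] at hzc
    have h1 : (z.1 : ℝ) = distance f := le_antisymm hzd (hcon z hz hzc)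
    have h2 : (z.2 : ℝ) = distance f := by
      have := hdiag z hzc
      rw [h1, sub_self, mul_zero, zero_add] at this
      linarith [(mul_eq_zero.1 this).resolve_left hq0.ne']
    obtain ⟨hzz, hNz⟩ := hpt z h1 h2
    refine hV (diagVertex_of_fst hq hord (hzz ▸ hz) hNz fun w hw hwN hwz => ?_)
    have h3 := hcon w hw hwN
    rw [← h1] at h3
    refine lt_of_le_of_ne (by exact_mod_cast h3) fun h4 => hwz ?_
    have : q * w.2 = q * z.1 := by rw [← h4] at hwN; nlinarith
    ext
    · exact h4.symm
    · exact Nat.eq_of_mul_eq_mul_left hq this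
  · refine faceDim_eq_one ha.ne' (b := l * q) (c := c) (fun t ht => ?_) (hmemF x hx hxc) (hmemF y hy hyc) ?_
    · rw [hF] at ht; exact ht.2
    · intro h
      have := congrArg Prod.fst h
      simp only [Nat.cast_inj] at this
      omega
  · rw [hhull]; exact (finite_supportOn ha hb).isCompact_convexHull ℝ

theorem IsCompactEdge.exists_edgeData {F : Set (ℝ × ℝ)} (hF : IsPrincipalFace f F)
    (hE : IsCompactEdge F) : ∃ p q N, EdgeData f F p q N := by
  have hV : ¬ DiagVertex f := by
    intro hV
    have h1 := hV.isPrincipalFace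
    have h2 := hF.2.2 _ h1.1 rfl
    rw [hE.1, faceDim_singleton] at h2
    omega
  obtain ⟨⟨hne, a, b, c, hab, hs, hFeq⟩, hd, -⟩ := hF
  have hdN := hd
  rw [hFeq] at hdN
  obtain ⟨R, hR⟩ := hE.2.isBounded.subset_closedBall (0 : ℝ × ℝ)
  -- A direction of the quadrant parallel to the line would make the face unbounded; this excludes
  -- zero coefficients.
  have hunb : ∀ w : ℝ × ℝ, 0 ≤ w.1 → 0 ≤ w.2 → a * w.1 + b * w.2 = 0 → w ≠ 0 → False := by
    intro w h1 h2 h3 h4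
    have hmem : ∀ n : ℕ, ‖(distance f, distance f) + (n : ℝ) • w‖ ≤ R := by
      intro n
      have : (distance f, distance f) + (n : ℝ) • w ∈ F := by
        rw [hFeq]
        refine ⟨polyhedron_add hdN.1 (by simp; positivity) (by simp; positivity), ?_⟩
        simp only [Prod.fst_add, Prod.snd_add, Prod.smul_fst, Prod.smul_snd, smul_eq_mul]
        linear_combination hdN.2 + n * h3
      simpa using hR this
    obtain ⟨n, hn⟩ := exists_nat_gt ((R + ‖(distance f, distance f)‖) / ‖w‖)
    rw [div_lt_iff₀ (norm_pos_iff.2 h4)] at hn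
    have h5 := hmem n
    have h6 : ‖(n : ℝ) • w‖ ≤ ‖(distance f, distance f) + (n : ℝ) • w‖ +
        ‖(distance f, distance f)‖ := by
      have := norm_sub_le ((distance f, distance f) + (n : ℝ) • w) (distance f, distance f)
      simpa using this
    rw [norm_smul, Real.norm_natCast] at h6
    linarith
  have ha : 0 < a := by
    have h1 := hs _ (polyhedron_add (w := (1, 0)) hdN.1 (by simp) (by simp))
    have h2 := hdN.2
    simp at h1 h2
    refine lt_of_le_of_ne (by linarith) fun h0 => hunb (1, 0) (by simp) (by simp) ?_ (by simp)
    simp [← h0]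
  have hb : 0 < b := by
    have h1 := hs _ (polyhedron_add (w := (0, 1)) hdN.1 (by simp) (by simp))
    have h2 := hdN.2
    simp at h1 h2
    refine lt_of_le_of_ne (by linarith) fun h0 => hunb (0, 1) (by simp) (by simp) ?_ (by simp)
    simp [← h0]
  exact Newton.exists_edgeData ha hb hs hFeq hd hV

/-- The cases are those of the supporting line: both coefficients positive, or one zero, when the
whole support lies beyond a horizontal or vertical line through `(d, d)`. -/
theorem principal_cases (hT : (taylorSupport f 0).Nonempty) (hV : ¬ DiagVertex f) :
    (∃ F p q N, IsPrincipalFace f F ∧ EdgeData f F p q N) ∨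
      (∀ x ∈ taylorSupport f 0, distance f ≤ x.2) ∨
      (∀ x ∈ taylorSupport f 0, distance f ≤ x.1) := by
  obtain ⟨F, hF⟩ := exists_isPrincipalFace hT
  have hF' := hF
  obtain ⟨⟨hne, a, b, c, hab, hs, hFeq⟩, hd, -⟩ := hF
  have hdN := hd
  rw [hFeq] at hdN
  have ha : 0 ≤ a := by
    have h1 := hs _ (polyhedron_add (w := (1, 0)) hdN.1 (by simp) (by simp))
    have h2 := hdN.2
    simp at h1 h2
    linarith
  have hb : 0 ≤ b := by
    have h1 := hs _ (polyhedron_add (w := (0, 1)) hdN.1 (by simp) (by simp))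
    have h2 := hdN.2
    simp at h1 h2
    linarith
  have hc := hdN.2
  simp only at hc
  rcases ha.eq_or_lt with ha0 | ha0
  · right; left
    intro x hx
    have hb0 : 0 < b := lt_of_le_of_ne hb fun h => by simp [← ha0, ← h] at hab
    have h9 := hs _ (mem_polyhedron_of_le hx le_rfl le_rfl : ((x.1 : ℝ), (x.2 : ℝ)) ∈ _)
    rw [← hc, ← ha0] at h9
    simp only [zero_mul, zero_add] at h9
    exact le_of_mul_le_mul_left h9 hb0
  rcases hb.eq_or_lt with hb0 | hb0
  · right; right
    intro x hx
    have h9 := hs _ (mem_polyhedron_of_le hx le_rfl le_rfl : ((x.1 : ℝ), (x.2 : ℝ)) ∈ _)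
    rw [← hc, ← hb0] at h9
    simp only [zero_mul, add_zero] at h9
    exact le_of_mul_le_mul_left h9 ha0
  · left
    obtain ⟨p, q, N, h⟩ := exists_edgeData ha0 hb0 hs hFeq hd hV
    exact ⟨F, p, q, N, hF', h⟩

/-- The principal part along a compact edge is the corresponding weighted homogeneous part. -/
theorem EdgeData.facePart_eq {F : Set (ℝ × ℝ)} {p q N : ℕ} (h : EdgeData f F p q N)
    (x : ℝ × ℝ) : facePart f F x = initForm f p q N x.1 x.2 := by
  rw [facePart, initForm]
  refine finsum_mem_eq_sum_of_inter_support_eq _ ?_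
  ext y
  simp only [Set.mem_inter_iff, Set.mem_ofPred_eq, Function.mem_support, Finset.mem_coe,
    mem_line h.hp h.hq, h.face]
  constructor
  · rintro ⟨⟨-, h1⟩, h2⟩
    exact ⟨by exact_mod_cast h1, h2⟩
  · rintro ⟨h1, h2⟩
    refine ⟨⟨mem_polyhedron_of_le (x := y) ?_ le_rfl le_rfl, by exact_mod_cast h1⟩, h2⟩
    intro h0
    apply h2
    rw [h0]; simp

end

/-! ### Swaps, shears and the leading order of coordinate changes -/

section

variable {f g : ℝ × ℝ → ℝ}

theorem mem_taylorSupport_swap (hf : ContDiffAt ℝ ∞ f 0) {x : ℕ × ℕ} :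
    x ∈ taylorSupport (f ∘ Prod.swap) 0 ↔ x.swap ∈ taylorSupport f 0 := by
  simp [taylorSupport, taylorCoeff_swap hf]

theorem taylorSupport_swap_nonempty (hf : ContDiffAt ℝ ∞ f 0)
    (hT : (taylorSupport f 0).Nonempty) : (taylorSupport (f ∘ Prod.swap) 0).Nonempty := by
  obtain ⟨x, hx⟩ := hT
  exact ⟨x.swap, (mem_taylorSupport_swap hf).2 (by simpa using hx)⟩

theorem comp_swap_swap (f : ℝ × ℝ → ℝ) : (f ∘ Prod.swap) ∘ Prod.swap = f := by
  funext x; simp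

theorem distance_swap_le (hf : ContDiffAt ℝ ∞ f 0) (hT : (taylorSupport f 0).Nonempty) :
    distance (f ∘ Prod.swap) ≤ distance f := by
  refine distance_le_of_weights (taylorSupport_swap_nonempty hf hT) fun p q _ _ => ?_
  obtain ⟨x, hx, h⟩ := exists_weight_le hT (a := q) (b := p) (by positivity) (by positivity)
  refine ⟨x.swap, (mem_taylorSupport_swap hf).2 (by simpa using hx), ?_⟩
  simp only [Prod.fst_swap, Prod.snd_swap]
  linarith

theorem distance_swap (hf : ContDiffAt ℝ ∞ f 0) (hT : (taylorSupport f 0).Nonempty) :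
    distance (f ∘ Prod.swap) = distance f := by
  refine le_antisymm (distance_swap_le hf hT) ?_
  have := distance_swap_le (f := f ∘ Prod.swap) (contDiffAt_comp_swap hf)
    (taylorSupport_swap_nonempty hf hT)
  rwa [comp_swap_swap] at this

theorem OrdGE.swap (hf : ContDiffAt ℝ ∞ f 0) {p q N : ℕ} (h : OrdGE f p q N) :
    OrdGE (f ∘ Prod.swap) q p N := by
  intro x hx
  have := h _ ((mem_taylorSupport_swap hf).1 hx)
  simp at this
  omega

/-- The map `Φ` is to leading order `L` with respect to the weights `(p, q)`. -/
def WLim (Φ : ℝ × ℝ → ℝ × ℝ) (p q : ℕ) (L : ℝ × ℝ → ℝ × ℝ) : Prop :=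
  ∀ u v : ℝ, Tendsto (fun s : ℝ => (s ^ p)⁻¹ * (Φ (s ^ p * u, s ^ q * v)).1) (𝓝[>] 0)
      (𝓝 (L (u, v)).1) ∧
    Tendsto (fun s : ℝ => (s ^ q)⁻¹ * (Φ (s ^ p * u, s ^ q * v)).2) (𝓝[>] 0) (𝓝 (L (u, v)).2)

theorem tendsto_scale {p q : ℕ} (hp : 1 ≤ p) (hq : 1 ≤ q) (u v : ℝ) :
    Tendsto (fun s : ℝ => (s ^ p * u, s ^ q * v)) (𝓝[>] 0) (𝓝 (0 : ℝ × ℝ)) := by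
  have : Continuous (fun s : ℝ => (s ^ p * u, s ^ q * v)) := by fun_prop
  refine (this.tendsto' 0 0 ?_).mono_left nhdsWithin_le_nhds
  simp [zero_pow (by omega : p ≠ 0), zero_pow (by omega : q ≠ 0)]

/-- Evaluating `f` at a scaled point is evaluating `g` at a scaled point whose rescaled coordinates
converge to `L (u, v)`. For this `tendsto_initForm` admits moving arguments. -/
theorem initForm_of_wlim (hf : ContDiffAt ℝ ∞ f 0) (hg : ContDiffAt ℝ ∞ g 0)
    {Φ L : ℝ × ℝ → ℝ × ℝ} (hfg : f =ᶠ[𝓝 0] g ∘ Φ) {p q N : ℕ} (hp : 1 ≤ p) (hq : 1 ≤ q)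
    (hΦ : WLim Φ p q L) (hord : OrdGE g p q N) :
    OrdGE f p q N ∧ ∀ u v, initForm f p q N u v =
      initForm g p q N (L (u, v)).1 (L (u, v)).2 := by
  refine ordGE_of_tendsto hf hp hq fun u v => ?_
  refine (tendsto_initForm hg hp hq hord (hΦ u v).1 (hΦ u v).2).congr' ?_
  filter_upwards [(tendsto_scale hp hq u v).eventually hfg, self_mem_nhdsWithin] with s hs hs0
  have : s ≠ 0 := ne_of_gt hs0
  rw [hs]
  simp only [Function.comp]
  congr 2
  ext
  · simp only; field_simp
  · simp only; field_simp

/-- The shear `(z₁, z₂) ↦ (z₁, z₂ + ψ(z₁))`. -/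
def shear (ψ : ℝ → ℝ) (z : ℝ × ℝ) : ℝ × ℝ := (z.1, z.2 + ψ z.1)

theorem shear_zero {ψ : ℝ → ℝ} (h : ψ 0 = 0) : shear ψ 0 = 0 := by
  ext <;> simp [shear, h]

theorem shear_shear (ψ η : ℝ → ℝ) (z : ℝ × ℝ) :
    shear ψ (shear η z) = shear (fun x => ψ x + η x) z := by
  ext <;> simp [shear]; ring

theorem contDiffAt_shear {ψ : ℝ → ℝ} (h : ContDiffAt ℝ ∞ ψ 0) : ContDiffAt ℝ ∞ (shear ψ) 0 := by
  have h1 : ContDiffAt ℝ ∞ (fun z : ℝ × ℝ => ψ z.1) 0 :=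
    ContDiffAt.comp (g := ψ) (f := Prod.fst) (0 : ℝ × ℝ) h contDiffAt_fst
  exact contDiffAt_fst.prodMk (contDiffAt_snd.add h1)

theorem contDiffAt_comp_shear (hf : ContDiffAt ℝ ∞ f 0) {ψ : ℝ → ℝ} (h : ContDiffAt ℝ ∞ ψ 0)
    (h0 : ψ 0 = 0) : ContDiffAt ℝ ∞ (f ∘ shear ψ) 0 :=
  ContDiffAt.comp (0 : ℝ × ℝ) (by rw [shear_zero h0]; exact hf) (contDiffAt_shear h)

/-- The function `ψ` is to leading order `G` with respect to the weights `(p, q)`. -/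
def WLimOne (ψ : ℝ → ℝ) (p q : ℕ) (G : ℝ → ℝ) : Prop :=
  ∀ u : ℝ, Tendsto (fun s : ℝ => (s ^ q)⁻¹ * ψ (s ^ p * u)) (𝓝[>] 0) (𝓝 (G u))

theorem wlim_shear {ψ G : ℝ → ℝ} {p q : ℕ} (h : WLimOne ψ p q G) :
    WLim (shear ψ) p q (shear G) := by
  intro u v
  constructor
  · refine tendsto_const_nhds.congr' ?_
    filter_upwards [self_mem_nhdsWithin] with s hs0
    have : s ≠ 0 := ne_of_gt hs0
    simp only [shear]
    field_simp
  · refine ((h u).const_add v).congr' ?_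
    filter_upwards [self_mem_nhdsWithin] with s hs0
    have : s ≠ 0 := ne_of_gt hs0
    simp only [shear]
    field_simp

theorem WLimOne.neg {ψ G : ℝ → ℝ} {p q : ℕ} (h : WLimOne ψ p q G) :
    WLimOne (fun x => -ψ x) p q (fun x => -G x) := by
  intro u
  simpa using (h u).neg

/-- Initial forms under shears. -/
theorem initForm_shear (hf : ContDiffAt ℝ ∞ f 0) {ψ G : ℝ → ℝ} (hψ : ContDiffAt ℝ ∞ ψ 0)
    (h0 : ψ 0 = 0) {p q N : ℕ} (hp : 1 ≤ p) (hq : 1 ≤ q) (hG : WLimOne ψ p q G)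
    (hord : OrdGE f p q N) :
    OrdGE (f ∘ shear ψ) p q N ∧
      ∀ u v, initForm (f ∘ shear ψ) p q N u v = initForm f p q N u (v + G u) :=
  initForm_of_wlim (contDiffAt_comp_shear hf hψ h0) hf EventuallyEq.rfl hp hq (wlim_shear hG) hord

theorem comp_shear_neg (f : ℝ × ℝ → ℝ) (ψ : ℝ → ℝ) :
    (f ∘ shear ψ) ∘ shear (fun x => -ψ x) = f := by
  funext z
  simp only [Function.comp, shear_shear]
  simp [shear]

theorem ordGE_shear_iff (hf : ContDiffAt ℝ ∞ f 0) {ψ G : ℝ → ℝ} (hψ : ContDiffAt ℝ ∞ ψ 0)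
    (h0 : ψ 0 = 0) {p q N : ℕ} (hp : 1 ≤ p) (hq : 1 ≤ q) (hG : WLimOne ψ p q G) :
    OrdGE (f ∘ shear ψ) p q N ↔ OrdGE f p q N := by
  refine ⟨fun h => ?_, fun h => (initForm_shear hf hψ h0 hp hq hG h).1⟩
  have := (initForm_shear (contDiffAt_comp_shear hf hψ h0) hψ.neg (by simp [h0]) hp hq hG.neg h).1
  rwa [comp_shear_neg] at this

theorem wlimOne_of_isBigO {ψ : ℝ → ℝ} {p q K : ℕ} (hp : 1 ≤ p) (hK : q < p * K)
    (h : ψ =O[𝓝 0] (fun x => x ^ K)) : WLimOne ψ p q (fun _ => 0) := by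
  intro u
  have hs0 : Tendsto (fun s : ℝ => s) (𝓝[>] 0) (𝓝 0) := nhdsWithin_le_nhds
  have ht : Tendsto (fun s : ℝ => s ^ p * u) (𝓝[>] 0) (𝓝 0) := by
    have := (hs0.pow p).mul_const u
    rwa [zero_pow (by omega), zero_mul] at this
  have h1 := (isBigO_refl (fun s : ℝ => (s ^ q)⁻¹) (𝓝[>] 0)).mul (h.comp_tendsto ht)
  refine h1.trans_tendsto ?_
  obtain ⟨m, hm⟩ := Nat.exists_eq_add_of_lt hK
  have h2 := (hs0.pow (m + 1)).mul_const (u ^ K)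
  rw [zero_pow (by omega), zero_mul] at h2
  refine h2.congr' ?_
  filter_upwards [self_mem_nhdsWithin] with s hs
  have : s ≠ 0 := ne_of_gt hs
  simp only [Function.comp, mul_pow, ← pow_mul]
  rw [hm, add_assoc, pow_add s q]
  field_simp

theorem WLimOne.add {ψ η G H : ℝ → ℝ} {p q : ℕ} (h : WLimOne ψ p q G) (h' : WLimOne η p q H) :
    WLimOne (fun x => ψ x + η x) p q (fun x => G x + H x) := by
  intro u
  simpa [mul_add] using (h u).add (h' u)

theorem wlimOne_pow (c : ℝ) (p k : ℕ) : WLimOne (fun x => c * x ^ k) p (p * k)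
    (fun x => c * x ^ k) := by
  intro u
  refine tendsto_const_nhds.congr' ?_
  filter_upwards [self_mem_nhdsWithin] with s hs
  have : s ≠ 0 := ne_of_gt hs
  simp only [mul_pow, ← pow_mul]
  field_simp

theorem wlimOne_leading {ψ : ℝ → ℝ} {p k : ℕ} {c : ℝ} (hp : 1 ≤ p)
    (h : (fun x => ψ x - c * x ^ k) =O[𝓝 0] (fun x => x ^ (k + 1))) :
    WLimOne ψ p (p * k) (fun x => c * x ^ k) := by
  have h1 := (wlimOne_pow c p k).add
    (wlimOne_of_isBigO (q := p * k) hp (Nat.mul_lt_mul_of_pos_left (Nat.lt_succ_self k) hp) h)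
  simpa using h1

/-- A smooth `ψ` may be flat, so its leading monomial is sought only up to the cutoff `K`. -/
theorem leading_term {ψ : ℝ → ℝ} (hψ : ContDiffAt ℝ ∞ ψ 0) (h0 : ψ 0 = 0) (K : ℕ) :
    (∃ k, 1 ≤ k ∧ k ≤ K ∧ ∃ c : ℝ, c ≠ 0 ∧
      (fun x => ψ x - c * x ^ k) =O[𝓝 0] (fun x => x ^ (k + 1))) ∨
    ψ =O[𝓝 0] (fun x => x ^ (K + 1)) := by
  induction K with
  | zero =>
    right
    have := taylor_isBigO_one hψ 1
    simpa [h0] using this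
  | succ K ih =>
    rcases ih with ⟨k, hk, hkK, h⟩ | h
    · exact Or.inl ⟨k, hk, by omega, h⟩
    · have h1 := taylor_isBigO_one hψ (K + 2)
      set a : ℕ → ℝ := fun n => iteratedDeriv n ψ 0 / (n.factorial : ℝ)
      have hz : ∀ n, n < K + 1 → a n = 0 := by
        intro n
        induction n using Nat.strong_induction_on with
        | _ n ihn =>
          intro hn
          have h2 := taylor_isBigO_one hψ (n + 1)
          have h3 : (fun x : ℝ => a n * x ^ n) =O[𝓝 0] (fun x => x ^ (n + 1)) := by
            have h4 : ψ =O[𝓝 0] (fun x : ℝ => x ^ (n + 1)) := by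
              refine h.trans ?_
              refine IsBigO.of_bound 1 ?_
              filter_upwards [Metric.closedBall_mem_nhds (0 : ℝ) one_pos] with x hx
              rw [one_mul, norm_pow, norm_pow]
              exact pow_le_pow_of_le_one (norm_nonneg _) (by simpa using hx) (by omega)
            refine (h4.sub h2).congr_left fun x => ?_
            rw [Finset.sum_range_succ, Finset.sum_eq_zero fun i hi => ?_]
            · simp [a]
            · have := ihn i (by simpa using hi) (by simp at hi; omega)
              simp only [a] at this
              rw [this, zero_mul]
          exact eq_zero_of_mul_pow_isBigO (h3.mono nhdsWithin_le_nhds)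
      have h5 : (fun x => ψ x - a (K + 1) * x ^ (K + 1)) =O[𝓝 0] (fun x => x ^ (K + 2)) := by
        refine h1.congr_left fun x => ?_
        rw [Finset.sum_range_succ, Finset.sum_eq_zero fun i hi => ?_]
        · simp [a]
        · have := hz i (by simpa using hi)
          simp only [a] at this
          rw [this, zero_mul]
      by_cases hc : a (K + 1) = 0
      · right; simpa [hc] using h5
      · exact Or.inl ⟨K + 1, by omega, le_rfl, _, hc, h5⟩

/-- Either the leading monomial of `ψ` has weight less than `q` and dominates `v`, in which case the
weights `(1, k)` are the relevant ones, or `ψ` has a limit on the scale `s ^ q`. -/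
theorem wlimOne_cases {ψ : ℝ → ℝ} (hψ : ContDiffAt ℝ ∞ ψ 0) (h0 : ψ 0 = 0) {p q : ℕ}
    (hp : 1 ≤ p) (hq : 1 ≤ q) :
    (∃ k, 1 ≤ k ∧ p * k < q ∧ ∃ c : ℝ, c ≠ 0 ∧
      (fun x => ψ x - c * x ^ k) =O[𝓝 0] (fun x => x ^ (k + 1))) ∨
    ∃ k, 1 ≤ k ∧ q ≤ p * k ∧ ∃ c : ℝ, (c = 0 ∨ p * k = q) ∧
      WLimOne ψ p q (fun u => c * u ^ k) := by
  rcases leading_term hψ h0 q with ⟨k, hk, -, c, hc, h⟩ | h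
  · rcases lt_trichotomy (p * k) q with hlt | heq | hgt
    · exact Or.inl ⟨k, hk, hlt, c, hc, h⟩
    · refine Or.inr ⟨k, hk, heq.ge, c, Or.inr heq, ?_⟩
      subst heq
      exact wlimOne_leading hp h
    · refine Or.inr ⟨k, hk, hgt.le, 0, Or.inl rfl, ?_⟩
      have h1 : ψ =O[𝓝 0] (fun x => x ^ k) := by
        have h2 : (fun x : ℝ => x ^ (k + 1)) =O[𝓝 0] (fun x => x ^ k) := by
          refine IsBigO.of_bound 1 ?_
          filter_upwards [Metric.closedBall_mem_nhds (0 : ℝ) one_pos] with x hx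
          rw [one_mul, norm_pow, norm_pow]
          exact pow_le_pow_of_le_one (norm_nonneg _) (by simpa using hx) (by omega)
        simpa using (h.trans h2).add ((isBigO_refl (fun x : ℝ => x ^ k) (𝓝 0)).const_mul_left c)
      simpa using wlimOne_of_isBigO hp hgt h1
  · refine Or.inr ⟨q, hq, Nat.le_mul_of_pos_left _ hp, 0, Or.inl rfl, ?_⟩
    have : q < p * (q + 1) := lt_of_lt_of_le (Nat.lt_succ_self q) (Nat.le_mul_of_pos_left _ hp)
    simpa using wlimOne_of_isBigO hp this h

/-- A coordinate change is, up to a shear, triangular to leading order. -/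
theorem exists_shear_wlim {E : ℝ × ℝ → ℝ × ℝ} (hE : ContDiffAt ℝ ∞ E 0) (hE0 : E 0 = 0)
    (hinj : Function.Injective (fderiv ℝ E 0)) (h2 : (fderiv ℝ E 0 (0, 1)).2 ≠ 0) :
    ∃ ψ : ℝ → ℝ, ContDiffAt ℝ ∞ ψ 0 ∧ ψ 0 = 0 ∧ ∃ α β γ : ℝ, α ≠ 0 ∧ β ≠ 0 ∧
      ∀ p q : ℕ, 1 ≤ p → p ≤ q → WLim (E ∘ shear ψ) p q
        (fun w => (α * w.1 + (if p = q then γ else 0) * w.2, β * w.2)) := by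
  set A := fderiv ℝ E 0 with hA
  have hEd : HasFDerivAt E A 0 := (hE.differentiableAt (by simp)).hasFDerivAt
  set b := (A (0, 1)).2 with hb
  set a := (A (1, 0)).2 with ha
  have hA2 : ∀ h : ℝ × ℝ, (A h).2 = a * h.1 + b * h.2 := by
    intro h
    have : h = h.1 • ((1 : ℝ), (0 : ℝ)) + h.2 • ((0 : ℝ), (1 : ℝ)) := by ext <;> simp
    conv_lhs => rw [this]
    rw [map_add, map_smul, map_smul]
    simp [ha, hb, mul_comm]
  -- Inverting this map yields the curve `x₂ = ψ(x₁)` on which `E₂` vanishes. After shearing along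
  -- it, `E₂` vanishes on the first axis and hence has size `s ^ q`, not just `s ^ p`.
  set Φ : ℝ × ℝ → ℝ × ℝ := fun x => (x.1, (E x).2) with hΦdef
  have hΦ : ContDiffAt ℝ ∞ Φ 0 := contDiffAt_fst.prodMk hE.snd
  let A1 : ℝ × ℝ →L[ℝ] ℝ × ℝ :=
    (ContinuousLinearMap.fst ℝ ℝ ℝ).prod ((ContinuousLinearMap.snd ℝ ℝ ℝ).comp A)
  let A2 : ℝ × ℝ →L[ℝ] ℝ × ℝ :=
    (ContinuousLinearMap.fst ℝ ℝ ℝ).prod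
      (b⁻¹ • ((ContinuousLinearMap.snd ℝ ℝ ℝ) - a • (ContinuousLinearMap.fst ℝ ℝ ℝ)))
  have hl : Function.LeftInverse A2 A1 := by
    intro h
    ext
    · simp [A1, A2]
    · simp [A1, A2, hA2]; field_simp
  have hr : Function.RightInverse A2 A1 := by
    intro h
    ext
    · simp [A1, A2]
    · simp [A1, A2, hA2]; field_simp; ring
  let A' : (ℝ × ℝ) ≃L[ℝ] ℝ × ℝ := ContinuousLinearEquiv.equivOfInverse A1 A2 hl hr
  have hΦd : HasFDerivAt Φ (A' : ℝ × ℝ →L[ℝ] ℝ × ℝ) 0 := hasFDerivAt_fst.prodMk hEd.snd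
  have hΦ0 : Φ 0 = 0 := by ext <;> simp [Φ, hE0]
  have hn : (∞ : WithTop ℕ∞) ≠ 0 := by simp
  set G := hΦ.localInverse hΦd hn with hG
  have hGs : ContDiffAt ℝ ∞ G 0 := by
    have := hΦ.to_localInverse hΦd hn
    rwa [hΦ0] at this
  have hG0 : G 0 = 0 := by
    have := hΦ.localInverse_apply_image hΦd hn
    rwa [hΦ0] at this
  have hGr : ∀ᶠ y in 𝓝 (0 : ℝ × ℝ), Φ (G y) = y := by
    have := (hΦ.hasStrictFDerivAt' hΦd hn).eventually_right_inverse
    rwa [hΦ0] at this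
  set ψ : ℝ → ℝ := fun s => (G (s, 0)).2 with hψdef
  have hax : ContDiffAt ℝ ∞ (fun s : ℝ => (s, (0 : ℝ))) 0 := by fun_prop
  have hψ : ContDiffAt ℝ ∞ ψ 0 := (ContDiffAt.comp (g := G) (f := fun s : ℝ => (s, (0 : ℝ))) (0 : ℝ) hGs hax).snd
  have hψ0 : ψ 0 = 0 := by
    have : G (0, 0) = 0 := hG0
    simp [ψ, this]
  have hcurve : ∀ᶠ s : ℝ in 𝓝 0, (E (s, ψ s)).2 = 0 := by
    have ht : Tendsto (fun s : ℝ => (s, (0 : ℝ))) (𝓝 0) (𝓝 0) := hax.continuousAt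
    filter_upwards [ht.eventually hGr] with s hs
    have h3 := congrArg Prod.fst hs
    have h4 := congrArg Prod.snd hs
    simp only [Φ] at h3 h4
    have : G (s, 0) = (s, ψ s) := by ext <;> simp [h3, ψ]
    rwa [this] at h4
  refine ⟨ψ, hψ, hψ0, ?_⟩
  -- the derivative of the first component
  have hSd := (contDiffAt_shear hψ).differentiableAt (by simp)
  have hE1 : DifferentiableAt ℝ (fun z => (E (shear ψ z)).1) 0 := by
    have : DifferentiableAt ℝ (E ∘ shear ψ) 0 := by
      refine DifferentiableAt.comp (0 : ℝ × ℝ) ?_ hSd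
      rw [shear_zero hψ0]; exact hEd.differentiableAt
    exact this.fst
  set B := fderiv ℝ (fun z => (E (shear ψ z)).1) 0 with hB
  have hBh : ∀ h : ℝ × ℝ, B h = B (1, 0) * h.1 + B (0, 1) * h.2 := by
    intro h
    have : h = h.1 • ((1 : ℝ), (0 : ℝ)) + h.2 • ((0 : ℝ), (1 : ℝ)) := by ext <;> simp
    conv_lhs => rw [this]
    rw [map_add, map_smul, map_smul]
    simp [mul_comm]
  -- This number is the derivative of `E₁` along the curve. Were it zero, the tangent vector would
  -- lie in the kernel of the derivative, as `E₂` is constant along the curve.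
  have hα : B (1, 0) ≠ 0 := by
    have hψd : HasDerivAt ψ (deriv ψ 0) 0 := (hψ.differentiableAt (by simp)).hasDerivAt
    have hcd : HasDerivAt (fun s : ℝ => (s, ψ s)) (1, deriv ψ 0) 0 :=
      (hasDerivAt_id (0 : ℝ)).prodMk hψd
    have hEc : HasDerivAt (fun s : ℝ => E (s, ψ s)) (A (1, deriv ψ 0)) 0 := by
      refine HasFDerivAt.comp_hasDerivAt (l := E) (0 : ℝ) (by
        rw [hψ0]; exact hEd) hcd
    have h3 : (A (1, deriv ψ 0)).2 = 0 := by
      have h4 : HasDerivAt (fun s : ℝ => (E (s, ψ s)).2) 0 0 :=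
        (hasDerivAt_const (0 : ℝ) (0 : ℝ)).congr_of_eventuallyEq hcurve
      exact HasDerivAt.unique ((ContinuousLinearMap.snd ℝ ℝ ℝ).hasFDerivAt.comp_hasDerivAt (0 : ℝ) hEc) h4
    have h5 : (A (1, deriv ψ 0)).1 = B (1, 0) := by
      have h6 : HasDerivAt (fun s : ℝ => (E (shear ψ (s, 0))).1) (B (1, 0)) 0 := by
        have h7 : HasDerivAt (fun s : ℝ => (s, (0 : ℝ))) ((1 : ℝ), (0 : ℝ)) 0 :=
          (hasDerivAt_id (0 : ℝ)).prodMk (hasDerivAt_const _ _)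
        exact HasFDerivAt.comp_hasDerivAt (l := fun z => (E (shear ψ z)).1) (0 : ℝ)
          (f := fun s : ℝ => (s, (0 : ℝ))) hE1.hasFDerivAt h7
      refine HasDerivAt.unique
        ((ContinuousLinearMap.fst ℝ ℝ ℝ).hasFDerivAt.comp_hasDerivAt (0 : ℝ) hEc) ?_
      simp only [shear, zero_add] at h6
      exact h6
    intro h0
    have h8 : A (1, deriv ψ 0) = 0 := by
      ext
      · rw [h5, h0]; rfl
      · exact h3
    have h9 := hinj (h8.trans (map_zero A).symm)
    simp at h9
  refine ⟨B (1, 0), b, B (0, 1), hα, h2, fun p q hp hpq u v => ⟨?_, ?_⟩⟩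
  · have hs0 : Tendsto (fun s : ℝ => s) (𝓝[>] 0) (𝓝 0) := nhdsWithin_le_nhds
    have ht := tendsto_scale hp (hp.trans hpq) u v
    have ho := hE1.hasFDerivAt.isLittleO.comp_tendsto ht
    have hn : (fun s : ℝ => (s ^ p * u, s ^ q * v)) =O[𝓝[>] 0] (fun s => s ^ p) := by
      refine IsBigO.prod_left ?_ ?_
      · simpa [mul_comm] using (isBigO_refl (fun s : ℝ => s ^ p) (𝓝[>] 0)).const_mul_left u
      · obtain ⟨m, rfl⟩ := Nat.exists_eq_add_of_le hpq
        have h3 : (fun s : ℝ => s ^ m * v) =O[𝓝[>] 0] (fun _ => (1 : ℝ)) :=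
          ((hs0.pow m).mul_const v).isBigO_one ℝ
        have h4 := (isBigO_refl (fun s : ℝ => s ^ p) (𝓝[>] 0)).mul h3
        refine (h4.congr_left fun s => ?_).congr_right fun s => mul_one _
        rw [pow_add]; ring
    have ho2 := ho.trans_isBigO (by simpa [Function.comp_def] using hn :
      ((fun x' : ℝ × ℝ => x' - 0) ∘ fun s : ℝ => (s ^ p * u, s ^ q * v)) =O[𝓝[>] 0]
        (fun s => s ^ p))
    have ho3 := ho2.tendsto_div_nhds_zero
    -- The coefficient of `v` carries a factor `s ^ (q - p)` and survives only for equal weights.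
    have hlin : Tendsto (fun s : ℝ => B (1, 0) * u + s ^ (q - p) * (B (0, 1) * v)) (𝓝[>] 0)
        (𝓝 (B (1, 0) * u + (if p = q then B (0, 1) else 0) * v)) := by
      refine tendsto_const_nhds.add ?_
      split_ifs with h
      · subst h; simp
      · have := (hs0.pow (q - p)).mul_const (B (0, 1) * v)
        rw [zero_pow (by omega), zero_mul] at this
        rwa [zero_mul]
    have := ho3.add hlin
    rw [zero_add] at this
    refine this.congr' ?_
    filter_upwards [self_mem_nhdsWithin] with s hs
    have hs1 : s ≠ 0 := ne_of_gt hs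
    have h5 : s ^ q = s ^ p * s ^ (q - p) := by rw [← pow_add]; congr 1; omega
    have h6 : (E (shear ψ 0)).1 = 0 := by rw [shear_zero hψ0, hE0]; rfl
    simp only [Function.comp, sub_zero, h6]
    rw [← hB, hBh, h5]
    simp only
    field_simp
    ring
  · have ht := tendsto_scale hp (hp.trans hpq) u v
    -- Strictness is needed: it compares two moving points differing by `(0, s ^ q v)` with error
    -- `o(s ^ q)`, whereas the derivative at the origin alone gives only `o(s ^ p)`.
    have hst : HasStrictFDerivAt E A 0 := hE.hasStrictFDerivAt' hEd (by simp)
    have ho := (hst.snd).isLittleO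
    have hz1 : Tendsto (fun s : ℝ => shear ψ (s ^ p * u, s ^ q * v)) (𝓝[>] 0) (𝓝 0) := by
      have := (contDiffAt_shear hψ).continuousAt.tendsto.comp ht
      rwa [shear_zero hψ0] at this
    have hfst : Tendsto (fun s : ℝ => s ^ p * u) (𝓝[>] 0) (𝓝 0) :=
      (continuous_fst.tendsto _).comp ht
    have hz2 : Tendsto (fun s : ℝ => (s ^ p * u, ψ (s ^ p * u))) (𝓝[>] 0) (𝓝 0) := by
      have h3 : Tendsto (fun s : ℝ => ψ (s ^ p * u)) (𝓝[>] 0) (𝓝 0) := by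
        have := hψ.continuousAt.tendsto.comp hfst
        rwa [hψ0] at this
      exact hfst.prodMk_nhds h3
    have ho2 := ho.comp_tendsto (hz1.prodMk_nhds hz2)
    have hn : (fun s : ℝ => shear ψ (s ^ p * u, s ^ q * v) - (s ^ p * u, ψ (s ^ p * u)))
        =O[𝓝[>] 0] (fun s => s ^ q) := by
      have h3 : (fun s : ℝ => ((0 : ℝ), s ^ q * v)) =O[𝓝[>] 0] (fun s => s ^ q) := by
        refine IsBigO.prod_left (isBigO_zero _ _) ?_
        simpa [mul_comm] using (isBigO_refl (fun s : ℝ => s ^ q) (𝓝[>] 0)).const_mul_left v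
      refine h3.congr_left fun s => ?_
      ext <;> simp [shear]
    have ho3 := (ho2.trans_isBigO hn).tendsto_div_nhds_zero
    have := ho3.add_const (b * v)
    rw [zero_add] at this
    refine this.congr' ?_
    filter_upwards [self_mem_nhdsWithin, hfst.eventually hcurve] with s hs hc
    have hs1 : s ≠ 0 := ne_of_gt hs
    simp only [Function.comp, hc]
    have h4 : shear ψ (s ^ p * u, s ^ q * v) - (s ^ p * u, ψ (s ^ p * u)) = (0, s ^ q * v) := by
      ext <;> simp [shear]
    rw [h4]
    simp only [ContinuousLinearMap.comp_apply, ContinuousLinearMap.coe_snd', hA2]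
    field_simp
    ring

end

/-! ### Bad roots, and maximality of the distance in good coordinates -/

section

variable {f g : ℝ × ℝ → ℝ}

/-- `f` is smooth and of finite type at the origin. -/
structure FiniteType (f : ℝ × ℝ → ℝ) : Prop where
  smooth : ContDiffAt ℝ ∞ f 0
  nonempty : (taylorSupport f 0).Nonempty

/-- If `g` were flat it would be `O(‖h‖ ^ M)` for every `M`, and then so would `f`. -/
theorem FiniteType.of_comp (hf : FiniteType f) (hg : ContDiffAt ℝ ∞ g 0) {E : ℝ × ℝ → ℝ × ℝ}
    (hE : ContDiffAt ℝ ∞ E 0) (hE0 : E 0 = 0) (hfg : f =ᶠ[𝓝 0] g ∘ E) : FiniteType g := by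
  refine ⟨hg, ?_⟩
  by_contra hcon
  rw [Set.not_nonempty_iff_eq_empty] at hcon
  obtain ⟨x, hx⟩ := hf.nonempty
  refine hx (taylorCoeff_eq_zero_of_isBigO (N := x.1 + x.2 + 1) hf.smooth ?_ (Nat.lt_succ_self _))
  have h1 : g =O[𝓝 0] (fun h => ‖h‖ ^ (x.1 + x.2 + 1)) :=
    isBigO_of_taylorCoeff_eq_zero hg fun j k _ => by
      by_contra hjk
      have : (j, k) ∈ taylorSupport g 0 := hjk
      rw [hcon] at this
      exact this
  have hE1 : (fun h => ‖E h‖) =O[𝓝 0] (fun h : ℝ × ℝ => ‖h‖) := by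
    have := (hE.differentiableAt (by simp)).isBigO_sub
    simpa [hE0] using this.norm_norm
  have ht : Tendsto E (𝓝 0) (𝓝 0) := by
    have := hE.continuousAt.tendsto
    rwa [hE0] at this
  exact ((h1.comp_tendsto ht).trans (hE1.pow _)).congr' hfg.symm EventuallyEq.rfl

theorem FiniteType.shear (hf : FiniteType f) {ψ : ℝ → ℝ} (hψ : ContDiffAt ℝ ∞ ψ 0)
    (h0 : ψ 0 = 0) : FiniteType (f ∘ shear ψ) :=
  hf.of_comp (contDiffAt_comp_shear hf.smooth hψ h0) (contDiffAt_shear hψ.neg)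
    (shear_zero (by simp [h0])) (by
      have := comp_shear_neg f ψ
      exact this.symm.eventuallyEq)

theorem FiniteType.swap (hf : FiniteType f) : FiniteType (f ∘ Prod.swap) :=
  ⟨contDiffAt_comp_swap hf.smooth, taylorSupport_swap_nonempty hf.smooth hf.nonempty⟩

theorem contDiffAt_monomial (c : ℝ) (k : ℕ) : ContDiffAt ℝ ∞ (fun x : ℝ => c * x ^ k) 0 := by
  fun_prop

theorem exists_ordGE (hT : (taylorSupport f 0).Nonempty) (p q : ℕ) :
    ∃ D, OrdGE f p q D ∧ ∃ x ∈ taylorSupport f 0, p * x.1 + q * x.2 = D := by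
  refine ⟨_, fun x hx => Function.argminOn_le (fun x : ℕ × ℕ => p * x.1 + q * x.2)
    (taylorSupport f 0) hx, _, Function.argminOn_mem _ _ hT, rfl⟩

theorem OrdGE.cast_le (hT : (taylorSupport f 0).Nonempty) {p q D : ℕ} (h : OrdGE f p q D) :
    (D : ℝ) ≤ ((p : ℝ) + q) * distance f :=
  le_distance_of_weight hT (Nat.cast_nonneg p) (Nat.cast_nonneg q) fun x hx => by
    exact_mod_cast h x hx

/-- A power of `X` and a power of `X - c` with `c ≠ 0` are coprime divisors of `P`, so their degrees
add up. -/
theorem natTrailingDegree_add_le {P : Polynomial ℝ} (hP : P ≠ 0) {m : ℕ} {c : ℝ} (hc : c ≠ 0)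
    (h : ∀ i, (P.comp (Polynomial.X + Polynomial.C c)).coeff i ≠ 0 → m ≤ i) :
    P.natTrailingDegree + m ≤ P.natDegree := by
  open Polynomial in
  have h1 : X ^ m ∣ P.comp (X + C c) := by
    rw [X_pow_dvd_iff]
    intro i hi
    by_contra hne
    exact absurd (h i hne) (by omega)
  have h2 : (X - C c) ^ m ∣ P := by
    obtain ⟨Q, hQ⟩ := h1
    refine ⟨Q.comp (X - C c), ?_⟩
    have := congrArg (fun R => R.comp (X - C c)) hQ
    simpa [comp_assoc] using this
  have h3 : X ^ P.natTrailingDegree ∣ P := by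
    rw [X_pow_dvd_iff]
    exact fun i hi => coeff_eq_zero_of_lt_natTrailingDegree hi
  have h4 : IsCoprime (X : ℝ[X]) (X - C c) := by
    have := isCoprime_X_sub_C_of_isUnit_sub (R := ℝ) (a := 0) (b := c) (by simpa using hc)
    simpa using this
  have h5 := (h4.pow (m := P.natTrailingDegree) (n := m)).mul_dvd h3 h2
  have h6 := natDegree_le_of_dvd h5 hP
  rwa [natDegree_mul (pow_ne_zero _ X_ne_zero) (pow_ne_zero _ (X_sub_C_ne_zero c)),
    natDegree_pow, natDegree_pow, natDegree_X, natDegree_X_sub_C, mul_one, mul_one] at h6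

/-- A root off the axes of high multiplicity forces the edge to be long. -/
theorem exists_edge_points (hf : FiniteType f) {k D m : ℕ} (hk : 1 ≤ k) (hord : OrdGE f 1 k D)
    (hD : ∃ x ∈ taylorSupport f 0, 1 * x.1 + k * x.2 = D) {ψ : ℝ → ℝ} {c : ℝ} (hc : c ≠ 0)
    (hψ : ContDiffAt ℝ ∞ ψ 0) (h0 : ψ 0 = 0) (hlim : WLimOne ψ 1 k (fun u => c * u ^ k))
    (hm : ∀ x ∈ taylorSupport (f ∘ shear ψ) 0, 1 * x.1 + k * x.2 = D → m ≤ x.2) :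
    ∃ x ∈ taylorSupport f 0, ∃ y ∈ taylorSupport f 0,
      1 * x.1 + k * x.2 = D ∧ 1 * y.1 + k * y.2 = D ∧ x.2 + m ≤ y.2 := by
  open Polynomial in
  have hz := initForm_shear hf.smooth hψ h0 le_rfl hk hlim hord
  have hP0 : edgePoly f 1 k D 1 ≠ 0 := by
    obtain ⟨x, hx, hxD⟩ := hD
    intro h
    have := congrArg (fun P => Polynomial.coeff P x.2) h
    simp only [edgePoly_coeff le_rfl hk hxD, coeff_zero, one_pow, mul_one] at this
    exact hx this
  have hcomp : edgePoly (f ∘ shear ψ) 1 k D 1 = (edgePoly f 1 k D 1).comp (X + C c) := by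
    refine Polynomial.funext fun v => ?_
    rw [edgePoly_eval, hz.2]
    simp [edgePoly_eval]
  have hlen := natTrailingDegree_add_le hP0 (m := m) hc (by
    intro i hi
    rw [← hcomp] at hi
    obtain ⟨j, hj, hmem⟩ := exists_of_edgePoly_coeff_ne_zero le_rfl hk hi
    exact hm _ hmem hj)
  obtain ⟨j, hj, hmem⟩ := exists_of_edgePoly_coeff_ne_zero (f := f) (N := D) (u := 1) le_rfl hk
    (k := (edgePoly f 1 k D 1).natTrailingDegree)
    (by rw [← trailingCoeff]; exact trailingCoeff_eq_zero.not.2 hP0)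
  obtain ⟨j', hj', hmem'⟩ := exists_of_edgePoly_coeff_ne_zero (f := f) (N := D) (u := 1) le_rfl hk
    (k := (edgePoly f 1 k D 1).natDegree)
    (by rw [coeff_natDegree]; exact leadingCoeff_ne_zero.2 hP0)
  exact ⟨_, hmem, _, hmem', hj, hj', hlen⟩

/-- The point `(r, r)` lies on the segment from `x` to `y`. For any weights the excesses over `(p +
q) r` are `(x₂ - r)(q - p k)` and `(y₂ - r)(q - p k)`, which cannot both be positive. -/
theorem distance_le_of_segment {x y : ℕ × ℕ} (hx : x ∈ taylorSupport f 0)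
    (hy : y ∈ taylorSupport f 0) {k r : ℝ} (hxl : (x.1 : ℝ) + k * x.2 = (1 + k) * r)
    (hyl : (y.1 : ℝ) + k * y.2 = (1 + k) * r) (hxr : (x.2 : ℝ) ≤ r) (hyr : r ≤ y.2) :
    distance f ≤ r := by
  refine distance_le_of_weights ⟨x, hx⟩ fun p q _ _ => ?_
  by_contra hcon
  push Not at hcon
  have h1 := hcon x hx
  have h2 := hcon y hy
  have h3 : 0 < ((x.2 : ℝ) - r) * (q - p * k) := by nlinarith
  have h4 : 0 < ((y.2 : ℝ) - r) * (q - p * k) := by nlinarith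
  rcases le_total ((q : ℝ) - p * k) 0 with h | h
  · nlinarith
  · nlinarith

/-- A root off the axes of multiplicity at least `d` makes the edge so long that it crosses the
bisectrix; its line is then the principal one. -/
theorem line_eq_of_multiplicity (hf : FiniteType f) {k D m : ℕ} (hk : 1 ≤ k)
    (hord : OrdGE f 1 k D) (hD : ∃ x ∈ taylorSupport f 0, 1 * x.1 + k * x.2 = D) {ψ : ℝ → ℝ}
    {c : ℝ} (hc : c ≠ 0) (hψ : ContDiffAt ℝ ∞ ψ 0) (h0 : ψ 0 = 0)
    (hlim : WLimOne ψ 1 k (fun u => c * u ^ k)) (hdm : distance f ≤ m)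
    (hm : ∀ x ∈ taylorSupport (f ∘ shear ψ) 0, 1 * x.1 + k * x.2 = D → m ≤ x.2) :
    (D : ℝ) = (1 + k) * distance f := by
  obtain ⟨x, hx, y, hy, hxD, hyD, hxy⟩ := exists_edge_points hf hk hord hD hc hψ h0 hlim hm
  have h1 := hord.cast_le hf.nonempty
  push_cast at h1
  have hk0 : (1 : ℝ) ≤ k := by exact_mod_cast hk
  set r : ℝ := D / (1 + k) with hr
  have hDr : (D : ℝ) = (1 + k) * r := by rw [hr]; field_simp
  have hrd : r ≤ distance f := by
    rw [hr, div_le_iff₀ (by linarith)]; linarith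
  have hxD' : (x.1 : ℝ) + k * x.2 = (1 + k) * r := by rw [← hDr, ← hxD]; push_cast; ring
  have hyD' : (y.1 : ℝ) + k * y.2 = (1 + k) * r := by rw [← hDr, ← hyD]; push_cast; ring
  have hxy' : (x.2 : ℝ) + m ≤ y.2 := by exact_mod_cast hxy
  have hx2 : (0 : ℝ) ≤ x.2 := Nat.cast_nonneg _
  have hy1 : (0 : ℝ) ≤ y.1 := Nat.cast_nonneg _
  have hm0 : (0 : ℝ) ≤ m := Nat.cast_nonneg _
  have hx1 : (m : ℝ) ≤ x.1 := by nlinarith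
  have hxr : (x.2 : ℝ) ≤ r := by
    by_contra hcon
    push Not at hcon
    nlinarith
  have := distance_le_of_segment hx hy hxD' hyD' hxr (by linarith)
  rw [hDr, le_antisymm hrd this]

/-- The principal line has slope `k` and the principal part has a root `c` off the axes of
multiplicity larger than the distance. -/
structure Bad (f : ℝ × ℝ → ℝ) (k : ℕ) (c : ℝ) : Prop where
  one_le : 1 ≤ k
  ne_zero : c ≠ 0
  ord : ∀ x ∈ taylorSupport f 0, (1 + (k : ℝ)) * distance f ≤ x.1 + k * x.2
  root : ∀ x ∈ taylorSupport (f ∘ shear fun s => c * s ^ k) 0,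
    (x.1 : ℝ) + k * x.2 = (1 + k) * distance f → distance f < x.2

theorem wlimOne_monomial (c : ℝ) (k : ℕ) :
    WLimOne (fun s => c * s ^ k) 1 k (fun s => c * s ^ k) := by
  simpa using wlimOne_pow c 1 k

theorem Bad.exists_ord {k : ℕ} {c : ℝ} (hf : FiniteType f) (h : Bad f k c) :
    ∃ D : ℕ, (D : ℝ) = (1 + k) * distance f ∧ OrdGE f 1 k D ∧
      ∃ x ∈ taylorSupport f 0, 1 * x.1 + k * x.2 = D := by
  obtain ⟨D, hord, x, hx, hxD⟩ := exists_ordGE hf.nonempty 1 k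
  refine ⟨D, le_antisymm ?_ ?_, hord, x, hx, hxD⟩
  · simpa using hord.cast_le hf.nonempty
  · have := h.ord x hx
    rw [← hxD]; push_cast; linarith

theorem Bad.exists_points {k : ℕ} {c : ℝ} (hf : FiniteType f) (h : Bad f k c) :
    (∃ x ∈ taylorSupport f 0, (x.1 : ℝ) + k * x.2 = (1 + k) * distance f ∧
      (x.2 : ℝ) < distance f) ∧
    ∃ y ∈ taylorSupport f 0, (y.1 : ℝ) + k * y.2 = (1 + k) * distance f ∧
      (y.1 : ℝ) < distance f := by
  obtain ⟨D, hDd, hord, hD⟩ := h.exists_ord hf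
  have hk0 : (1 : ℝ) ≤ k := by exact_mod_cast h.one_le
  have hd0 := distance_nonneg hf.nonempty
  -- `⌊d⌋ + 1` is the least integer multiplicity exceeding `d`.
  obtain ⟨x, hx, y, hy, hxD, hyD, hxy⟩ := exists_edge_points (m := ⌊distance f⌋₊ + 1) hf h.one_le
    hord hD h.ne_zero (contDiffAt_monomial c k) (by simp; right; have := h.one_le; omega)
    (wlimOne_monomial c k) (by
    intro x hx hxD
    have h1 : (x.1 : ℝ) + k * x.2 = (1 + k) * distance f := by
      rw [← hDd, ← hxD]; push_cast; ring
    have h2 := h.root x hx h1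
    have h3 : ⌊distance f⌋₊ < x.2 := (Nat.floor_lt hd0).2 h2
    omega)
  have hxD' : (x.1 : ℝ) + k * x.2 = (1 + k) * distance f := by
    rw [← hDd, ← hxD]; push_cast; ring
  have hyD' : (y.1 : ℝ) + k * y.2 = (1 + k) * distance f := by
    rw [← hDd, ← hyD]; push_cast; ring
  have hxy' : (x.2 : ℝ) + (⌊distance f⌋₊ + 1) ≤ y.2 := by exact_mod_cast hxy
  have h1 := Nat.lt_floor_add_one (distance f)
  have hy1 : (0 : ℝ) ≤ y.1 := Nat.cast_nonneg _
  have hx2 : (x.2 : ℝ) < distance f := by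
    by_contra hcon
    push Not at hcon
    nlinarith
  exact ⟨⟨x, hx, hxD', hx2⟩, y, hy, hyD', by nlinarith⟩

/-- Good coordinates: no root off the axes has multiplicity larger than the distance. -/
def Good (f : ℝ × ℝ → ℝ) : Prop :=
  (∀ k c, ¬ Bad f k c) ∧ ∀ k c, ¬ Bad (f ∘ Prod.swap) k c

theorem Good.swap (h : Good f) : Good (f ∘ Prod.swap) :=
  ⟨h.2, by rw [comp_swap_swap]; exact h.1⟩

/-- Otherwise the root `c` has multiplicity above `d`, so the line is principal by
`line_eq_of_multiplicity`. Its initial form sees only the leading term of `ψ`, so the monomial shear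
exhibits a bad root. -/
theorem Good.exists_low_point (hf : FiniteType f) (h : ∀ k c, ¬ Bad f k c) {k D : ℕ} (hk : 1 ≤ k)
    (hord : OrdGE f 1 k D) (hD : ∃ x ∈ taylorSupport f 0, 1 * x.1 + k * x.2 = D) {ψ : ℝ → ℝ}
    {c : ℝ} (hc : c ≠ 0) (hψ : ContDiffAt ℝ ∞ ψ 0) (h0 : ψ 0 = 0)
    (hlim : WLimOne ψ 1 k (fun u => c * u ^ k)) :
    ∃ x ∈ taylorSupport (f ∘ shear ψ) 0, 1 * x.1 + k * x.2 = D ∧ (x.2 : ℝ) ≤ distance f := by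
  by_contra hcon
  push Not at hcon
  have hd0 := distance_nonneg hf.nonempty
  have hDd := line_eq_of_multiplicity (m := ⌊distance f⌋₊ + 1) hf hk hord hD hc hψ h0 hlim
    (by push_cast; exact (Nat.lt_floor_add_one _).le)
    (fun x hx hxD => (Nat.floor_lt hd0).2 (hcon x hx hxD))
  have hk0 : c * (0 : ℝ) ^ k = 0 := by rw [zero_pow (by omega), mul_zero]
  refine h k c ⟨hk, hc, fun x hx => ?_, fun x hx hxD => ?_⟩
  · rw [← hDd]
    have := hord x hx
    rw [one_mul] at this
    exact_mod_cast this
  · have hxD' : 1 * x.1 + k * x.2 = D := by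
      rw [← hDd] at hxD
      rw [one_mul]; exact_mod_cast hxD
    have h1 := (initForm_shear hf.smooth hψ h0 le_rfl hk hlim hord).2
    have h2 := (initForm_shear hf.smooth (contDiffAt_monomial c k) hk0 le_rfl hk
      (wlimOne_monomial c k) hord).2
    have h3 := initForm_coeff_eq (f := f ∘ shear fun s => c * s ^ k) (g := f ∘ shear ψ) le_rfl hk
      (fun v => by rw [h1, h2]) hxD'
    refine hcon x ?_ hxD'
    intro h4
    rw [h4] at h3
    exact hx h3

/-- If the leading term dominates, the low point on the line of weights `(1, k)` works, because `p
x₁ + q x₂ = p (x₁ + k x₂) + (q - p k) x₂`. Otherwise the shear preserves the weighted order, which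
is bounded by the distance of `f`. -/
theorem Good.exists_weight_le_shear (hf : FiniteType f) (h : ∀ k c, ¬ Bad f k c) {ψ : ℝ → ℝ}
    (hψ : ContDiffAt ℝ ∞ ψ 0) (h0 : ψ 0 = 0) {p q : ℕ} (hp : 1 ≤ p) (hq : 1 ≤ q) :
    ∃ x ∈ taylorSupport (f ∘ shear ψ) 0,
      (p : ℝ) * x.1 + q * x.2 ≤ ((p : ℝ) + q) * distance f := by
  rcases wlimOne_cases hψ h0 hp hq with ⟨k, hk, hkq, c, hc, hlead⟩ | ⟨k, hk, -, c, -, hlim⟩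
  · obtain ⟨D, hord, hD⟩ := exists_ordGE hf.nonempty 1 k
    have hlim : WLimOne ψ 1 k (fun u => c * u ^ k) := by
      simpa using wlimOne_leading (p := 1) le_rfl hlead
    obtain ⟨x, hx, hxD, hxd⟩ := Good.exists_low_point hf h hk hord hD hc hψ h0 hlim
    refine ⟨x, hx, ?_⟩
    have h1 := hord.cast_le hf.nonempty
    push_cast at h1
    have h2 : (x.1 : ℝ) + k * x.2 = D := by rw [← hxD]; push_cast; ring
    have h3 : (0 : ℝ) ≤ q - p * k := by
      have : ((p * k : ℕ) : ℝ) ≤ q := by exact_mod_cast hkq.le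
      push_cast at this; linarith
    have hp0 : (0 : ℝ) ≤ p := Nat.cast_nonneg _
    have h4 := mul_le_mul_of_nonneg_left hxd h3
    have h5 := mul_le_mul_of_nonneg_left h1 hp0
    rw [← h2] at h5
    nlinarith
  · by_contra hcon
    push Not at hcon
    have hd0 := distance_nonneg hf.nonempty
    have hN : OrdGE (f ∘ Newton.shear ψ) p q (⌊((p : ℝ) + q) * distance f⌋₊ + 1) := by
      intro x hx
      refine (Nat.floor_lt (by positivity)).2 ?_
      push_cast
      exact hcon x hx
    rw [ordGE_shear_iff hf.smooth hψ h0 hp hq hlim] at hN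
    have h1 := hN.cast_le hf.nonempty
    push_cast at h1
    linarith [Nat.lt_floor_add_one (((p : ℝ) + q) * distance f)]

theorem fderiv_comp_swap {E : ℝ × ℝ → ℝ × ℝ} (hE : DifferentiableAt ℝ E 0) (h : ℝ × ℝ) :
    fderiv ℝ (E ∘ Prod.swap) 0 h = fderiv ℝ E 0 h.swap := by
  have h1 : HasFDerivAt (Prod.swap : ℝ × ℝ → ℝ × ℝ)
      ((ContinuousLinearMap.snd ℝ ℝ ℝ).prod (ContinuousLinearMap.fst ℝ ℝ ℝ)) 0 :=
    hasFDerivAt_snd.prodMk hasFDerivAt_fst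
  have h2 : HasFDerivAt (E ∘ Prod.swap) ((fderiv ℝ E 0).comp
      ((ContinuousLinearMap.snd ℝ ℝ ℝ).prod (ContinuousLinearMap.fst ℝ ℝ ℝ))) 0 :=
    HasFDerivAt.comp (0 : ℝ × ℝ) (g := E) hE.hasFDerivAt h1
  rw [h2.fderiv]
  rfl

/-- Normal form of a coordinate change with respect to weights `p ≤ q`. -/
theorem exists_normal_form (hf : FiniteType f) (hg : ContDiffAt ℝ ∞ g 0) {E : ℝ × ℝ → ℝ × ℝ}
    (hE : ContDiffAt ℝ ∞ E 0) (hE0 : E 0 = 0) (hinj : Function.Injective (fderiv ℝ E 0))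
    (hfg : f =ᶠ[𝓝 0] g ∘ E) :
    ∃ f', (f' = f ∨ f' = f ∘ Prod.swap) ∧ ∃ ψ : ℝ → ℝ, ContDiffAt ℝ ∞ ψ 0 ∧ ψ 0 = 0 ∧
      ∃ α β γ : ℝ, α ≠ 0 ∧ β ≠ 0 ∧ ∀ p q N : ℕ, 1 ≤ p → p ≤ q → OrdGE g p q N →
        OrdGE (f' ∘ shear ψ) p q N ∧ ∀ u v, initForm (f' ∘ shear ψ) p q N u v =
          initForm g p q N (α * u + (if p = q then γ else 0) * v) (β * v) := by
  suffices H : ∀ (f' : ℝ × ℝ → ℝ) (E' : ℝ × ℝ → ℝ × ℝ), FiniteType f' → ContDiffAt ℝ ∞ E' 0 →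
      E' 0 = 0 → Function.Injective (fderiv ℝ E' 0) → f' =ᶠ[𝓝 0] g ∘ E' →
      (fderiv ℝ E' 0 (0, 1)).2 ≠ 0 → ∃ ψ : ℝ → ℝ, ContDiffAt ℝ ∞ ψ 0 ∧ ψ 0 = 0 ∧
      ∃ α β γ : ℝ, α ≠ 0 ∧ β ≠ 0 ∧ ∀ p q N : ℕ, 1 ≤ p → p ≤ q → OrdGE g p q N →
        OrdGE (f' ∘ shear ψ) p q N ∧ ∀ u v, initForm (f' ∘ shear ψ) p q N u v =
          initForm g p q N (α * u + (if p = q then γ else 0) * v) (β * v) by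
    -- In this case injectivity makes the second component depend on `x₁` to first order, so
    -- swapping the source variables restores the nondegeneracy.
    by_cases h2 : (fderiv ℝ E 0 (0, 1)).2 = 0
    · have hEd := hE.differentiableAt (by simp)
      refine ⟨f ∘ Prod.swap, Or.inr rfl, H _ (E ∘ Prod.swap) hf.swap ?_ hE0 ?_ ?_ ?_⟩
      · have h1 : ContDiffAt ℝ ∞ (Prod.swap : ℝ × ℝ → ℝ × ℝ) 0 := by
          have : ContDiffAt ℝ ∞ (fun x : ℝ × ℝ => (x.2, x.1)) 0 := by fun_prop
          exact this
        exact ContDiffAt.comp (g := E) (0 : ℝ × ℝ) hE h1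
      · intro a b hab
        rw [fderiv_comp_swap hEd, fderiv_comp_swap hEd] at hab
        exact Prod.swap_injective (hinj hab)
      · exact (hfg.comp_tendsto tendsto_swap_zero)
      · rw [fderiv_comp_swap hEd]
        intro h1
        set A := fderiv ℝ E 0
        simp only [Prod.swap_prod_mk] at h1
        have h3 : A ((A (0, 1)).1, -(A (1, 0)).1) = 0 := by
          have h4 : ((A (0, 1)).1, -(A (1, 0)).1) =
              (A (0, 1)).1 • ((1 : ℝ), (0 : ℝ)) + (-(A (1, 0)).1) • ((0 : ℝ), (1 : ℝ)) := by
            ext <;> simp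
          rw [h4, map_add, map_smul, map_smul]
          ext
          · simp; ring
          · simp [h1, h2]
        have h5 := hinj (h3.trans (map_zero A).symm)
        have h6 : (A (1, 0)).1 = 0 := by
          have := congrArg Prod.snd h5; simpa using this
        have h7 : A (1, 0) = 0 := by ext <;> simp [h6, h1]
        have h8 := hinj (h7.trans (map_zero A).symm)
        simp at h8
    · exact ⟨f, Or.inl rfl, H f E hf hE hE0 hinj hfg h2⟩
  intro f' E' hf' hE' hE0' hinj' hfg' h2
  obtain ⟨ψ, hψ, hψ0, α, β, γ, hα, hβ, hlim⟩ := exists_shear_wlim hE' hE0' hinj' h2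
  refine ⟨ψ, hψ, hψ0, α, β, γ, hα, hβ, fun p q N hp hpq hord => ?_⟩
  have ht : Tendsto (Newton.shear ψ) (𝓝 0) (𝓝 0) := by
    have := (contDiffAt_shear hψ).continuousAt.tendsto
    rwa [shear_zero hψ0] at this
  exact initForm_of_wlim (contDiffAt_comp_shear hf'.smooth hψ hψ0) hg
    (hfg'.comp_tendsto ht) hp (hp.trans hpq) (hlim p q hp hpq) hord

/-- In good coordinates the distance is maximal. -/
theorem Good.distance_le (hf : FiniteType f) (h : Good f) (hg : ContDiffAt ℝ ∞ g 0)
    {E : ℝ × ℝ → ℝ × ℝ} (hE : ContDiffAt ℝ ∞ E 0) (hE0 : E 0 = 0)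
    (hinj : Function.Injective (fderiv ℝ E 0)) (hfg : f =ᶠ[𝓝 0] g ∘ E) :
    distance g ≤ distance f := by
  have key : ∀ (g : ℝ × ℝ → ℝ) (E : ℝ × ℝ → ℝ × ℝ), ContDiffAt ℝ ∞ g 0 → ContDiffAt ℝ ∞ E 0 →
      E 0 = 0 → Function.Injective (fderiv ℝ E 0) → f =ᶠ[𝓝 0] g ∘ E → ∀ p q N : ℕ, 1 ≤ p →
      p ≤ q → OrdGE g p q N → (N : ℝ) ≤ ((p : ℝ) + q) * distance f := by
    intro g E hg hE hE0 hinj hfg p q N hp hpq hord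
    obtain ⟨f', hf', ψ, hψ, hψ0, _, _, _, -, -, H⟩ :=
      exists_normal_form hf hg hE hE0 hinj hfg
    have hN := (H p q N hp hpq hord).1
    have hfin' : FiniteType f' := by
      rcases hf' with rfl | rfl
      exacts [hf, hf.swap]
    have hgood' : Good f' := by
      rcases hf' with rfl | rfl
      exacts [h, h.swap]
    have hd' : distance f' = distance f := by
      rcases hf' with rfl | rfl
      exacts [rfl, distance_swap hf.smooth hf.nonempty]
    obtain ⟨x, hx, hxd⟩ := Good.exists_weight_le_shear hfin' hgood'.1 hψ hψ0 hp (hp.trans hpq)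
    rw [hd'] at hxd
    have h1 := hN x hx
    have h2 : (N : ℝ) ≤ p * x.1 + q * x.2 := by exact_mod_cast h1
    linarith
  have hgfin : FiniteType g := hf.of_comp hg hE hE0 hfg
  refine distance_le_of_weights hgfin.nonempty fun p q hp hq => ?_
  obtain ⟨D, hord, x, hx, hxD⟩ := exists_ordGE hgfin.nonempty p q
  refine ⟨x, hx, ?_⟩
  have hxD' : (p : ℝ) * x.1 + q * x.2 = D := by exact_mod_cast hxD
  rw [hxD']
  -- The normal form requires `p ≤ q`; in the other case the coordinates of `g` are swapped.
  rcases le_total p q with hpq | hpq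
  · exact key g E hg hE hE0 hinj hfg p q D hp hpq hord
  · rw [add_comm]
    have hsw : ContDiffAt ℝ ∞ (Prod.swap : ℝ × ℝ → ℝ × ℝ) (E 0) := by
      have : ContDiffAt ℝ ∞ (fun x : ℝ × ℝ => (x.2, x.1)) (E 0) := by fun_prop
      exact this
    refine key (g ∘ Prod.swap) (Prod.swap ∘ E) (contDiffAt_comp_swap hg)
      (ContDiffAt.comp (0 : ℝ × ℝ) hsw hE) (by simp [hE0]) ?_ ?_ q p D hq hpq (hord.swap hg)
    · have h1 : HasFDerivAt (Prod.swap : ℝ × ℝ → ℝ × ℝ)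
          ((ContinuousLinearMap.snd ℝ ℝ ℝ).prod (ContinuousLinearMap.fst ℝ ℝ ℝ)) (E 0) :=
        hasFDerivAt_snd.prodMk hasFDerivAt_fst
      have h2 := (h1.comp (0 : ℝ × ℝ) (hE.differentiableAt (by simp)).hasFDerivAt).fderiv
      rw [h2]
      intro a b hab
      exact hinj (Prod.swap_injective hab)
    · refine hfg.trans (Eventually.of_forall fun x => ?_)
      simp

end

/-! ### Steep supporting lines and Borel's lemma -/

section

variable {f g : ℝ × ℝ → ℝ}

/-- The supporting line of slope `k` touches the support at a lowest point above the diagonal. -/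
def Steep (f : ℝ × ℝ → ℝ) (k : ℕ) : Prop :=
  ∃ x₀ ∈ taylorSupport f 0, x₀.1 < x₀.2 ∧ ∀ x ∈ taylorSupport f 0,
    x₀.1 + k * x₀.2 ≤ x.1 + k * x.2 ∧ (x₀.1 + k * x₀.2 = x.1 + k * x.2 → x₀.2 ≤ x.2)

theorem exists_on_line_shear (hf : FiniteType f) {ψ G : ℝ → ℝ} (hψ : ContDiffAt ℝ ∞ ψ 0)
    (h0 : ψ 0 = 0) {p q D : ℕ} (hp : 1 ≤ p) (hq : 1 ≤ q) (hG : WLimOne ψ p q G)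
    (hord : OrdGE f p q D) (hD : ∃ x ∈ taylorSupport f 0, p * x.1 + q * x.2 = D) :
    ∃ x ∈ taylorSupport (f ∘ shear ψ) 0, p * x.1 + q * x.2 = D := by
  by_contra hcon
  push Not at hcon
  obtain ⟨x, hx, hxD⟩ := hD
  refine hx (taylorCoeff_eq_zero_of_initForm hp hq (fun v => ?_) hxD)
  have h1 := (initForm_shear hf.smooth hψ h0 hp hq hG hord).2 1 (v - G 1)
  rw [sub_add_cancel] at h1
  rw [← h1]
  refine Finset.sum_eq_zero fun y hy => ?_
  rw [mem_line hp hq] at hy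
  have : taylorCoeff (f ∘ Newton.shear ψ) 0 y.1 y.2 = 0 := by
    by_contra h2
    exact hcon y h2 hy
  rw [this]; ring

theorem monomial_zero (c : ℝ) {k : ℕ} (hk : 1 ≤ k) : c * (0 : ℝ) ^ k = 0 := by
  rw [zero_pow (by omega), mul_zero]

/-- After the shear all support points on the principal line have second exponent above `d`, so the
lowest of them lies above the bisectrix. -/
theorem Bad.steep (hf : FiniteType f) {k : ℕ} {c : ℝ} (h : Bad f k c) :
    Steep (f ∘ shear fun s => c * s ^ k) k := by
  obtain ⟨D, hDd, hord, hD⟩ := h.exists_ord hf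
  have hk0 := monomial_zero c h.one_le
  have hord' := (initForm_shear hf.smooth (contDiffAt_monomial c k) hk0 le_rfl h.one_le
    (wlimOne_monomial c k) hord).1
  have hne := exists_on_line_shear hf (contDiffAt_monomial c k) hk0 le_rfl h.one_le
    (wlimOne_monomial c k) hord hD
  set S : Set (ℕ × ℕ) := {x | x ∈ taylorSupport (f ∘ Newton.shear fun s => c * s ^ k) 0 ∧
    1 * x.1 + k * x.2 = D}
  have hS : S.Nonempty := hne
  have hmem := Function.argminOn_mem Prod.snd S hS
  set x₀ := Function.argminOn Prod.snd S hS
  refine ⟨x₀, hmem.1, ?_, fun x hx => ⟨?_, fun heq => ?_⟩⟩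
  · have h1 : (x₀.1 : ℝ) + k * x₀.2 = (1 + k) * distance f := by
      rw [← hDd, ← hmem.2]; push_cast; ring
    have h2 := h.root x₀ hmem.1 h1
    have hk1 : (1 : ℝ) ≤ k := by exact_mod_cast h.one_le
    have : (x₀.1 : ℝ) < x₀.2 := by nlinarith
    exact_mod_cast this
  · have h1 := hord' x hx
    have h2 := hmem.2
    omega
  · refine Function.argminOn_le Prod.snd S ⟨hx, ?_⟩
    have h2 := hmem.2
    omega

/-- The bad edge has a point below `x₀`. Comparing the two supporting lines at it and at `x₀` gives
`k₀ ≤ k`, and equality contradicts that `x₀` is lowest. This makes the exponents increase during the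
removal of bad roots. -/
theorem Steep.lt_of_bad (hf : FiniteType f) {k₀ k : ℕ} {c : ℝ} (hs : Steep f k₀)
    (h : Bad f k c) : k₀ < k := by
  obtain ⟨x₀, hx₀, hlt, hall⟩ := hs
  obtain ⟨⟨x, hx, hxd, hx2⟩, -⟩ := h.exists_points hf
  have h1 := h.ord x₀ hx₀
  obtain ⟨h2, h3⟩ := hall x hx
  have h4 : distance f ≤ x₀.2 := by
    refine distance_le_of_mem_support hx₀ ?_ le_rfl
    exact_mod_cast hlt.le
  have h5 : x.2 < x₀.2 := by exact_mod_cast hx2.trans_le h4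
  rw [← hxd] at h1
  have h1' : x.1 + k * x.2 ≤ x₀.1 + k * x₀.2 := by exact_mod_cast h1
  by_contra hcon
  push Not at hcon
  have h6 : k * (x₀.2 - x.2) ≤ k₀ * (x₀.2 - x.2) := Nat.mul_le_mul_right _ hcon
  obtain ⟨m, hm⟩ := Nat.exists_eq_add_of_lt h5
  rw [show x₀.2 - x.2 = m + 1 by omega] at h6
  rw [hm] at h1' h2 h3
  have h7 := h3 (by nlinarith)
  omega

/-- The swapped bad edge would also have a point below `x₀`. Supporting lines of weights `(1, k₀)`
and `(k, 1)` allow this only if both weights are `(1, 1)`, where `x₀` is lowest. So no further swap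
is needed once a bad root has been removed. -/
theorem Steep.not_bad_swap (hf : FiniteType f) {k₀ k : ℕ} {c : ℝ} (hk₀ : 1 ≤ k₀)
    (hs : Steep f k₀) : ¬ Bad (f ∘ Prod.swap) k c := by
  intro h
  obtain ⟨x₀, hx₀, hlt, hall⟩ := hs
  obtain ⟨-, y, hy, hyd, hy1⟩ := h.exists_points hf.swap
  have h1 := h.ord x₀.swap ((mem_taylorSupport_swap hf.smooth).2 (by simpa using hx₀))
  rw [distance_swap hf.smooth hf.nonempty] at h1 hyd hy1
  obtain ⟨h2, h3⟩ := hall _ ((mem_taylorSupport_swap hf.smooth).1 hy)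
  simp only [Prod.fst_swap, Prod.snd_swap] at h1 h2 h3
  have h4 : distance f ≤ x₀.2 := by
    refine distance_le_of_mem_support hx₀ ?_ le_rfl
    exact_mod_cast hlt.le
  have h5 : y.1 < x₀.2 := by exact_mod_cast hy1.trans_le h4
  rw [← hyd] at h1
  have h1' : y.1 + k * y.2 ≤ x₀.2 + k * x₀.1 := by exact_mod_cast h1
  obtain ⟨m, hm⟩ := Nat.exists_eq_add_of_lt h5
  rw [hm] at h1' h2 h3
  have hk := h.one_le
  rcases Nat.lt_or_ge x₀.1 y.2 with h6 | h6
  · obtain ⟨n, hn⟩ := Nat.exists_eq_add_of_lt h6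
    rw [hn] at h1' h2 h3
    have h7 : k * (n + 1) ≤ m + 1 := by nlinarith
    have h8 : k₀ * (m + 1) ≤ n + 1 := by nlinarith
    have h9 : n + 1 ≤ k * (n + 1) := Nat.le_mul_of_pos_left _ hk
    have h10 : m + 1 ≤ k₀ * (m + 1) := Nat.le_mul_of_pos_left _ hk₀
    have h11 := h3 (by nlinarith)
    omega
  · have h8 : k₀ * (m + 1) ≤ 0 := by nlinarith
    have h10 : m + 1 ≤ k₀ * (m + 1) := Nat.le_mul_of_pos_left _ hk₀
    omega

/-- A shear of order `k + 1` is invisible for the weights `(1, k)`. Steepness thus passes to the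
Borel sum. -/
theorem Steep.shear (hf : FiniteType f) {k : ℕ} (hk : 1 ≤ k) (hs : Steep f k) {η : ℝ → ℝ}
    (hη : ContDiffAt ℝ ∞ η 0) (h0 : η 0 = 0) (hO : η =O[𝓝 0] (fun x => x ^ (k + 1))) :
    Steep (f ∘ shear η) k := by
  obtain ⟨x₀, hx₀, hlt, hall⟩ := hs
  have hord : OrdGE f 1 k (x₀.1 + k * x₀.2) := fun x hx => by
    have := (hall x hx).1; omega
  have hlim : WLimOne η 1 k (fun _ => 0) := wlimOne_of_isBigO (K := k + 1) le_rfl (by omega) hO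
  obtain ⟨h1, h2⟩ := initForm_shear hf.smooth hη h0 le_rfl hk hlim hord
  have hco : ∀ x : ℕ × ℕ, x₀.1 + k * x₀.2 = x.1 + k * x.2 →
      taylorCoeff (f ∘ Newton.shear η) 0 x.1 x.2 = taylorCoeff f 0 x.1 x.2 := by
    intro x hx
    exact initForm_coeff_eq le_rfl hk (fun v => by rw [h2, add_zero]) (by rw [one_mul]; exact hx.symm)
  refine ⟨x₀, ?_, hlt, fun x hx => ⟨?_, fun heq => ?_⟩⟩
  · change taylorCoeff _ 0 _ _ ≠ 0
    rw [hco x₀ rfl]; exact hx₀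
  · have := h1 x hx; omega
  · refine (hall x ?_).2 heq
    change taylorCoeff _ 0 _ _ ≠ 0
    rw [← hco x heq]; exact hx

/-- Borel's lemma in one variable. -/
theorem exists_contDiff_taylor (a : ℕ → ℝ) : ∃ ψ : ℝ → ℝ, ContDiff ℝ ∞ ψ ∧
    ∀ M, (fun x => ψ x - ∑ n ∈ range M, a n * x ^ n) =O[𝓝 0] (fun x => x ^ M) := by
  let χ : ContDiffBump (0 : ℝ) := ⟨1, 2, one_pos, one_lt_two⟩
  have hχ : ContDiff ℝ ∞ χ := χ.contDiff
  have hχc : HasCompactSupport χ := χ.hasCompactSupport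
  set h : ℕ → ℝ → ℝ := fun n x => x ^ n * χ x
  have hh : ∀ n, ContDiff ℝ ∞ (h n) := fun n => (contDiff_id.pow n).mul hχ
  have hhc : ∀ n, HasCompactSupport (h n) := fun n => hχc.mul_left
  have hC : ∀ n, ∃ C : ℝ, 0 ≤ C ∧ ∀ k < n, ∀ x, ‖iteratedFDeriv ℝ k (h n) x‖ ≤ C := by
    intro n
    have h1 : ∀ k : ℕ, ∃ C, ∀ x, ‖iteratedFDeriv ℝ k (h n) x‖ ≤ C := fun k =>
      ((hh n).continuous_iteratedFDeriv (by exact_mod_cast le_top)).bounded_above_of_compact_support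
        ((hhc n).iteratedFDeriv k)
    choose C hC using h1
    refine ⟨∑ k ∈ range n, |C k|, Finset.sum_nonneg fun _ _ => abs_nonneg _, fun k hk x => ?_⟩
    exact (hC k x).trans ((le_abs_self _).trans
      (Finset.single_le_sum (f := fun k => |C k|) (fun _ _ => abs_nonneg _) (by simpa using hk)))
  choose C hC0 hC using hC
  -- The scale of the `n`-th cutoff: at least 2, so the cutoff lives in `|x| ≤ 1`, and large enough
  -- for the geometric bounds `hla` (remainder) and `hlC` (derivatives).
  set l : ℕ → ℝ := fun n => 2 + 2 * |a n| * 2 ^ n * (1 + C n)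
  have hl2 : ∀ n, 2 ≤ l n := fun n => by
    have := hC0 n
    have : 0 ≤ 2 * |a n| * 2 ^ n * (1 + C n) := by positivity
    simp only [l]; linarith
  have hl0 : ∀ n, 0 < l n := fun n => by linarith [hl2 n]
  have hla : ∀ n, |a n| * (2 / l n) ≤ (1 / 2) ^ n := fun n => by
    have h1 := hC0 n
    have h2 : 0 ≤ 2 * |a n| * 2 ^ n * C n := by positivity
    rw [← mul_div_assoc, div_le_iff₀ (hl0 n), one_div, inv_pow, ← div_eq_inv_mul,
      le_div_iff₀ (by positivity)]
    simp only [l]; linarith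
  have hlC : ∀ n, |a n| * (C n / l n) ≤ (1 / 2) ^ n := fun n => by
    have h1 := hC0 n
    have h2 : 0 ≤ |a n| * 2 ^ n * C n := by positivity
    have h3 : 0 ≤ |a n| * 2 ^ n := by positivity
    rw [← mul_div_assoc, div_le_iff₀ (hl0 n), one_div, inv_pow, ← div_eq_inv_mul,
      le_div_iff₀ (by positivity)]
    simp only [l]; linarith
  set g : ℕ → ℝ → ℝ := fun n x => a n * x ^ n * χ (l n * x)
  have hg : ∀ n, ContDiff ℝ ∞ (g n) := fun n =>
    (contDiff_const.mul (contDiff_id.pow n)).mul (hχ.comp (contDiff_const.mul contDiff_id))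
  have hgh : ∀ n, g n = fun x => (a n * ((l n)⁻¹) ^ n) * h n (l n * x) := by
    intro n
    funext x
    have := (hl0 n).ne'
    simp only [g, h, mul_pow, inv_pow]
    field_simp
  refine ⟨fun x => ∑' n, g n x, ?_, fun M => ?_⟩
  · refine contDiff_tsum_of_eventually (v := fun _ n => (1 / 2 : ℝ) ^ n) hg
      (fun _ _ => summable_geometric_two) fun k _ => ?_
    rw [Nat.cofinite_eq_atTop]
    filter_upwards [eventually_gt_atTop k] with n hn x
    rw [norm_iteratedFDeriv_eq_norm_iteratedDeriv, hgh n, iteratedDeriv_const_mul_field,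
      iteratedDeriv_comp_const_mul ((hh n).of_le (by exact_mod_cast le_top)) (l n)]
    beta_reduce
    rw [norm_mul (a n * _), norm_mul (a n), norm_mul (l n ^ k),
      ← norm_iteratedFDeriv_eq_norm_iteratedDeriv, norm_pow, norm_pow, norm_inv]
    simp only [Real.norm_eq_abs, abs_of_pos (hl0 n)]
    have h1 := hC n k hn (l n * x)
    refine le_trans ?_ (hlC n)
    obtain ⟨m, rfl⟩ := Nat.exists_eq_add_of_lt hn
    -- With fewer than `n` derivatives at least one factor `(l n)⁻¹` is left over.
    have h2 : (l (k + m + 1))⁻¹ ^ (k + m + 1) * l (k + m + 1) ^ k ≤ (l (k + m + 1))⁻¹ := by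
      have h3 : (l (k + m + 1))⁻¹ ^ (k + m + 1) * l (k + m + 1) ^ k =
          (l (k + m + 1))⁻¹ ^ m * (l (k + m + 1))⁻¹ := by
        have h4 : (l (k + m + 1))⁻¹ ^ k * l (k + m + 1) ^ k = 1 := by
          rw [← mul_pow, inv_mul_cancel₀ (hl0 (k + m + 1)).ne', one_pow]
        rw [pow_succ, pow_add]
        linear_combination (l (k + m + 1))⁻¹ ^ m * (l (k + m + 1))⁻¹ * h4
      rw [h3]
      refine mul_le_of_le_one_left (inv_nonneg.2 (hl0 _).le) ?_
      exact pow_le_one₀ (inv_nonneg.2 (hl0 _).le)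
        (inv_le_one_of_one_le₀ (by linarith [hl2 (k + m + 1)]))
    calc _ = |a (k + m + 1)| * (((l (k + m + 1))⁻¹ ^ (k + m + 1) * l (k + m + 1) ^ k) *
          ‖iteratedFDeriv ℝ k (h (k + m + 1)) (l (k + m + 1) * x)‖) := by ring
      _ ≤ |a (k + m + 1)| * ((l (k + m + 1))⁻¹ * C (k + m + 1)) := by
          gcongr
          exact inv_nonneg.2 (hl0 _).le
      _ = _ := by rw [div_eq_inv_mul]
  · have hχ1 : ∀ y, |χ y| ≤ 1 := fun y => by
      rw [abs_of_nonneg χ.nonneg]; exact χ.le_one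
    -- Beyond the term of index `M`, one spare factor `|x| ≤ 2 / l` on the support of the cutoff
    -- absorbs the coefficient.
    have hbound : ∀ n, ∀ x, |g (n + M) x| ≤ |x| ^ M * ((1 / 2) ^ (n + M) + if n = 0 then |a M| else 0) := by
      intro n x
      by_cases hx : χ (l (n + M) * x) = 0
      · simp only [g, hx, mul_zero, abs_zero]
        have : (0 : ℝ) ≤ if n = 0 then |a M| else 0 := by split_ifs <;> positivity
        positivity
      · have hx2 : |x| ≤ 2 / l (n + M) := by
          rw [le_div_iff₀ (hl0 _)]
          by_contra hcon
          push Not at hcon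
          apply hx
          refine χ.zero_of_le_dist ?_
          rw [dist_zero_right, Real.norm_eq_abs, abs_mul, abs_of_pos (hl0 _)]
          change 2 ≤ _
          linarith
        have h1 : |g (n + M) x| ≤ |a (n + M)| * |x| ^ (n + M) := by
          simp only [g, abs_mul, abs_pow]
          exact mul_le_of_le_one_right (by positivity) (hχ1 _)
        refine h1.trans ?_
        rw [pow_add |x|]
        rcases n with _ | n
        · have : (0 : ℝ) ≤ (1 / 2) ^ M := by positivity
          have : (0 : ℝ) ≤ |x| ^ M := by positivity
          simp only [zero_add, pow_zero, one_mul, if_true]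
          nlinarith
        · rw [if_neg (Nat.succ_ne_zero n), add_zero]
          have h2 : |x| ^ (n + 1) ≤ 2 / l (n + 1 + M) := by
            have h3 : |x| ≤ 1 := hx2.trans ((div_le_one (hl0 _)).2 (hl2 _))
            calc |x| ^ (n + 1) ≤ |x| ^ 1 :=
                  pow_le_pow_of_le_one (abs_nonneg _) h3 (by omega)
              _ ≤ _ := by rw [pow_one]; exact hx2
          calc _ = |x| ^ M * (|a (n + 1 + M)| * |x| ^ (n + 1)) := by ring
            _ ≤ |x| ^ M * (|a (n + 1 + M)| * (2 / l (n + 1 + M))) := by gcongr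
            _ ≤ _ := by gcongr; exact hla _
    have hsb : Summable fun n : ℕ => ((1 / 2 : ℝ) ^ (n + M) + if n = 0 then |a M| else 0) := by
      refine Summable.add ?_ ?_
      · simp_rw [pow_add]
        exact summable_geometric_two.mul_right _
      · exact summable_of_ne_finset_zero (s := {0}) fun n hn => by
          rw [if_neg (by simpa using hn)]
    have hnear : ∀ᶠ x : ℝ in 𝓝 0, ∀ n ∈ range M, g n x = a n * x ^ n := by
      rw [Filter.eventually_all_finset]
      intro n _
      have h1 : Tendsto (fun x : ℝ => l n * x) (𝓝 0) (𝓝 0) :=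
        (continuous_const.mul continuous_id).tendsto' _ _ (by simp)
      filter_upwards [h1.eventually χ.eventuallyEq_one] with x hx
      simp only [g, hx]
      simp
    refine IsBigO.of_bound (∑' n : ℕ, ((1 / 2 : ℝ) ^ (n + M) + if n = 0 then |a M| else 0)) ?_
    filter_upwards [hnear] with x hx
    have hst : Summable fun n => g (n + M) x :=
      Summable.of_norm_bounded (hsb.mul_left (|x| ^ M)) fun n => hbound n x
    have hs : Summable fun n => g n x := (summable_nat_add_iff M).1 hst
    rw [← hs.sum_add_tsum_nat_add M, Finset.sum_congr rfl hx, add_sub_cancel_left]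
    refine (tsum_of_norm_bounded (hsb.mul_left (|x| ^ M)).hasSum fun n => hbound n x).trans ?_
    rw [tsum_mul_left, norm_pow, Real.norm_eq_abs, mul_comm]

end

/-! ### Existence of good coordinates -/

section

variable {f g : ℝ × ℝ → ℝ}

theorem isBigO_pow_of_le {m n : ℕ} (h : m ≤ n) :
    (fun x : ℝ => x ^ n) =O[𝓝 0] (fun x => x ^ m) := by
  refine IsBigO.of_bound 1 ?_
  filter_upwards [Metric.closedBall_mem_nhds (0 : ℝ) one_pos] with x hx
  rw [one_mul, norm_pow, norm_pow]
  exact pow_le_pow_of_le_one (norm_nonneg _) (by simpa using hx) h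

theorem polynomial_taylor (P : Polynomial ℝ) (M : ℕ) :
    (fun x => P.eval x - ∑ n ∈ range M, P.coeff n * x ^ n) =O[𝓝 0] (fun x => x ^ M) := by
  induction P using Polynomial.induction_on' with
  | add P Q hP hQ =>
    refine (hP.add hQ).congr_left fun x => ?_
    simp only [Polynomial.eval_add, Polynomial.coeff_add, add_mul, Finset.sum_add_distrib]
    ring
  | monomial n c =>
    by_cases hn : n < M
    · refine (isBigO_zero _ _).congr_left fun x => ?_
      rw [Finset.sum_eq_single n]
      · simp
      · intro b _ hb
        rw [Polynomial.coeff_monomial, if_neg hb.symm, zero_mul]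
      · intro h; simp at h; omega
    · refine ((isBigO_pow_of_le (not_lt.1 hn)).const_mul_left c).congr_left fun x => ?_
      rw [Finset.sum_eq_zero fun b hb => ?_]
      · simp
      · rw [Polynomial.coeff_monomial, if_neg, zero_mul]
        simp at hb; omega

theorem contDiff_polynomial_eval (P : Polynomial ℝ) : ContDiff ℝ ∞ (fun s : ℝ => P.eval s) := by
  simpa [Polynomial.aeval_def] using P.contDiff_aeval (𝕜 := ℝ) (R := ℝ) ∞

theorem comp_shear_comp_shear (f : ℝ × ℝ → ℝ) (ψ η : ℝ → ℝ) :
    (f ∘ shear ψ) ∘ shear η = f ∘ shear fun x => ψ x + η x := by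
  funext z
  simp only [Function.comp, shear_shear]

/-- There is a shear (possibly after swapping the coordinates) to good coordinates. -/
theorem exists_good_of_bad (hf : FiniteType f) {k₀ : ℕ} {c₀ : ℝ} (hbad : Bad f k₀ c₀) :
    ∃ ψ : ℝ → ℝ, ContDiff ℝ ∞ ψ ∧ ψ 0 = 0 ∧ Good (f ∘ shear ψ) := by
  by_contra hcon
  push Not at hcon
  have step : ∀ ψ : ℝ → ℝ, ContDiff ℝ ∞ ψ → ψ 0 = 0 → ∀ k, 1 ≤ k → Steep (f ∘ shear ψ) k →
      ∃ k₁ c, Bad (f ∘ shear ψ) k₁ c := by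
    intro ψ hψ h0 k hk hs
    by_contra h
    push Not at h
    exact hcon ψ hψ h0 ⟨h, fun k' c' => hs.not_bad_swap (hf.shear hψ.contDiffAt h0) hk⟩
  -- A state consists of the shear accumulated so far and its last exponent. Each step adds a
  -- monomial of strictly larger exponent.
  let σ := {x : Polynomial ℝ × ℕ // x.1.eval 0 = 0 ∧ 1 ≤ x.2 ∧
    Steep (f ∘ shear fun s => x.1.eval s) x.2}
  have hnext : ∀ s : σ, ∃ s' : σ, s.1.2 < s'.1.2 ∧
      ∃ c : ℝ, s'.1.1 = s.1.1 + Polynomial.monomial s'.1.2 c := by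
    rintro ⟨⟨P, k⟩, h0, hk, hs⟩
    have hP : ContDiff ℝ ∞ (fun s => P.eval s) := contDiff_polynomial_eval P
    obtain ⟨k₁, c, hb⟩ := step _ hP h0 k hk hs
    have hfin := hf.shear hP.contDiffAt h0
    have h1 := hb.steep hfin
    rw [comp_shear_comp_shear] at h1
    refine ⟨⟨(P + Polynomial.monomial k₁ c, k₁), ?_, hb.one_le, ?_⟩, hs.lt_of_bad hfin hb, c, rfl⟩
    · have := monomial_zero c hb.one_le
      simp only [Polynomial.eval_add, Polynomial.eval_monomial, this, add_zero]
      exact h0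
    · simpa using h1
  choose next hlt hmon using hnext
  let s₀ : σ := ⟨(Polynomial.monomial k₀ c₀, k₀), by
    have := monomial_zero c₀ hbad.one_le
    simpa using this, hbad.one_le, by simpa using hbad.steep hf⟩
  let S : ℕ → σ := fun n => next^[n] s₀
  have hS : ∀ n, S (n + 1) = next (S n) := fun n => Function.iterate_succ_apply' next n s₀
  have hkmono : StrictMono fun n => (S n).1.2 := strictMono_nat_of_lt_succ fun n => by
    rw [hS]; exact hlt _
  have hcoeff : ∀ i n, n ≤ (S i).1.2 → ∀ j, i ≤ j → (S j).1.1.coeff n = (S i).1.1.coeff n := by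
    intro i n hn j hij
    induction j, hij using Nat.le_induction with
    | base => rfl
    | succ j hij ih =>
      obtain ⟨c, hc⟩ := hmon (S j)
      rw [hS, hc, Polynomial.coeff_add, ih, Polynomial.coeff_monomial, if_neg, add_zero]
      have h1 := hlt (S j)
      have h2 := hkmono.monotone hij
      omega
  have hk : ∀ n, n ≤ (S n).1.2 := fun n => hkmono.id_le n
  -- The exponent at stage `n` is at least `n`, so the `n`-th coefficient is final from that stage
  -- on.
  obtain ⟨ψ, hψ, hψt⟩ := exists_contDiff_taylor fun n => (S n).1.1.coeff n
  have hψ0 : ψ 0 = 0 := by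
    obtain ⟨C, hC⟩ := (hψt 1).bound
    have h1 := hC.self_of_nhds
    have h2 : (S 0).1.1.coeff 0 = 0 := by
      rw [Polynomial.coeff_zero_eq_eval_zero]; exact (S 0).2.1
    simpa [h2] using h1
  have hsteep : ∀ i, Steep (f ∘ shear ψ) (S i).1.2 := by
    intro i
    have hP : ContDiff ℝ ∞ (fun s => (S i).1.1.eval s) := contDiff_polynomial_eval _
    have hη : ContDiff ℝ ∞ (fun s => ψ s - (S i).1.1.eval s) := hψ.sub hP
    have hO : (fun s => ψ s - (S i).1.1.eval s) =O[𝓝 0] (fun x => x ^ ((S i).1.2 + 1)) := by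
      refine ((hψt ((S i).1.2 + 1)).sub (polynomial_taylor (S i).1.1 ((S i).1.2 + 1))).congr_left
        fun x => ?_
      have : ∑ n ∈ range ((S i).1.2 + 1), (S n).1.1.coeff n * x ^ n =
          ∑ n ∈ range ((S i).1.2 + 1), (S i).1.1.coeff n * x ^ n := by
        refine Finset.sum_congr rfl fun n hn => ?_
        have hn' : n ≤ (S i).1.2 := by simpa [Nat.lt_succ_iff] using hn
        rcases le_total n i with h | h
        · rw [hcoeff n n (hk n) i h]
        · rw [hcoeff i n hn' n h]
      rw [this]; ring
    have := (S i).2.2.2.shear (hf.shear hP.contDiffAt (S i).2.1) (S i).2.2.1 hη.contDiffAt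
      (by simp only [hψ0, (S i).2.1, sub_zero]) hO
    rw [comp_shear_comp_shear] at this
    simpa using this
  -- The sum is steep for every exponent of the process, so a bad exponent would exceed all of
  -- these, which are unbounded.
  obtain ⟨k₁, c, hb⟩ := step ψ hψ hψ0 _ (S 0).2.2.1 (hsteep 0)
  have := (hsteep k₁).lt_of_bad (hf.shear hψ.contDiffAt hψ0) hb
  exact absurd (hk k₁) (by omega)

theorem comp_shear_const_zero (f : ℝ × ℝ → ℝ) : (f ∘ shear fun _ => 0) = f := by
  funext z; simp [shear]

theorem exists_good (hf : FiniteType f) : ∃ f', (f' = f ∨ f' = f ∘ Prod.swap) ∧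
    ∃ ψ : ℝ → ℝ, ContDiff ℝ ∞ ψ ∧ ψ 0 = 0 ∧ Good (f' ∘ shear ψ) := by
  by_cases hgood : Good f
  · exact ⟨f, Or.inl rfl, fun _ => 0, contDiff_const, rfl, by rwa [comp_shear_const_zero]⟩
  · rw [Good, not_and_or] at hgood
    push Not at hgood
    rcases hgood with ⟨k, c, hb⟩ | ⟨k, c, hb⟩
    · exact ⟨f, Or.inl rfl, exists_good_of_bad hf hb⟩
    · exact ⟨_, Or.inr rfl, exists_good_of_bad hf.swap hb⟩

end

/-! ### Local coordinates: adapted means good -/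

section

variable {f g φ : ℝ × ℝ → ℝ} {e e₁ e₂ : OpenPartialHomeomorph (ℝ × ℝ) (ℝ × ℝ)}

/-- Tilting the line to the weights `(b, b k + 1)` with `b = ⌊d⌋ + 1` raises the order to `b D + b`,
which is more than these weights give at `(d, d)`. -/
theorem lt_distance_of_line (hf : FiniteType f) {k D : ℕ} {d : ℝ} (hord : OrdGE f 1 k D)
    (hd0 : 0 ≤ d) (hD : (D : ℝ) = (1 + k) * d)
    (h : ∀ x ∈ taylorSupport f 0, 1 * x.1 + k * x.2 = D → d < x.2) : d < distance f := by
  set b := ⌊d⌋₊ + 1 with hb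
  have hbd : d < b := by rw [hb]; push_cast; exact Nat.lt_floor_add_one d
  have hord' : OrdGE f b (b * k + 1) (b * D + b) := by
    intro x hx
    rcases (hord x hx).eq_or_lt with heq | hlt
    · have h1 : b ≤ x.2 := (Nat.floor_lt hd0).2 (h x hx heq.symm)
      rw [heq]; nlinarith
    · have h2 : b * (D + 1) ≤ b * (1 * x.1 + k * x.2) := Nat.mul_le_mul_left _ hlt
      nlinarith [Nat.zero_le x.2]
  have h1 := hord'.cast_le hf.nonempty
  push_cast at h1
  rw [hD] at h1
  have hk : (0 : ℝ) ≤ k := Nat.cast_nonneg k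
  by_contra hcon
  push Not at hcon
  have h2 : ((b : ℝ) + (b * k + 1)) * distance f ≤ ((b : ℝ) + (b * k + 1)) * d :=
    mul_le_mul_of_nonneg_left hcon (by positivity)
  nlinarith

theorem Bad.lt_distance (hf : FiniteType f) {k : ℕ} {c : ℝ} (h : Bad f k c) :
    distance f < distance (f ∘ shear fun s => c * s ^ k) := by
  obtain ⟨D, hDd, hord, hD⟩ := h.exists_ord hf
  have hk0 := monomial_zero c h.one_le
  have hord' := (initForm_shear hf.smooth (contDiffAt_monomial c k) hk0 le_rfl h.one_le
    (wlimOne_monomial c k) hord).1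
  refine lt_distance_of_line (hf.shear (contDiffAt_monomial c k) hk0) hord'
    (distance_nonneg hf.nonempty) hDd fun x hx hxD => h.root x hx ?_
  rw [← hDd, ← hxD]; push_cast; ring

theorem IsLocalCoordinates.zero_mem_target (he : IsLocalCoordinates e) :
    (0 : ℝ × ℝ) ∈ e.target := by
  have := e.map_source he.1
  rwa [he.2.1] at this

theorem IsLocalCoordinates.symm_zero (he : IsLocalCoordinates e) : e.symm 0 = 0 := by
  have := e.left_inv he.1
  rwa [he.2.1] at this

theorem IsLocalCoordinates.contDiffAt (he : IsLocalCoordinates e) : ContDiffAt ℝ ∞ e 0 :=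
  he.2.2.1.contDiffAt (e.open_source.mem_nhds he.1)

theorem IsLocalCoordinates.contDiffAt_symm (he : IsLocalCoordinates e) :
    ContDiffAt ℝ ∞ e.symm 0 :=
  he.2.2.2.contDiffAt (e.open_target.mem_nhds he.zero_mem_target)

theorem IsLocalCoordinates.contDiffAt_inCoordinates (he : IsLocalCoordinates e)
    (hφ : ContDiffAt ℝ ∞ φ 0) : ContDiffAt ℝ ∞ (inCoordinates φ e) 0 :=
  ContDiffAt.comp (0 : ℝ × ℝ) (by rw [he.symm_zero]; exact hφ) he.contDiffAt_symm

theorem IsLocalCoordinates.finiteType (he : IsLocalCoordinates e) (hφ : FiniteType φ) :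
    FiniteType (inCoordinates φ e) := by
  refine hφ.of_comp (he.contDiffAt_inCoordinates hφ.smooth) he.contDiffAt he.2.1 ?_
  filter_upwards [e.open_source.mem_nhds he.1] with x hx
  simp [inCoordinates, e.left_inv hx]

theorem contDiffAt_transition (h₁ : IsLocalCoordinates e₁) (h₂ : IsLocalCoordinates e₂) :
    ContDiffAt ℝ ∞ (e₂ ∘ e₁.symm) 0 :=
  ContDiffAt.comp (0 : ℝ × ℝ) (by rw [h₁.symm_zero]; exact h₂.contDiffAt) h₁.contDiffAt_symm

theorem transition_zero (h₁ : IsLocalCoordinates e₁) (h₂ : IsLocalCoordinates e₂) :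
    (e₂ ∘ e₁.symm) 0 = 0 := by
  simp [h₁.symm_zero, h₂.2.1]

theorem eventually_symm_mem_source (h₁ : IsLocalCoordinates e₁) (h₂ : IsLocalCoordinates e₂) :
    ∀ᶠ x in 𝓝 (0 : ℝ × ℝ), e₁.symm x ∈ e₂.source := by
  have h := h₁.contDiffAt_symm.continuousAt.tendsto
  rw [h₁.symm_zero] at h
  exact h.eventually (e₂.open_source.mem_nhds h₂.1)

theorem injective_fderiv_transition (h₁ : IsLocalCoordinates e₁) (h₂ : IsLocalCoordinates e₂) :
    Function.Injective (fderiv ℝ (e₂ ∘ e₁.symm) 0) := by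
  have hd₁ := ((contDiffAt_transition h₁ h₂).differentiableAt (by simp)).hasFDerivAt
  have hd₂ := ((contDiffAt_transition h₂ h₁).differentiableAt (by simp)).hasFDerivAt
  rw [← transition_zero h₁ h₂] at hd₂
  have hcomp := hd₂.comp (0 : ℝ × ℝ) hd₁
  have hid : (e₁ ∘ e₂.symm) ∘ (e₂ ∘ e₁.symm) =ᶠ[𝓝 0] id := by
    filter_upwards [eventually_symm_mem_source h₁ h₂,
      e₁.open_target.mem_nhds h₁.zero_mem_target] with x hx hx'
    simp [e₂.left_inv hx, e₁.right_inv hx']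
  have h3 := hcomp.unique ((hasFDerivAt_id (0 : ℝ × ℝ)).congr_of_eventuallyEq hid)
  intro a b hab
  have h4 := congrArg (fun L : ℝ × ℝ →L[ℝ] ℝ × ℝ => L a) h3
  have h5 := congrArg (fun L : ℝ × ℝ →L[ℝ] ℝ × ℝ => L b) h3
  simp only [ContinuousLinearMap.comp_apply, ContinuousLinearMap.id_apply] at h4 h5
  rw [← h4, ← h5, hab]

theorem inCoordinates_transition (h₁ : IsLocalCoordinates e₁) (h₂ : IsLocalCoordinates e₂) :
    inCoordinates φ e₁ =ᶠ[𝓝 0] inCoordinates φ e₂ ∘ (e₂ ∘ e₁.symm) := by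
  filter_upwards [eventually_symm_mem_source h₁ h₂] with x hx
  simp [inCoordinates, e₂.left_inv hx]

theorem isLocalCoordinates_transHomeomorph (he : IsLocalCoordinates e)
    (H : (ℝ × ℝ) ≃ₜ (ℝ × ℝ)) (hH : ContDiff ℝ ∞ H) (hH' : ContDiff ℝ ∞ H.symm) (h0 : H 0 = 0) :
    IsLocalCoordinates (e.transHomeomorph H) := by
  refine ⟨he.1, ?_, ?_, ?_⟩
  · simp [he.2.1, h0]
  · exact hH.comp_contDiffOn he.2.2.1
  · exact he.2.2.2.comp hH'.contDiffOn fun x hx => hx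

theorem contDiff_shear {ψ : ℝ → ℝ} (h : ContDiff ℝ ∞ ψ) : ContDiff ℝ ∞ (shear ψ) :=
  contDiff_fst.prodMk (contDiff_snd.add (h.comp contDiff_fst))

/-- The inverse of a shear as a homeomorphism. -/
def shearHomeomorph (ψ : ℝ → ℝ) (h : Continuous ψ) : (ℝ × ℝ) ≃ₜ (ℝ × ℝ) where
  toFun := shear fun x => -ψ x
  invFun := shear ψ
  left_inv z := by ext <;> simp [shear]
  right_inv z := by ext <;> simp [shear]
  continuous_toFun := by unfold shear; fun_prop
  continuous_invFun := by unfold shear; fun_prop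

theorem exists_shear_coordinates (he : IsLocalCoordinates e) {ψ : ℝ → ℝ} (hψ : ContDiff ℝ ∞ ψ)
    (h0 : ψ 0 = 0) : ∃ e', IsLocalCoordinates e' ∧
      ∀ φ, inCoordinates φ e' = inCoordinates φ e ∘ shear ψ :=
  ⟨e.transHomeomorph (shearHomeomorph ψ hψ.continuous),
    isLocalCoordinates_transHomeomorph he _ (contDiff_shear hψ.neg) (contDiff_shear hψ)
      (shear_zero (ψ := fun x => -ψ x) (by simp [h0])), fun _ => rfl⟩

theorem exists_swap_coordinates (he : IsLocalCoordinates e) : ∃ e', IsLocalCoordinates e' ∧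
      ∀ φ, inCoordinates φ e' = inCoordinates φ e ∘ Prod.swap :=
  ⟨e.transHomeomorph (Homeomorph.prodComm ℝ ℝ),
    isLocalCoordinates_transHomeomorph he _ (contDiff_snd.prodMk contDiff_fst)
      (contDiff_snd.prodMk contDiff_fst) rfl, fun _ => rfl⟩

theorem isLocalCoordinates_refl : IsLocalCoordinates (OpenPartialHomeomorph.refl (ℝ × ℝ)) :=
  ⟨trivial, rfl, contDiffOn_id, contDiffOn_id⟩

theorem exists_good_coordinates (hφ : FiniteType φ) :
    ∃ e, IsLocalCoordinates e ∧ Good (inCoordinates φ e) := by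
  obtain ⟨f', hf', ψ, hψ, h0, hgood⟩ := exists_good hφ
  have h1 : ∃ e, IsLocalCoordinates e ∧ inCoordinates φ e = f' := by
    rcases hf' with rfl | rfl
    · exact ⟨_, isLocalCoordinates_refl, rfl⟩
    · obtain ⟨e', he', h⟩ := exists_swap_coordinates isLocalCoordinates_refl
      exact ⟨e', he', h φ⟩
  obtain ⟨e, he, rfl⟩ := h1
  obtain ⟨e', he', h⟩ := exists_shear_coordinates he hψ h0
  exact ⟨e', he', by rw [h]; exact hgood⟩

theorem Good.isGreatest (hφ : FiniteType φ) (he : IsLocalCoordinates e)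
    (h : Good (inCoordinates φ e)) :
    IsGreatest {d : ℝ | ∃ e : OpenPartialHomeomorph (ℝ × ℝ) (ℝ × ℝ),
      IsLocalCoordinates e ∧ d = distance (inCoordinates φ e)} (distance (inCoordinates φ e)) := by
  refine ⟨⟨e, he, rfl⟩, ?_⟩
  rintro _ ⟨e', he', rfl⟩
  exact h.distance_le (he.finiteType hφ) (he'.contDiffAt_inCoordinates hφ.smooth)
    (contDiffAt_transition he he') (transition_zero he he') (injective_fderiv_transition he he')
    (inCoordinates_transition he he')

theorem Good.isAdapted (hφ : FiniteType φ) (he : IsLocalCoordinates e)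
    (h : Good (inCoordinates φ e)) : IsAdapted φ e :=
  ⟨he, (h.isGreatest hφ he).csSup_eq⟩

/-- Good coordinates attain the supremum, so the set is bounded and the default value of `sSup` does
not intervene. -/
theorem distance_le_height (hφ : FiniteType φ) (he : IsLocalCoordinates e) :
    distance (inCoordinates φ e) ≤ height φ := by
  obtain ⟨e', he', hgood⟩ := exists_good_coordinates hφ
  have h := hgood.isGreatest hφ he'
  rw [height, h.csSup_eq]
  exact h.2 ⟨e, he, rfl⟩

/-- Shearing away a bad root would push the distance above the height. -/
theorem IsAdapted.good (hφ : FiniteType φ) (he : IsAdapted φ e) : Good (inCoordinates φ e) := by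
  have key : ∀ e, IsAdapted φ e → ∀ k c, ¬ Bad (inCoordinates φ e) k c := by
    intro e he k c hb
    have h1 := hb.lt_distance (he.1.finiteType hφ)
    obtain ⟨e', he', h⟩ := exists_shear_coordinates he.1
      (ψ := fun s => c * s ^ k) (by fun_prop) (monomial_zero c hb.one_le)
    have h2 := distance_le_height hφ he'
    rw [h, he.2] at h2
    linarith
  refine ⟨key e he, ?_⟩
  obtain ⟨e', he', h⟩ := exists_swap_coordinates he.1
  rw [← h φ]
  refine key e' ⟨he', ?_⟩
  have hf := he.1.finiteType hφ
  rw [h, distance_swap hf.smooth hf.nonempty, he.2]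

end

/-! ### Roots of the principal part on the unit circle -/

section

variable {f g : ℝ × ℝ → ℝ}

/-- The operator `X P' - (deg P) P` deletes exactly the top monomial and lowers the multiplicity of
a root by at most one; a single monomial has no nonzero root. -/
theorem lt_card_support_of_pow_dvd {P : Polynomial ℝ} (hP : P ≠ 0) {v : ℝ} (hv : v ≠ 0) {m : ℕ}
    (h : (Polynomial.X - Polynomial.C v) ^ m ∣ P) : m < P.support.card := by
  induction m generalizing P with
  | zero => exact Finset.card_pos.2 (Polynomial.nonempty_support_iff.2 hP)
  | succ m ih =>
    set R : Polynomial ℝ := Polynomial.X * Polynomial.derivative P -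
      Polynomial.C (P.natDegree : ℝ) * P with hR
    have hcoeff : ∀ i, R.coeff i = ((i : ℝ) - P.natDegree) * P.coeff i := by
      intro i
      rw [hR, Polynomial.coeff_sub, Polynomial.coeff_C_mul]
      cases i with
      | zero => simp
      | succ i => rw [Polynomial.coeff_X_mul, Polynomial.coeff_derivative]; push_cast; ring
    have hsupp : R.support = P.support.erase P.natDegree := by
      ext i
      rw [Polynomial.mem_support_iff, hcoeff, Finset.mem_erase, Polynomial.mem_support_iff,
        mul_ne_zero_iff, sub_ne_zero, Nat.cast_injective.ne_iff]
    have hcard : R.support.card + 1 = P.support.card := by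
      rw [hsupp]
      exact Finset.card_erase_add_one (Polynomial.natDegree_mem_support_of_nonzero hP)
    have hdvd : (Polynomial.X - Polynomial.C v) ^ m ∣ R :=
      dvd_sub (Dvd.dvd.mul_left (Polynomial.pow_sub_one_dvd_derivative_of_pow_dvd h) _)
        (Dvd.dvd.mul_left ((pow_dvd_pow _ m.le_succ).trans h) _)
    by_cases hR0 : R = 0
    · exfalso
      rw [hR0, Polynomial.support_zero, Finset.card_empty, zero_add] at hcard
      obtain ⟨k, a, ha, hPa⟩ := Polynomial.card_support_eq_one.1 hcard.symm
      have : P.IsRoot v := Polynomial.dvd_iff_isRoot.1 ((dvd_pow_self _ m.succ_ne_zero).trans h)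
      rw [hPa, Polynomial.IsRoot.def] at this
      simp [ha, hv] at this
    · have := ih hR0 hdvd
      omega

theorem iteratedDeriv_eval (P : Polynomial ℝ) (i : ℕ) :
    iteratedDeriv i (fun t => P.eval t) = fun t => (Polynomial.derivative^[i] P).eval t := by
  induction i generalizing P with
  | zero => simp
  | succ i ih =>
    rw [iteratedDeriv_succ', Function.iterate_succ_apply, ← ih]
    congr 1
    ext t
    exact P.deriv

/-- The weighted homogeneous part of degree `N` as a function on the plane. -/
noncomputable def edgeFun (f : ℝ × ℝ → ℝ) (p q N : ℕ) (x : ℝ × ℝ) : ℝ :=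
  initForm f p q N x.1 x.2

theorem contDiff_edgeFun (f : ℝ × ℝ → ℝ) (p q N : ℕ) : ContDiff ℝ ∞ (edgeFun f p q N) := by
  unfold edgeFun initForm
  fun_prop

theorem edgeFun_swap (hf : ContDiffAt ℝ ∞ f 0) (p q N : ℕ) :
    edgeFun (f ∘ Prod.swap) q p N = edgeFun f p q N ∘ Prod.swap := by
  ext x
  simp only [edgeFun, initForm, Function.comp_apply, Prod.fst_swap, Prod.snd_swap]
  refine Finset.sum_nbij' Prod.swap Prod.swap ?_ ?_ (fun _ _ => rfl) (fun _ _ => rfl) ?_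
  · intro y hy
    simp only [line, mem_filter, mem_product, mem_range, Prod.fst_swap, Prod.snd_swap] at hy ⊢
    omega
  · intro y hy
    simp only [line, mem_filter, mem_product, mem_range, Prod.fst_swap, Prod.snd_swap] at hy ⊢
    omega
  · intro y _
    rw [taylorCoeff_swap hf, Prod.fst_swap, Prod.snd_swap]
    ring

theorem vanishingOrder_swap (hg : ContDiff ℝ ∞ g) (x : ℝ × ℝ) :
    vanishingOrder (g ∘ Prod.swap) x = vanishingOrder g x.swap := by
  have key : ∀ j k, taylorCoeff (g ∘ Prod.swap) x j k = taylorCoeff g x.swap k j := by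
    intro j k
    rw [taylorCoeff_translate, taylorCoeff_translate g]
    have : (fun h => (g ∘ Prod.swap) (x + h)) = (fun h => g (x.swap + h)) ∘ Prod.swap := by
      ext h; simp
    rw [this, taylorCoeff_swap]
    exact (hg.comp (contDiff_const.add contDiff_id)).contDiffAt
  unfold vanishingOrder
  apply le_antisymm
  · refine le_iInf₂ fun y hy => ?_
    refine (iInf₂_le y.swap ?_).trans ?_
    · simpa [taylorSupport, key] using hy
    · simp [add_comm]
  · refine le_iInf₂ fun y hy => ?_
    refine (iInf₂_le y.swap ?_).trans ?_
    · simpa [taylorSupport, key] using hy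
    · simp [add_comm]

theorem circleOrder_swap (hg : ContDiff ℝ ∞ g) :
    circleOrder (g ∘ Prod.swap) = circleOrder g := by
  unfold circleOrder
  apply le_antisymm
  · refine iSup₂_le fun x hx => ?_
    rw [vanishingOrder_swap hg]
    refine le_iSup₂ (f := fun (x : ℝ × ℝ) (_ : x ∈ {x : ℝ × ℝ | x.1 ^ 2 + x.2 ^ 2 = 1}) =>
      vanishingOrder g x) x.swap ?_
    simpa [add_comm] using hx
  · refine iSup₂_le fun x hx => ?_
    have : vanishingOrder g x = vanishingOrder (g ∘ Prod.swap) x.swap := by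
      rw [vanishingOrder_swap hg, Prod.swap_swap]
    rw [this]
    refine le_iSup₂ (f := fun (x : ℝ × ℝ) (_ : x ∈ {x : ℝ × ℝ | x.1 ^ 2 + x.2 ^ 2 = 1}) =>
      vanishingOrder (g ∘ Prod.swap) x) x.swap ?_
    simpa [add_comm] using hx

theorem pow_dvd_edgePoly {p q N m : ℕ} {x : ℝ × ℝ}
    (hm : (m : ℕ∞) ≤ vanishingOrder (edgeFun f p q N) x) :
    (Polynomial.X - Polynomial.C x.2) ^ m ∣ edgePoly f p q N x.1 := by
  by_cases hP : edgePoly f p q N x.1 = 0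
  · rw [hP]; exact dvd_zero _
  rw [← Polynomial.le_rootMultiplicity_iff hP]
  cases m with
  | zero => exact Nat.zero_le _
  | succ m =>
    refine Polynomial.lt_rootMultiplicity_of_isRoot_iterate_derivative hP fun i hi => ?_
    have h0 : taylorCoeff (edgeFun f p q N) x 0 i = 0 := by
      by_contra hne
      have h1 := hm.trans (iInf₂_le (0, i) hne)
      have h2 : m + 1 ≤ 0 + i := by exact_mod_cast h1
      omega
    have h1 : (fun t => edgeFun f p q N (x.1, t)) = fun t => (edgePoly f p q N x.1).eval t := by
      ext t; rw [edgePoly_eval]; rfl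
    rw [taylorCoeff, iteratedDeriv_zero, h1, iteratedDeriv_eval, div_eq_zero_iff] at h0
    refine h0.resolve_right ?_
    positivity

/-- The line `p j + q k = N` supports the Newton polyhedron of `f` along an edge which contains the
point `(d, d)` in its relative interior, where `d` is the Newton distance. -/
structure EdgeLine (f : ℝ × ℝ → ℝ) (p q N : ℕ) : Prop where
  hp : 1 ≤ p
  hq : 1 ≤ q
  coprime : Nat.Coprime p q
  ord : OrdGE f p q N
  weight : (N : ℝ) = ((p : ℝ) + q) * distance f
  below : ∃ x ∈ taylorSupport f 0, p * x.1 + q * x.2 = N ∧ (x.2 : ℝ) < distance f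
  left : ∃ x ∈ taylorSupport f 0, p * x.1 + q * x.2 = N ∧ (x.1 : ℝ) < distance f

theorem EdgeData.edgeLine {F : Set (ℝ × ℝ)} {p q N : ℕ} (h : EdgeData f F p q N) :
    EdgeLine f p q N :=
  ⟨h.hp, h.hq, h.coprime, h.ord, h.weight, h.below, h.left⟩

theorem EdgeLine.swap {p q N : ℕ} (hf : FiniteType f) (h : EdgeLine f p q N) :
    EdgeLine (f ∘ Prod.swap) q p N where
  hp := h.hq
  hq := h.hp
  coprime := h.coprime.symm
  ord := h.ord.swap hf.smooth
  weight := by rw [distance_swap hf.smooth hf.nonempty, h.weight]; ring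
  below := by
    obtain ⟨x, hx, hl, hd⟩ := h.left
    refine ⟨x.swap, (mem_taylorSupport_swap hf.smooth).2 (by simpa using hx), ?_, ?_⟩
    · simp only [Prod.fst_swap, Prod.snd_swap]; omega
    · rwa [distance_swap hf.smooth hf.nonempty]
  left := by
    obtain ⟨x, hx, hl, hd⟩ := h.below
    refine ⟨x.swap, (mem_taylorSupport_swap hf.smooth).2 (by simpa using hx), ?_, ?_⟩
    · simp only [Prod.fst_swap, Prod.snd_swap]; omega
    · rwa [distance_swap hf.smooth hf.nonempty]

theorem EdgeLine.distance_pos {p q N : ℕ} (h : EdgeLine f p q N) : 0 < distance f := by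
  obtain ⟨x, -, -, hd⟩ := h.below
  exact (Nat.cast_nonneg _).trans_lt hd

theorem EdgeLine.edgePoly_ne_zero {p q N : ℕ} (h : EdgeLine f p q N) {u : ℝ} (hu : u ≠ 0) :
    edgePoly f p q N u ≠ 0 := by
  obtain ⟨y, hy, hl, -⟩ := h.below
  intro h0
  have := edgePoly_coeff (f := f) h.hp h.hq (u := u) hl
  rw [h0, Polynomial.coeff_zero] at this
  exact mul_ne_zero hy (pow_ne_zero _ hu) this.symm

/-- On this axis the multiplicity is at most the second exponent of the point in `below`, which is
less than `d`. -/
theorem EdgeLine.snd_ne_zero {p q N m : ℕ} (h : EdgeLine f p q N) (hdm : distance f ≤ m)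
    {x : ℝ × ℝ} (hx : x.1 ^ 2 + x.2 ^ 2 = 1)
    (hm : (m : ℕ∞) ≤ vanishingOrder (edgeFun f p q N) x) : x.2 ≠ 0 := by
  intro h2
  have hu : x.1 ≠ 0 := by rintro h1; simp [h1, h2] at hx
  have hdvd := pow_dvd_edgePoly hm
  rw [h2, Polynomial.C_0, sub_zero, Polynomial.X_pow_dvd_iff] at hdvd
  obtain ⟨y, hy, hl, hd⟩ := h.below
  have := hdvd y.2 (by exact_mod_cast hd.trans_le hdm)
  rw [edgePoly_coeff h.hp h.hq hl] at this
  exact mul_ne_zero hy (pow_ne_zero _ hu) this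

theorem EdgeLine.fst_ne_zero {p q N m : ℕ} (hf : FiniteType f) (h : EdgeLine f p q N)
    (hdm : distance f ≤ m) {x : ℝ × ℝ} (hx : x.1 ^ 2 + x.2 ^ 2 = 1)
    (hm : (m : ℕ∞) ≤ vanishingOrder (edgeFun f p q N) x) : x.1 ≠ 0 := by
  have := (h.swap hf).snd_ne_zero (m := m) (x := x.swap)
    (by rwa [distance_swap hf.smooth hf.nonempty]) (by simpa [add_comm] using hx)
  rw [edgeFun_swap hf.smooth, vanishingOrder_swap (contDiff_edgeFun _ _ _ _)] at this
  exact this hm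

/-- By coprimality the second exponents on the line are congruent modulo `p`, and they are at most
`N / q`. -/
theorem EdgeLine.card_support_le {p q N : ℕ} (h : EdgeLine f p q N) (u : ℝ) :
    (edgePoly f p q N u).support.card ≤ N / q / p + 1 := by
  have hline : ∀ k ∈ (edgePoly f p q N u).support, ∃ j, p * j + q * k = N := fun k hk => by
    obtain ⟨j, hj, -⟩ := exists_of_edgePoly_coeff_ne_zero h.hp h.hq
      (Polynomial.mem_support_iff.1 hk)
    exact ⟨j, hj⟩
  rw [← Finset.card_range (N / q / p + 1)]
  refine Finset.card_le_card_of_injOn (fun k => k / p) (fun k hk => ?_) fun k hk l hl hkl => ?_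
  · obtain ⟨j, hj⟩ := hline k hk
    simp only [coe_range, Set.mem_Iio]
    refine Nat.lt_succ_of_le (Nat.div_le_div_right ?_)
    rw [Nat.le_div_iff_mul_le h.hq]
    nlinarith
  · obtain ⟨i, hi⟩ := hline k hk
    obtain ⟨j, hj⟩ := hline l hl
    have hmod : q * k ≡ q * l [MOD p] := by
      have h1 : q * k ≡ N [MOD p] := by
        rw [← hi]; exact (Nat.modEq_iff_dvd' (Nat.le_add_left _ _)).2 (by simp)
      have h2 : q * l ≡ N [MOD p] := by
        rw [← hj]; exact (Nat.modEq_iff_dvd' (Nat.le_add_left _ _)).2 (by simp)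
      exact h1.trans h2.symm
    have hmod' : k % p = l % p := Nat.ModEq.cancel_left_of_coprime h.coprime hmod
    have hkl' : k / p = l / p := hkl
    rw [← Nat.div_add_mod k p, ← Nat.div_add_mod l p, hmod', hkl']

/-- Counting monomials gives `m p q ≤ N ≤ (p + q) m`, so `p q ≤ p + q`; besides a weight 1 this
leaves only `(2, 2)`, which is not coprime. -/
theorem EdgeLine.eq_one {p q N m : ℕ} (hf : FiniteType f) (h : EdgeLine f p q N) (hpq : p ≤ q)
    (hdm : distance f ≤ m) {x : ℝ × ℝ} (hx : x.1 ^ 2 + x.2 ^ 2 = 1)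
    (hm : (m : ℕ∞) ≤ vanishingOrder (edgeFun f p q N) x) : p = 1 := by
  have hlt := lt_card_support_of_pow_dvd (h.edgePoly_ne_zero (h.fst_ne_zero hf hdm hx hm))
    (h.snd_ne_zero hdm hx hm) (pow_dvd_edgePoly hm)
  have hle : m ≤ N / q / p := by have := h.card_support_le x.1; omega
  rw [Nat.le_div_iff_mul_le h.hp, Nat.le_div_iff_mul_le h.hq] at hle
  have hN : N ≤ (p + q) * m := by
    have : (N : ℝ) ≤ ((p + q) * m : ℕ) := by
      rw [h.weight]; push_cast
      exact mul_le_mul_of_nonneg_left hdm (by positivity)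
    exact_mod_cast this
  have hm0 : 0 < m := by exact_mod_cast h.distance_pos.trans_le hdm
  have hpq' : p * q ≤ p + q := by
    refine Nat.le_of_mul_le_mul_left ?_ hm0
    calc m * (p * q) = m * p * q := by ring
      _ ≤ m * (p + q) := by rw [mul_comm m (p + q)]; exact hle.trans hN
  by_contra hp1
  have hp2 : 2 ≤ p := by have := h.hp; omega
  have hp2' : p = 2 := by nlinarith
  have hq2 : q = 2 := by subst hp2'; omega
  have := h.coprime
  rw [hp2', hq2] at this
  norm_num at this

theorem edgePoly_homogeneous (f : ℝ × ℝ → ℝ) (q N : ℕ) (u : ℝ) :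
    (edgePoly f 1 q N u).comp (Polynomial.C (u ^ q) * Polynomial.X) =
      Polynomial.C (u ^ N) * edgePoly f 1 q N 1 := by
  refine Polynomial.funext fun w => ?_
  simp only [Polynomial.eval_comp, Polynomial.eval_mul, Polynomial.eval_C, Polynomial.eval_X,
    edgePoly_eval, initForm, Finset.mul_sum]
  refine Finset.sum_congr rfl fun y hy => ?_
  simp only [line, mem_filter] at hy
  rw [← hy.2, mul_pow, ← pow_mul, pow_add]
  ring

theorem edgePoly_shear_monomial (hf : ContDiffAt ℝ ∞ f 0) {q N : ℕ} (hq : 1 ≤ q)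
    (hord : OrdGE f 1 q N) (c : ℝ) :
    edgePoly (f ∘ shear fun s => c * s ^ q) 1 q N 1 =
      (edgePoly f 1 q N 1).comp (Polynomial.X + Polynomial.C c) := by
  refine Polynomial.funext fun w => ?_
  rw [edgePoly_eval, (initForm_shear hf (contDiffAt_monomial c q) (monomial_zero c hq) le_rfl hq
    (wlimOne_monomial c q) hord).2]
  simp [edgePoly_eval]

/-- By homogeneity the root `v` at `u` becomes the root `v / u ^ q` at `u = 1`, which the shear
moves to zero. -/
theorem le_snd_of_pow_dvd (hf : ContDiffAt ℝ ∞ f 0) {q N m : ℕ} (hq : 1 ≤ q)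
    (hord : OrdGE f 1 q N) {u v : ℝ} (hu : u ≠ 0)
    (h : (Polynomial.X - Polynomial.C v) ^ m ∣ edgePoly f 1 q N u) :
    ∀ y ∈ taylorSupport (f ∘ shear fun s => v / u ^ q * s ^ q) 0, 1 * y.1 + q * y.2 = N →
      m ≤ y.2 := by
  have huq : u ^ q ≠ 0 := pow_ne_zero _ hu
  have h1 : (Polynomial.X - Polynomial.C (v / u ^ q)) ^ m ∣ edgePoly f 1 q N 1 := by
    have h2 := _root_.map_dvd (Polynomial.compRingHom (Polynomial.C (u ^ q) * Polynomial.X)) h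
    rw [map_pow, Polynomial.coe_compRingHom_apply, Polynomial.coe_compRingHom_apply,
      edgePoly_homogeneous] at h2
    have h3 : (Polynomial.X - Polynomial.C v).comp (Polynomial.C (u ^ q) * Polynomial.X) =
        Polynomial.C (u ^ q) * (Polynomial.X - Polynomial.C (v / u ^ q)) := by
      rw [Polynomial.sub_comp, Polynomial.X_comp, Polynomial.C_comp, mul_sub, ← Polynomial.C_mul,
        mul_div_cancel₀ _ huq]
    rw [h3, mul_pow] at h2
    exact (IsUnit.dvd_mul_left (Polynomial.isUnit_C.2 (pow_ne_zero N hu).isUnit)).1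
      ((Dvd.intro_left _ rfl).trans h2)
  intro y hy hl
  by_contra! hlt
  have h2 : Polynomial.X ^ m ∣ edgePoly (f ∘ shear fun s => v / u ^ q * s ^ q) 1 q N 1 := by
    rw [edgePoly_shear_monomial hf hq hord]
    have := _root_.map_dvd (Polynomial.compRingHom (Polynomial.X + Polynomial.C (v / u ^ q))) h1
    rw [map_pow, Polynomial.coe_compRingHom_apply, Polynomial.coe_compRingHom_apply] at this
    simpa using this
  rw [Polynomial.X_pow_dvd_iff] at h2
  have h3 := h2 y.2 hlt
  rw [edgePoly_coeff le_rfl hq hl, one_pow, mul_one] at h3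
  exact hy h3

theorem EdgeLine.exists_root {p q N m : ℕ} (hf : FiniteType f) (h : EdgeLine f p q N)
    (hpq : p ≤ q) (hdm : distance f ≤ m) {x : ℝ × ℝ} (hx : x.1 ^ 2 + x.2 ^ 2 = 1)
    (hm : (m : ℕ∞) ≤ vanishingOrder (edgeFun f p q N) x) :
    p = 1 ∧ ∃ c : ℝ, c ≠ 0 ∧ ∀ y ∈ taylorSupport (f ∘ shear fun s => c * s ^ q) 0,
      1 * y.1 + q * y.2 = N → m ≤ y.2 := by
  obtain rfl := h.eq_one hf hpq hdm hx hm
  have hu := h.fst_ne_zero hf hdm hx hm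
  exact ⟨rfl, x.2 / x.1 ^ q, div_ne_zero (h.snd_ne_zero hdm hx hm) (pow_ne_zero _ hu),
    le_snd_of_pow_dvd hf.smooth h.hq h.ord hu (pow_dvd_edgePoly hm)⟩

/-- A root of multiplicity `⌊d⌋ + 1` would be bad. -/
theorem Good.vanishingOrder_le_of_le {p q N : ℕ} (hf : FiniteType f) (hg : Good f)
    (h : EdgeLine f p q N) (hpq : p ≤ q) {x : ℝ × ℝ} (hx : x.1 ^ 2 + x.2 ^ 2 = 1) :
    vanishingOrder (edgeFun f p q N) x ≤ (⌊distance f⌋₊ : ℕ∞) := by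
  by_contra! hlt
  have hlt' : ((⌊distance f⌋₊ + 1 : ℕ) : ℕ∞) ≤ vanishingOrder (edgeFun f p q N) x := by
    push_cast
    exact Order.add_one_le_of_lt hlt
  have hdm : distance f < (⌊distance f⌋₊ + 1 : ℕ) := by
    push_cast; exact Nat.lt_floor_add_one _
  obtain ⟨rfl, c, hc, hroot⟩ := h.exists_root hf hpq hdm.le hx hlt'
  refine hg.1 q c ⟨h.hq, hc, fun y hy => ?_, fun y hy hl => ?_⟩
  · have h1 := h.ord y hy
    have h2 := h.weight
    have h3 : (N : ℝ) ≤ ((1 * y.1 + q * y.2 : ℕ) : ℝ) := by exact_mod_cast h1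
    push_cast at h2 h3
    linarith
  · refine hdm.trans_le ?_
    have h2 := h.weight
    have h3 : ((1 * y.1 + q * y.2 : ℕ) : ℝ) = N := by push_cast at h2 ⊢; linarith
    exact_mod_cast hroot y hy (by exact_mod_cast h3)

theorem Good.vanishingOrder_le {p q N : ℕ} (hf : FiniteType f) (hg : Good f)
    (h : EdgeLine f p q N) {x : ℝ × ℝ} (hx : x.1 ^ 2 + x.2 ^ 2 = 1) :
    vanishingOrder (edgeFun f p q N) x ≤ (⌊distance f⌋₊ : ℕ∞) := by
  rcases le_total p q with hpq | hpq
  · exact hg.vanishingOrder_le_of_le hf h hpq hx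
  · have := hg.swap.vanishingOrder_le_of_le hf.swap (h.swap hf) hpq (x := x.swap)
      (by simpa [add_comm] using hx)
    rwa [edgeFun_swap hf.smooth, vanishingOrder_swap (contDiff_edgeFun _ _ _ _), Prod.swap_swap,
      distance_swap hf.smooth hf.nonempty] at this

theorem Good.circleOrder_le {p q N : ℕ} (hf : FiniteType f) (hg : Good f)
    (h : EdgeLine f p q N) : circleOrder (edgeFun f p q N) ≤ (⌊distance f⌋₊ : ℕ∞) :=
  iSup₂_le fun _ hx => hg.vanishingOrder_le hf h hx

theorem exists_le_vanishingOrder {m : ℕ} (hm : 0 < m) (h : (m : ℕ∞) ≤ circleOrder g) :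
    ∃ x : ℝ × ℝ, x.1 ^ 2 + x.2 ^ 2 = 1 ∧ (m : ℕ∞) ≤ vanishingOrder g x := by
  by_contra! hlt
  obtain ⟨n, rfl⟩ := Nat.exists_eq_succ_of_ne_zero hm.ne'
  have hle : circleOrder g ≤ (n : ℕ∞) := iSup₂_le fun x hx => by
    have := hlt x hx
    exact Order.le_of_lt_add_one (by exact_mod_cast this)
  have : n + 1 ≤ n := by exact_mod_cast h.trans hle
  omega

end

/-! ### Transport of a vertex to other coordinates -/

section

variable {f g : ℝ × ℝ → ℝ}

theorem DiagVertex.swap (hf : ContDiffAt ℝ ∞ f 0) (h : DiagVertex f) :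
    DiagVertex (f ∘ Prod.swap) := by
  obtain ⟨d, hd, a, b, ha, hb, hab⟩ := h
  refine ⟨d, (mem_taylorSupport_swap hf).2 hd, b, a, hb, ha, fun x hx hne => ?_⟩
  have := hab x.swap ((mem_taylorSupport_swap hf).1 hx) fun h0 => hne (by
    rw [← Prod.swap_swap x, h0]; rfl)
  simp only [Prod.fst_swap, Prod.snd_swap] at this
  linarith

theorem diagVertex_swap_iff (hf : ContDiffAt ℝ ∞ f 0) :
    DiagVertex (f ∘ Prod.swap) ↔ DiagVertex f := by
  refine ⟨fun h => ?_, DiagVertex.swap hf⟩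
  have := h.swap (contDiffAt_comp_swap hf)
  rwa [comp_swap_swap] at this

theorem initForm_eq_pow_snd_mul {p q N d : ℕ}
    (h : ∀ x ∈ taylorSupport f 0, p * x.1 + q * x.2 = N → d ≤ x.2) :
    ∃ Q : ℝ × ℝ → ℝ, Continuous Q ∧ ∀ u v, initForm f p q N u v = v ^ d * Q (u, v) := by
  refine ⟨fun w => ∑ x ∈ line p q N, taylorCoeff f 0 x.1 x.2 * w.1 ^ x.1 * w.2 ^ (x.2 - d),
    by fun_prop, fun u v => ?_⟩
  rw [initForm, Finset.mul_sum]
  refine Finset.sum_congr rfl fun x hx => ?_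
  by_cases hc : taylorCoeff f 0 x.1 x.2 = 0
  · simp [hc]
  · have hl : p * x.1 + q * x.2 = N := by simp only [line, mem_filter] at hx; exact hx.2
    rw [← pow_mul_pow_sub v (h x hc hl)]
    ring

theorem initForm_eq_pow_fst_mul {p q N d : ℕ}
    (h : ∀ x ∈ taylorSupport f 0, p * x.1 + q * x.2 = N → d ≤ x.1) :
    ∃ Q : ℝ × ℝ → ℝ, Continuous Q ∧ ∀ u v, initForm f p q N u v = u ^ d * Q (u, v) := by
  refine ⟨fun w => ∑ x ∈ line p q N, taylorCoeff f 0 x.1 x.2 * w.1 ^ (x.1 - d) * w.2 ^ x.2,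
    by fun_prop, fun u v => ?_⟩
  rw [initForm, Finset.mul_sum]
  refine Finset.sum_congr rfl fun x hx => ?_
  by_cases hc : taylorCoeff f 0 x.1 x.2 = 0
  · simp [hc]
  · have hl : p * x.1 + q * x.2 = N := by simp only [line, mem_filter] at hx; exact hx.2
    rw [← pow_mul_pow_sub u (h x hc hl)]
    ring

theorem le_vanishingOrder_of_isBigO (hg : ContDiff ℝ ∞ g) {d : ℕ} {y : ℝ × ℝ}
    (h : (fun h => g (y + h)) =O[𝓝 0] (fun h => ‖h‖ ^ d)) : (d : ℕ∞) ≤ vanishingOrder g y := by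
  refine le_iInf₂ fun x hx => ?_
  by_contra! hlt
  have hlt' : x.1 + x.2 < d := by exact_mod_cast hlt
  apply hx
  rw [taylorCoeff_translate]
  exact taylorCoeff_eq_zero_of_isBigO (hg.comp (contDiff_const.add contDiff_id)).contDiffAt h hlt'

/-- If `g` has a factor of multiplicity `d` in linear coordinates, and this factor vanishes on a
curve which connects the origin with a point outside of the open unit disc, then `g` vanishes
of order at least `d` somewhere on the unit circle. -/
theorem le_circleOrder_of_factor (hg : ContDiff ℝ ∞ g) {α β γ : ℝ} (hα : α ≠ 0) (hβ : β ≠ 0)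
    {B Q : ℝ × ℝ → ℝ} (hB : Differentiable ℝ B) (hQ : Continuous Q) {d : ℕ}
    (h : ∀ u v, g (α * u + γ * v, β * v) = B (u, v) ^ d * Q (u, v)) {w : ℝ → ℝ × ℝ}
    (hw : Continuous w) (hw0 : w 0 = 0) (hBw : ∀ t, B (w t) = 0)
    (hw1 : ∃ t, 1 ≤ (α * (w t).1 + γ * (w t).2) ^ 2 + (β * (w t).2) ^ 2) :
    (d : ℕ∞) ≤ circleOrder g := by
  have hcont : Continuous fun t => (α * (w t).1 + γ * (w t).2) ^ 2 + (β * (w t).2) ^ 2 := by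
    fun_prop
  -- By the intermediate value theorem the image of the curve meets the circle. There `B` composed
  -- with the inverse linear map vanishes and is `O(‖z‖)`, so its `d`-th power vanishes to order
  -- `d`.
  obtain ⟨t, ht⟩ := mem_range_of_exists_le_of_exists_ge hcont
    ⟨0, by simp [hw0]⟩ hw1
  set y : ℝ × ℝ := (α * (w t).1 + γ * (w t).2, β * (w t).2) with hy
  set M : ℝ × ℝ → ℝ × ℝ := fun z => ((z.1 - γ * (z.2 / β)) / α, z.2 / β) with hM
  have hMd : Differentiable ℝ fun z : ℝ × ℝ => M (y + z) := by
    intro z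
    rw [hM]
    fun_prop
  have hMy : M (y + 0) = w t := by
    ext <;> simp only [hM, hy, add_zero] <;> field_simp
    ring
  have hgM : ∀ z, g z = B (M z) ^ d * Q (M z) := by
    intro z
    rw [← h]
    congr 1
    ext <;> simp only <;> field_simp
    ring
  refine le_trans (le_vanishingOrder_of_isBigO (y := y) hg ?_)
    (le_iSup₂ (f := fun (x : ℝ × ℝ) (_ : x ∈ {x : ℝ × ℝ | x.1 ^ 2 + x.2 ^ 2 = 1}) =>
      vanishingOrder g x) y ht)
  have hB1 : (fun z => B (M (y + z))) =O[𝓝 0] fun z : ℝ × ℝ => ‖z‖ := by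
    have := ((hB.comp hMd) (0 : ℝ × ℝ)).isBigO_sub
    simpa only [Function.comp_def, hMy, hBw, sub_zero] using this.norm_right
  have hQ1 : (fun z => Q (M (y + z))) =O[𝓝 0] fun _ : ℝ × ℝ => (1 : ℝ) :=
    ((hQ.comp hMd.continuous).tendsto (0 : ℝ × ℝ)).isBigO_one ℝ
  simpa [hgM] using (hB1.pow d).mul hQ1

/-- The supporting line at the vertex cuts the given line at `(d, d)` and leaves the support on one
half of it; the sign of `p b - a q` tells which. -/
theorem DiagVertex.le_snd_or_le_fst (h : DiagVertex f) {d : ℕ} (hd : (d : ℝ) = distance f)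
    {p q N : ℕ} (hp : 1 ≤ p) (hq : 1 ≤ q) (hN : N = (p + q) * d) :
    (∀ x ∈ taylorSupport f 0, p * x.1 + q * x.2 = N → d ≤ x.2) ∨
      ∀ x ∈ taylorSupport f 0, p * x.1 + q * x.2 = N → d ≤ x.1 := by
  obtain ⟨d', hd', -, a, b, ha, hb, hab⟩ := h.spec
  obtain rfl : d' = d := by exact_mod_cast hd'.trans hd.symm
  have hp' : (0 : ℝ) < p := by exact_mod_cast hp
  have hq' : (0 : ℝ) < q := by exact_mod_cast hq
  have key : ∀ x ∈ taylorSupport f 0, p * x.1 + q * x.2 = N → x ≠ (d', d') →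
      0 < (p * b - a * q) * ((x.2 : ℝ) - d') ∧ (p : ℝ) * (x.1 - d') = -(q * ((x.2 : ℝ) - d')) := by
    intro x hx hl hne
    have h1 := hab x hx hne
    have h2 : (p : ℝ) * x.1 + q * x.2 = (p + q) * d' := by rw [hN] at hl; exact_mod_cast hl
    refine ⟨?_, by linarith⟩
    have h3 : (p * b - a * q) * ((x.2 : ℝ) - d') =
      p * (a * x.1 + b * x.2 - (a + b) * d') := by linear_combination (-a) * h2
    rw [h3]
    exact mul_pos hp' (by linarith)
  rcases le_total 0 ((p : ℝ) * b - a * q) with hs | hs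
  · left
    intro x hx hl
    by_cases hne : x = (d', d')
    · rw [hne]
    · have := (pos_of_mul_pos_right (key x hx hl hne).1 hs)
      exact_mod_cast (sub_pos.1 this).le
  · right
    intro x hx hl
    by_cases hne : x = (d', d')
    · rw [hne]
    · obtain ⟨h1, h2⟩ := key x hx hl hne
      have h3 : (x.2 : ℝ) - d' < 0 := by
        by_contra! hc
        exact absurd h1 (not_lt.2 (mul_nonpos_of_nonpos_of_nonneg hs hc))
      have h4 : 0 < (p : ℝ) * (x.1 - d') := by rw [h2]; nlinarith
      exact_mod_cast (sub_pos.1 (pos_of_mul_pos_right h4 hp'.le)).le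

/-- The low point for the weights `(1, k)` has weight at least `(p + q) d`, which forces the line of
weights `(1, k)` to pass through `(d, d)`. As `p k < q`, the points of the line `N` to the left of
`(d, d)` fall below it. -/
theorem Good.le_fst_of_leading (hf : FiniteType f) (hgood : Good f) {d : ℕ}
    (hd : (d : ℝ) = distance f) {ψ : ℝ → ℝ} (hψ : ContDiffAt ℝ ∞ ψ 0) (h0 : ψ 0 = 0)
    {p q N k : ℕ} (hp : 1 ≤ p) (hord : OrdGE (f ∘ Newton.shear ψ) p q N) (hN : N = (p + q) * d)
    (hk : 1 ≤ k) (hkq : p * k < q) {c : ℝ} (hc : c ≠ 0)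
    (hlead : (fun x => ψ x - c * x ^ k) =O[𝓝 0] (fun x => x ^ (k + 1))) :
    ∀ x ∈ taylorSupport (f ∘ Newton.shear ψ) 0, p * x.1 + q * x.2 = N → d ≤ x.1 := by
  have hlim : WLimOne ψ 1 k (fun u => c * u ^ k) := by
    simpa using wlimOne_leading (p := 1) le_rfl hlead
  obtain ⟨D, hD, hDx⟩ := exists_ordGE hf.nonempty 1 k
  obtain ⟨x, hx, hxl, hxd⟩ := Good.exists_low_point hf hgood.1 hk hD hDx hc hψ h0 hlim
  have hzD := (initForm_shear hf.smooth hψ h0 le_rfl hk hlim hD).1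
  have hDle := OrdGE.cast_le hf.nonempty hD
  rw [← hd] at hxd hDle
  have hxd' : x.2 ≤ d := by exact_mod_cast hxd
  have hDle' : D ≤ (1 + k) * d := by
    have : (D : ℝ) ≤ ((1 + k) * d : ℕ) := by push_cast; simpa using hDle
    exact_mod_cast this
  have hxN := hord x hx
  have hDeq : (1 + k) * d ≤ D := by
    by_contra! hlt
    zify at *
    have h1 : p * (x.1 : ℤ) + p * k * x.2 < p * ((1 + k) * d) := by nlinarith
    nlinarith
  intro y hy hl
  have hyD := hDeq.trans (hzD y hy)
  by_contra! hlt
  rw [hN] at hl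
  zify at *
  nlinarith

theorem Good.le_circleOrder_of_le (hf : FiniteType f) (hgood : Good f) (hV : DiagVertex f)
    (hg : ContDiffAt ℝ ∞ g 0) {E : ℝ × ℝ → ℝ × ℝ} (hE : ContDiffAt ℝ ∞ E 0) (hE0 : E 0 = 0)
    (hinj : Function.Injective (fderiv ℝ E 0)) (hfg : f =ᶠ[𝓝 0] g ∘ E) {d : ℕ}
    (hd : (d : ℝ) = distance f) {p q N : ℕ} (hp : 1 ≤ p) (hpq : p ≤ q) (hord : OrdGE g p q N)
    (hN : N = (p + q) * d) : (d : ℕ∞) ≤ circleOrder (edgeFun g p q N) := by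
  obtain ⟨f', hf', ψ, hψ, h0, α, β, γ, hα, hβ, hform⟩ :=
    exists_normal_form hf hg hE hE0 hinj hfg
  obtain ⟨hf1, hgood1, hV1, hd1⟩ :
      FiniteType f' ∧ Good f' ∧ DiagVertex f' ∧ (d : ℝ) = distance f' := by
    rcases hf' with rfl | rfl
    · exact ⟨hf, hgood, hV, hd⟩
    · exact ⟨hf.swap, hgood.swap, hV.swap hf.smooth,
        hd.trans (distance_swap hf.smooth hf.nonempty).symm⟩
  obtain ⟨hz, hzg⟩ := hform p q N hp hpq hord
  have hq := hp.trans hpq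
  have hfst : (∃ Q : ℝ × ℝ → ℝ, Continuous Q ∧
      ∀ u v, initForm (f' ∘ shear ψ) p q N u v = u ^ d * Q (u, v)) →
      (d : ℕ∞) ≤ circleOrder (edgeFun g p q N) := by
    rintro ⟨Q, hQ, hfac⟩
    refine le_circleOrder_of_factor (contDiff_edgeFun g p q N) hα hβ (B := Prod.fst) (Q := Q)
      (γ := if p = q then γ else 0) differentiable_fst hQ (fun u v => ?_) (w := fun t => (0, t))
      (by fun_prop) rfl (fun _ => rfl) ⟨β⁻¹, ?_⟩
    · rw [← hfac, hzg]; rfl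
    · rw [mul_inv_cancel₀ hβ]
      nlinarith [sq_nonneg (α * 0 + (if p = q then γ else 0) * β⁻¹)]
  rcases wlimOne_cases hψ h0 hp hq with ⟨k, hk, hkq, c, hc, hlead⟩ | ⟨k, hk, -, c, -, hlim⟩
  · exact hfst (initForm_eq_pow_fst_mul
      (hgood1.le_fst_of_leading hf1 hd1 hψ h0 hp hz hN hk hkq hc hlead))
  have hord1 := (ordGE_shear_iff hf1.smooth hψ h0 hp hq hlim).1 hz
  have hshear := (initForm_shear hf1.smooth hψ h0 hp hq hlim hord1).2
  rcases hV1.le_snd_or_le_fst hd1 hp hq hN with hsnd | hle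
  · obtain ⟨Q, hQ, hfac⟩ := initForm_eq_pow_snd_mul hsnd
    refine le_circleOrder_of_factor (contDiff_edgeFun g p q N) hα hβ
      (B := fun w => w.2 + c * w.1 ^ k) (Q := fun w => Q (w.1, w.2 + c * w.1 ^ k))
      (γ := if p = q then γ else 0) (by fun_prop) (by fun_prop) (fun u v => ?_)
      (w := fun t => (t, -(c * t ^ k))) (by fun_prop) ?_ (fun t => by simp) ?_
    · rw [← hfac, ← hshear, hzg]; rfl
    · ext <;> simp [show k ≠ 0 by omega]
    · by_cases hc : c = 0
      · refine ⟨α⁻¹, ?_⟩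
        simp [hc, mul_inv_cancel₀ hα]
      -- At this parameter the second coordinate alone has absolute value at least 1, since `T ≥ 1`
      -- gives `T ≤ T ^ k`.
      · refine ⟨max 1 |β * c|⁻¹, ?_⟩
        set T := max 1 |β * c|⁻¹
        have hT : 1 ≤ T := le_max_left _ _
        have hpos : 0 < |β * c| := abs_pos.2 (mul_ne_zero hβ hc)
        have h1 : 1 ≤ |β * c| * T ^ k := by
          calc 1 = |β * c| * |β * c|⁻¹ := (mul_inv_cancel₀ hpos.ne').symm
            _ ≤ |β * c| * T := mul_le_mul_of_nonneg_left (le_max_right _ _) hpos.le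
            _ ≤ |β * c| * T ^ k :=
              mul_le_mul_of_nonneg_left (le_self_pow₀ hT (by omega)) hpos.le
        have h2 : (β * -(c * T ^ k)) ^ 2 = (|β * c| * T ^ k) ^ 2 := by
          rw [mul_pow |β * c|, sq_abs]; ring
        simp only [h2]
        nlinarith [sq_nonneg (α * T + (if p = q then γ else 0) * -(c * T ^ k))]
  · obtain ⟨Q, hQ, hfac⟩ := initForm_eq_pow_fst_mul hle
    exact hfst ⟨fun w => Q (w.1, w.2 + c * w.1 ^ k), by fun_prop, fun u v => by
      rw [hshear, hfac]⟩

/-- If the Newton polyhedron of `g` lies above the horizontal line through `(d, d)`, and `g` can be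
transformed into a function of the same Newton distance `d` whose principal face is a vertex, then
the principal face of `g` is a vertex. -/
theorem DiagVertex.of_le_snd (hf : FiniteType f) (hV : DiagVertex f)
    (hg : ContDiffAt ℝ ∞ g 0) {E : ℝ × ℝ → ℝ × ℝ} (hE : ContDiffAt ℝ ∞ E 0) (hE0 : E 0 = 0)
    (hinj : Function.Injective (fderiv ℝ E 0)) (hfg : f =ᶠ[𝓝 0] g ∘ E)
    (hdist : distance g = distance f) (hle : ∀ x ∈ taylorSupport g 0, distance g ≤ x.2) :
    DiagVertex g := by
  have hgF : FiniteType g := hf.of_comp hg hE hE0 hfg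
  obtain ⟨d, hd, -⟩ := hV.spec
  have hgd : distance g = d := hdist.trans hd.symm
  have hle' : ∀ x ∈ taylorSupport g 0, d ≤ x.2 := fun x hx => by
    have := hle x hx; rw [hgd] at this; exact_mod_cast this
  -- The weights `(1, d + 1)` are steep enough to exclude points of height `d + 1` or more.
  have hex : ∃ l, (l, d) ∈ taylorSupport g 0 ∧ l ≤ d := by
    obtain ⟨x, hx, hxw⟩ := exists_weight_le hgF.nonempty (a := 1) (b := (d : ℝ) + 1) zero_le_one
      (by positivity)
    rw [hgd] at hxw
    have h1 : x.1 + (d + 1) * x.2 ≤ (1 + (d + 1)) * d := by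
      have : ((x.1 + (d + 1) * x.2 : ℕ) : ℝ) ≤ ((1 + (d + 1)) * d : ℕ) := by
        push_cast; linarith
      exact_mod_cast this
    have h2 := hle' x hx
    have h3 : x.2 = d := by
      by_contra hne
      have : d + 1 ≤ x.2 := by omega
      nlinarith
    refine ⟨x.1, by rw [← h3]; exact hx, ?_⟩
    rw [h3] at h1
    nlinarith
  classical
  set l := Nat.find hex
  obtain ⟨hl, hld⟩ : (l, d) ∈ taylorSupport g 0 ∧ l ≤ d := Nat.find_spec hex
  have hmin : ∀ x ∈ taylorSupport g 0, x.2 = d → l ≤ x.1 := fun x hx hxd => by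
    by_cases hx1 : x.1 ≤ d
    · exact Nat.find_min' hex ⟨by rw [← hxd]; exact hx, hx1⟩
    · omega
  have hordg : ∀ n, l < n → OrdGE g 1 n (l + n * d) := fun n hn x hx => by
    rcases (hle' x hx).eq_or_lt with h | h
    · have := hmin x hx h.symm
      rw [← h]; omega
    · nlinarith
  clear_value l
  rcases hld.eq_or_lt with hld | hld
  · refine diagVertex_of_snd le_rfl (hordg (d + 1) (by omega)) (d := d)
      (by rwa [hld] at hl) (by rw [hld]; ring) fun x hx hxl hne => ?_
    refine lt_of_le_of_ne (hle' x hx) fun hxd => hne ?_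
    rw [← hxd] at hxl
    ext
    · simp only; omega
    · exact hxd.symm
  exfalso
  obtain ⟨f', hf', ψ, hψ, h0, α, β, γ, hα, hβ, hform⟩ :=
    exists_normal_form hf hg hE hE0 hinj hfg
  obtain ⟨hf1, hV1, hd1⟩ : FiniteType f' ∧ DiagVertex f' ∧ (d : ℝ) = distance f' := by
    rcases hf' with rfl | rfl
    · exact ⟨hf, hV, hd⟩
    · exact ⟨hf.swap, hV.swap hf.smooth, hd.trans (distance_swap hf.smooth hf.nonempty).symm⟩
  have hordz : ∀ n, l < n → OrdGE (f' ∘ shear ψ) 1 n (l + n * d) := fun n hn =>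
    (hform 1 n _ le_rfl (by omega) (hordg n hn)).1
  have hzle : ∀ x ∈ taylorSupport (f' ∘ shear ψ) 0, d ≤ x.2 := fun x hx => by
    by_contra! hlt
    have := hordz (l + x.1 + 1) (by omega) x hx
    nlinarith
  have hlz : (l, d) ∈ taylorSupport (f' ∘ shear ψ) 0 := by
    by_contra hc
    -- With these weights `(l, d)` is the only candidate on its line; `l + 2` is never 1, so the `γ`
    -- term of the normal form is absent.
    have hzero : ∀ v, initForm (f' ∘ shear ψ) 1 (l + 2) (l + (l + 2) * d) 1 v = 0 := fun v => by
      refine Finset.sum_eq_zero fun x hx => ?_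
      rw [mem_line le_rfl (by omega)] at hx
      suffices taylorCoeff (f' ∘ shear ψ) 0 x.1 x.2 = 0 by simp [this]
      by_contra hx0
      have h1 := hzle x hx0
      have h2 : x.2 = d := by
        by_contra hne
        have : d + 1 ≤ x.2 := by omega
        nlinarith
      have h3 : x.1 = l := by rw [h2] at hx; omega
      rw [h2, h3] at hx0
      exact hc hx0
    have hP : edgePoly g 1 (l + 2) (l + (l + 2) * d) α = 0 := by
      refine Polynomial.funext fun w => ?_
      have := (hform 1 (l + 2) _ le_rfl (by omega) (hordg (l + 2) (by omega))).2 1 (w / β)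
      rw [hzero, if_neg (by omega), mul_one, zero_mul, add_zero, mul_div_cancel₀ _ hβ] at this
      rw [edgePoly_eval, ← this, Polynomial.eval_zero]
    have := edgePoly_coeff (f := g) (p := 1) (q := l + 2) (N := l + (l + 2) * d) (u := α) (j := l)
      (k := d) le_rfl (by omega) (by omega)
    rw [hP, Polynomial.coeff_zero] at this
    exact mul_ne_zero hl (pow_ne_zero _ hα) this.symm
  -- A leading term of degree at most `l + 1` would make its line principal, although `(l, d)` lies
  -- below it. Otherwise the shear leaves `(l, d)` in the support of `f'`, against the vertex `(d,
  -- d)`.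
  rcases leading_term hψ h0 (l + 1) with ⟨k, hk, -, c, hc, hlead⟩ | hsmall
  · have hlim : WLimOne ψ 1 k (fun u => c * u ^ k) := by
      simpa using wlimOne_leading (p := 1) le_rfl hlead
    obtain ⟨D, hD, hDx⟩ := exists_ordGE hf1.nonempty 1 k
    have heq := line_eq_of_multiplicity hf1 hk hD hDx hc hψ h0 hlim hd1.ge
      fun x hx _ => hzle x hx
    have hDl := (initForm_shear hf1.smooth hψ h0 le_rfl hk hlim hD).1 _ hlz
    rw [← hd1] at heq
    have heq' : D = (1 + k) * d := by exact_mod_cast heq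
    simp only at hDl
    nlinarith
  · have hlim : WLimOne ψ 1 (l + 1) (fun _ => 0) := wlimOne_of_isBigO le_rfl (by omega) hsmall
    have hord1 := (ordGE_shear_iff hf1.smooth hψ h0 le_rfl (by omega) hlim).1
      (hordz (l + 1) (by omega))
    have hform1 := (initForm_shear hf1.smooth hψ h0 le_rfl (by omega) hlim hord1).2
    have hlf : (l, d) ∈ taylorSupport f' 0 := by
      have := initForm_coeff_eq (f := f' ∘ shear ψ) (g := f') (p := 1) (q := l + 1) le_rfl
        (by omega) (fun v => by rw [hform1, add_zero])
        (show 1 * l + (l + 1) * d = l + (l + 1) * d by omega)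
      change taylorCoeff f' 0 l d ≠ 0
      rw [← this]
      exact hlz
    obtain ⟨d', hd', -, a, b, ha, hb, hab⟩ := hV1.spec
    obtain rfl : d' = d := by exact_mod_cast hd'.trans hd1.symm
    have := hab _ hlf (fun h => hld.ne (congrArg Prod.fst h))
    have hld' : (l : ℝ) < d' := by exact_mod_cast hld
    simp only at this
    nlinarith

end

/-! ### The two implications in adapted coordinates -/

section

variable {φ : ℝ × ℝ → ℝ} {e e₀ : OpenPartialHomeomorph (ℝ × ℝ) (ℝ × ℝ)}

theorem IsAdapted.swap (hφ : FiniteType φ) (he : IsAdapted φ e) :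
    ∃ e', IsAdapted φ e' ∧ inCoordinates φ e' = inCoordinates φ e ∘ Prod.swap := by
  obtain ⟨e', he', hswap⟩ := exists_swap_coordinates he.1
  have hf := he.1.finiteType hφ
  refine ⟨e', ⟨he', ?_⟩, hswap φ⟩
  rw [hswap, distance_swap hf.smooth hf.nonempty, he.2]

theorem IsAdapted.diagVertex_of_le_snd (hφ : FiniteType φ) (he₀ : IsAdapted φ e₀)
    (hV : DiagVertex (inCoordinates φ e₀)) (he : IsAdapted φ e)
    (h : ∀ x ∈ taylorSupport (inCoordinates φ e) 0, distance (inCoordinates φ e) ≤ x.2) :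
    DiagVertex (inCoordinates φ e) :=
  DiagVertex.of_le_snd (he₀.1.finiteType hφ) hV (he.1.contDiffAt_inCoordinates hφ.smooth)
    (contDiffAt_transition he₀.1 he.1) (transition_zero he₀.1 he.1)
    (injective_fderiv_transition he₀.1 he.1) (inCoordinates_transition he₀.1 he.1)
    (he.2.symm.trans he₀.2) h

theorem IsAdapted.diagVertex_of_le_fst (hφ : FiniteType φ) (he₀ : IsAdapted φ e₀)
    (hV : DiagVertex (inCoordinates φ e₀)) (he : IsAdapted φ e)
    (h : ∀ x ∈ taylorSupport (inCoordinates φ e) 0, distance (inCoordinates φ e) ≤ x.1) :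
    DiagVertex (inCoordinates φ e) := by
  have hf := he.1.finiteType hφ
  obtain ⟨e', he', hswap⟩ := he.swap hφ
  refine (diagVertex_swap_iff hf.smooth).1 (hswap ▸ he₀.diagVertex_of_le_snd hφ hV he' ?_)
  rw [hswap, distance_swap hf.smooth hf.nonempty]
  exact fun x hx => h _ ((mem_taylorSupport_swap hf.smooth).1 hx)

theorem IsAdapted.le_circleOrder_of_le (hφ : FiniteType φ) (he₀ : IsAdapted φ e₀)
    (hV : DiagVertex (inCoordinates φ e₀)) (he : IsAdapted φ e) {p q N d : ℕ}
    (h : EdgeLine (inCoordinates φ e) p q N) (hd : (d : ℝ) = distance (inCoordinates φ e))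
    (hpq : p ≤ q) : (d : ℕ∞) ≤ circleOrder (edgeFun (inCoordinates φ e) p q N) := by
  refine (he₀.good hφ).le_circleOrder_of_le (he₀.1.finiteType hφ) hV
    (he.1.contDiffAt_inCoordinates hφ.smooth)
    (contDiffAt_transition he₀.1 he.1) (transition_zero he₀.1 he.1)
    (injective_fderiv_transition he₀.1 he.1) (inCoordinates_transition he₀.1 he.1)
    (hd.trans (he.2.symm.trans he₀.2)) h.hp hpq h.ord ?_
  have := h.weight
  rw [← hd] at this
  exact_mod_cast this

theorem IsAdapted.circleOrder_eq (hφ : FiniteType φ) (he₀ : IsAdapted φ e₀)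
    (hV : DiagVertex (inCoordinates φ e₀)) (he : IsAdapted φ e) {p q N d : ℕ}
    (h : EdgeLine (inCoordinates φ e) p q N) (hd : (d : ℝ) = distance (inCoordinates φ e)) :
    circleOrder (edgeFun (inCoordinates φ e) p q N) = (d : ℕ∞) := by
  have hf := he.1.finiteType hφ
  apply le_antisymm
  · have := (he.good hφ).circleOrder_le hf h
    rwa [← hd, Nat.floor_natCast] at this
  · rcases le_total p q with hpq | hpq
    · exact he₀.le_circleOrder_of_le hφ hV he h hd hpq
    · obtain ⟨e', he', hswap⟩ := he.swap hφ
      have := he₀.le_circleOrder_of_le hφ hV he' (hswap ▸ h.swap hf)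
        (by rw [hswap, distance_swap hf.smooth hf.nonempty, hd]) hpq
      rwa [hswap, edgeFun_swap hf.smooth, circleOrder_swap (contDiff_edgeFun _ _ _ _)] at this

theorem EdgeData.facePart_eq_edgeFun {f : ℝ × ℝ → ℝ} {F : Set (ℝ × ℝ)} {p q N : ℕ}
    (h : EdgeData f F p q N) : facePart f F = edgeFun f p q N :=
  funext h.facePart_eq

/-- If the principal face of `φ` is a vertex in some adapted coordinates, then in all other
adapted coordinates it is a vertex, or a compact edge whose principal part has a root of
multiplicity equal to the height. -/
theorem IsAdapted.principalFace_cases (hφ : FiniteType φ) (he₀ : IsAdapted φ e₀)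
    (hV : DiagVertex (inCoordinates φ e₀)) (he : IsAdapted φ e) :
    ∃ F : Set (ℝ × ℝ), IsPrincipalFace (inCoordinates φ e) F ∧
      (IsVertex F ∨ (IsCompactEdge F ∧ ∃ m : ℕ,
        circleOrder (facePart (inCoordinates φ e) F) = (m : ℕ∞) ∧
          (m : ℝ) = distance (inCoordinates φ e))) := by
  by_cases hVe : DiagVertex (inCoordinates φ e)
  · obtain ⟨F, hF, hFV⟩ := exists_principal_vertex_iff.2 hVe
    exact ⟨F, hF, Or.inl hFV⟩
  rcases principal_cases (he.1.finiteType hφ).nonempty hVe with ⟨F, p, q, N, hF, hE⟩ | h | h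
  · obtain ⟨d, hd, -⟩ := hV.spec
    have hd' : (d : ℝ) = distance (inCoordinates φ e) := by rw [hd, ← he.2, ← he₀.2]
    refine ⟨F, hF, Or.inr ⟨hE.isCompactEdge, d, ?_, hd'⟩⟩
    rw [hE.facePart_eq_edgeFun]
    exact he₀.circleOrder_eq hφ hV he hE.edgeLine hd'
  · exact absurd (he₀.diagVertex_of_le_snd hφ hV he h) hVe
  · exact absurd (he₀.diagVertex_of_le_fst hφ hV he h) hVe

/-- Shearing the root onto the axis keeps the weighted order, so the distance does not drop, and
adaptedness forbids it to rise. -/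
theorem IsAdapted.exists_diagVertex_of_le (hφ : FiniteType φ) (he : IsAdapted φ e) {p q N m : ℕ}
    (h : EdgeLine (inCoordinates φ e) p q N) (hm : (m : ℝ) = distance (inCoordinates φ e))
    (hc : (m : ℕ∞) ≤ circleOrder (edgeFun (inCoordinates φ e) p q N)) (hpq : p ≤ q) :
    ∃ e', IsAdapted φ e' ∧ DiagVertex (inCoordinates φ e') := by
  have hf := he.1.finiteType hφ
  have hm0 : 0 < m := by exact_mod_cast h.distance_pos.trans_eq hm.symm
  obtain ⟨x, hx, hxm⟩ := exists_le_vanishingOrder hm0 hc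
  obtain ⟨rfl, c, -, hroot⟩ := h.exists_root hf hpq hm.ge hx hxm
  have hw : (N : ℝ) = (1 + q) * m := by rw [hm]; simpa using h.weight
  obtain ⟨e', he', hshear⟩ := exists_shear_coordinates he.1 (ψ := fun s => c * s ^ q)
    (by fun_prop) (monomial_zero c h.hq)
  have hf' := he'.finiteType hφ
  have hord : OrdGE (inCoordinates φ e') 1 q N := by
    rw [hshear]
    exact (initForm_shear hf.smooth (contDiffAt_monomial c q) (monomial_zero c h.hq) le_rfl h.hq
      (wlimOne_monomial c q) h.ord).1
  rw [← hshear] at hroot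
  have hle : distance (inCoordinates φ e') ≤ m := by
    rw [hm, ← he.2]; exact distance_le_height hφ he'
  have hge : (m : ℝ) ≤ distance (inCoordinates φ e') := by
    have := hord.cast_le hf'.nonempty
    rw [hw, Nat.cast_one] at this
    exact le_of_mul_le_mul_left this (by positivity)
  have hfst : ∀ y : ℕ × ℕ, 1 * y.1 + q * y.2 = N → y.2 = m → y = (m, m) := by
    intro y hy h2
    have hN : N = (1 + q) * m := by exact_mod_cast hw
    rw [h2, hN] at hy
    ext
    · simp only; linarith
    · exact h2
  -- Without this point all exponents on the line would exceed `m`, and the distance would exceed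
  -- the height.
  have hmem : (m, m) ∈ taylorSupport (inCoordinates φ e') 0 := by
    by_contra hne
    refine absurd hle (not_le.2 (lt_distance_of_line hf' hord (Nat.cast_nonneg m) hw ?_))
    intro y hy hl
    have := lt_of_le_of_ne (hroot y hy hl) fun h2 => hne (hfst y hl h2.symm ▸ hy)
    exact_mod_cast this
  refine ⟨e', ⟨he', ?_⟩, diagVertex_of_snd le_rfl hord hmem (by exact_mod_cast hw) ?_⟩
  · rw [he.2, ← hm]; exact le_antisymm hge hle
  · exact fun y hy hl hne => lt_of_le_of_ne (hroot y hy hl) fun h2 => hne (hfst y hl h2.symm)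

theorem IsAdapted.exists_diagVertex (hφ : FiniteType φ) (he : IsAdapted φ e) {p q N m : ℕ}
    (h : EdgeLine (inCoordinates φ e) p q N) (hm : (m : ℝ) = distance (inCoordinates φ e))
    (hc : circleOrder (edgeFun (inCoordinates φ e) p q N) = (m : ℕ∞)) :
    ∃ e', IsAdapted φ e' ∧ DiagVertex (inCoordinates φ e') := by
  have hf := he.1.finiteType hφ
  rcases le_total p q with hpq | hpq
  · exact he.exists_diagVertex_of_le hφ h hm hc.ge hpq
  · obtain ⟨e', he', hswap⟩ := he.swap hφ
    refine he'.exists_diagVertex_of_le hφ (hswap ▸ h.swap hf)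
      (by rw [hswap, distance_swap hf.smooth hf.nonempty, hm]) ?_ hpq
    rw [hswap, edgeFun_swap hf.smooth, circleOrder_swap (contDiff_edgeFun _ _ _ _), hc]

end

end Newton

end

theorem lemma1p2 (φ : ℝ × ℝ → ℝ) (U : Set (ℝ × ℝ)) (hU : IsOpen U) (h0U : (0 : ℝ × ℝ) ∈ U)
    (hφ : ContDiffOn ℝ ∞ φ U) (hφ0 : φ 0 = 0) (hdφ0 : fderiv ℝ φ 0 = 0)
    (hfin : (Newton.taylorSupport φ 0).Nonempty) :
    (∃ e : OpenPartialHomeomorph (ℝ × ℝ) (ℝ × ℝ), Newton.IsAdapted φ e ∧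
      ∃ F : Set (ℝ × ℝ), Newton.IsPrincipalFace (Newton.inCoordinates φ e) F ∧
        Newton.IsVertex F) ↔
    (∀ e : OpenPartialHomeomorph (ℝ × ℝ) (ℝ × ℝ), Newton.IsAdapted φ e →
      ∃ F : Set (ℝ × ℝ), Newton.IsPrincipalFace (Newton.inCoordinates φ e) F ∧
        (Newton.IsVertex F ∨
          (Newton.IsCompactEdge F ∧
            ∃ m : ℕ,
              Newton.circleOrder (Newton.facePart (Newton.inCoordinates φ e) F) = (m : ℕ∞) ∧
              (m : ℝ) = Newton.distance (Newton.inCoordinates φ e)))) := by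
  have hT : Newton.FiniteType φ := ⟨hφ.contDiffAt (hU.mem_nhds h0U), hfin⟩
  constructor
  · rintro ⟨e₀, he₀, hF⟩ e he
    exact he₀.principalFace_cases hT (Newton.exists_principal_vertex_iff.1 hF) he
  · intro h
    -- The universal condition is not vacuous, since good coordinates exist and are adapted.
    obtain ⟨e, he, hgood⟩ := Newton.exists_good_coordinates hT
    have hadapted := hgood.isAdapted hT he
    obtain ⟨F, hF, hFV | ⟨hE, m, hc, hm⟩⟩ := h e hadapted
    · exact ⟨e, hadapted, F, hF, hFV⟩
    · obtain ⟨p, q, N, hN⟩ := hE.exists_edgeData hF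
      rw [hN.facePart_eq_edgeFun] at hc
      obtain ⟨e', he', hV⟩ := hadapted.exists_diagVertex hT hN.edgeLine hm hc
      exact ⟨e', he', Newton.exists_principal_vertex_iff.2 hV⟩
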